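/- **Setting.** Let $d\ge 3$, let $\mathcal K\subseteq\mathbb R^d$ be closed and convex, $r:\mathbb R^d\to\mathbb R$ convex, $\xi$ a random element, $l(x)=\mathbb E_\xi[l(x;\xi)]$ (with $l(x;\cdot)$ measurable and integrable for each $x$) and $f=l+r$. For $\Phi:\mathbb R^d\to\mathbb R$ differentiable with Bregman divergence $\mathcal B_\Phi(y,x)=\Phi(y)-\Phi(x)-\langle\nabla\Phi(x),y-x\rangle$, put $$\mathcal P^\Phi_{\mathcal K}(x,g,\eta)=\arg\min_{y\in\mathcal K}\langle g,y\rangle+r(y)+\eta\,\mathcal B_\Phi(y,x),\qquad \mathcal G^\Phi_{\mathcal K}(x,g,\eta)=\eta\,(x-\mathcal P^\Phi_{\mathcal K}(x,g,\eta)),$$ and let $\phi(x)=\sum_{i=1}^d\big((|x_i|+\tfrac1d)\ln(d|x_i|+1)-|x_i|\big)$. Let $G,L,R,D,\sigma$ be real numbers with $R,D>0$. Assume: 1. for every realisation $\xi$, $l(\cdot;\xi)$ is differentiable on $\mathbb R^d$, $G$-Lipschitz and has an $L$-Lipschitz gradient, with respect to $\|\cdot\|_2$; 2. $l$ is differentiable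 and $\nabla l(x)=\mathbb E_\xi[\nabla l(x;\xi)]$ for all $x\in\mathbb R^d$; and $\mathbb E_\xi\|\nabla l(x;\xi)-\nabla l(x)\|_2^2\le\sigma^2$ for all $x\in\mathcal K$; 3. $\|\mathcal P^\phi_{\mathcal K}(x,g,\eta)\|_1\le D$ for all $\eta>0$, $x\in\mathcal K$, $g\in\mathbb R^d$ (equivalently, $\mathcal K$ lies in the $\ell_1$ ball of radius $D$); 4. $f(x)\in[0,R]$ for all $x\in\mathcal K$. **Algorithm ZO-ExpStorm.** Let $T,m\ge1$ be integers, $0<\nu\le d^{-1}T^{-2/3}$ and $x_1\in\mathcal K$. Put $$\tau_t=\Big(1+\frac tm\Big)^{2/3},\quad \gamma_t=\frac2{1+\tau_t},\quad \beta_t=\max\Big\{1,\frac{\tau_t-1}{\sqrt{\tau_t}}\Big\},\quad \alpha_t=\sqrt{\beta_t\Big(1+\sum_{s=1}^{t-1}\lambda_s^2\alpha_s^2\|v_s-x_s\|_1^2\Big)},$$ where $\lambda_t=\lambda_t(x_t,v_t)$ are any measurable weights with $\frac1{D+1}\le\lambda_t(x,v)\le1$ for $x,v\in\mathcal K$, for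 example $\lambda_t=\frac1{\max\{\|x_t\|_1,\|v_t\|_1\}+1}$. For $t=1,\dots,T$ draw independent samples $(\xi_{t,j},u_{t,j})$, $j=1,\dots,m$, with $\xi_{t,j}$ distributed as $\xi$ and $u_{t,j}$ an independent vector of $d$ independent Rademacher variables, and set $$g_t=\frac1{m\nu}\sum_{j=1}^m\big(l(x_t+\nu u_{t,j};\xi_{t,j})-l(x_t;\xi_{t,j})\big)u_{t,j},\qquad m_t=\frac1{m\nu}\sum_{j=1}^m\big(l(x_{t-1}+\nu u_{t,j};\xi_{t,j})-l(x_{t-1};\xi_{t,j})\big)u_{t,j}\ \ (t\ge2),$$ $$d_1=g_1,\qquad d_t=g_t+(1-\gamma_t)(d_{t-1}-m_t)\ \ (t\ge2),$$ $$v_t=\mathcal P^\phi_{\mathcal K}(x_t,d_t,\alpha_t),\qquad x_{t+1}=\Big(1-\frac{\alpha_t}{\alpha_{t+1}}\Big)x_t+\frac{\alpha_t}{\alpha_{t+1}}v_t.$$ Let $\theta$ be uniform on $\{1,\dots,T\}$ and independent of the samples; the output is $x_\theta$. Write $\mathcal G_{\mathcal K}=\mathcal G_{\mathcal K}^{(D+1)\phi}$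 and $\eta_t=\frac{\alpha_t}{D+1}$; the function $(D+1)\phi$ is $1$-strongly convex with respect to $\|\cdot\|_1$ on the $\ell_1$ ball of radius $D$, and $\mathcal P^{(D+1)\phi}_{\mathcal K}(x,g,\eta_t)=\mathcal P^{\phi}_{\mathcal K}(x,g,\alpha_t)$. The algorithm evaluates $l(\cdot;\cdot)$ at most $4mT$ times. **Theorem.** (a) $\|\mathcal G_{\mathcal K}(x_\theta,\nabla l(x_\theta),\eta_\theta)\|_1^2$ is integrable and, with $\ln^+s=\max\{0,\ln s\}$ (and $\ln^+0=0$), $$\begin{aligned}\mathbb E\|\mathcal G_{\mathcal K}(x_\theta,\nabla l(x_\theta),\eta_\theta)\|_1^2\le{}&16R^2T^{-\frac23}+T^{-1}\big(4+16R+32L^2(D+1)^2\big)\\&+\frac{648e^2(4\ln d-2)^2(5G^2+4\sigma^2)m^{-\frac13}T^{-\frac23}}5+\frac{2160e(2\ln d-1)L^2T^{-\frac23}}5+72L^2T^{-\frac23}\\&+\frac{648(D+1)^2L^2e(2\ln d-1)T^{-\frac23}}5\ln^+\frac{324(D+1)^2L^2e(2\ln d-1)T^{\frac23}}5.\end{aligned}$$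 (b) There is a constant $C$ depending only on $G,L,R,D,\sigma$ such that, for all $d\ge3$, all $T,m\ge 1$ and all problems, starting points, $\nu$ and $\lambda_t$ as above, $\mathbb E\|\mathcal G_{\mathcal K}(x_\theta,\nabla l(x_\theta),\eta_\theta)\|_1^2\le C(\ln d)^2\,T^{-2/3}(1+\ln T)$. (c) (Oracle complexity.) There are $C$ and $k$ depending only on $G,L,R,D,\sigma$ such that for all $d\ge3$ and $\varepsilon\in(0,1]$ one can choose $T,m\ge1$ for which, for all problems, starting points, $\nu$ and $\lambda_t$ as above, $\mathbb E\|\mathcal G_{\mathcal K}(x_\theta,\nabla l(x_\theta),\eta_\theta)\|_1^2\le\varepsilon^2$ and the algorithm makes at most $C\,\frac{(\ln d)^2}{\varepsilon^3}\big(1+\ln\frac1\varepsilon\big)^k$ evaluations of $l(\cdot;\cdot)$. -/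

import Mathlib

open MeasureTheory ProbabilityTheory

universe u v

noncomputable section

namespace ZOExpStorm

/-- The decision space `ℝ^d`; its built-in norm is the Euclidean norm `‖·‖₂`. -/
abbrev E (d : ℕ) : Type := EuclideanSpace ℝ (Fin d)

/-- The `ℓ₁` norm on `ℝ^d`. -/
def l1Norm {d : ℕ} (x : E d) : ℝ := ∑ i, |x i|

/-! ### Mirror descent -/

/-- The symmetric entropy `φ(x) = ∑ᵢ ((|xᵢ| + 1/d) ln(d|xᵢ| + 1) - |xᵢ|)`. -/
def symEntropy (d : ℕ) (x : E d) : ℝ :=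
  ∑ i, ((|x i| + 1 / (d : ℝ)) * Real.log ((d : ℝ) * |x i| + 1) - |x i|)

/-- The Bregman divergence `B_Φ(y, x)`. -/
def bregman {d : ℕ} (Φ : E d → ℝ) (y x : E d) : ℝ :=
  Φ y - Φ x - inner ℝ (gradient Φ x) (y - x)

/-- The generalised projection `P_K(x, g, η) = argmin_{y ∈ K} ⟨g, y⟩ + r(y) + η B_Φ(y, x)`. -/
def prox {d : ℕ} (K : Set (E d)) (r Φ : E d → ℝ) (x g : E d) (η : ℝ) : E d :=
  Classical.epsilon fun p => p ∈ K ∧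
    IsMinOn (fun y => inner ℝ g y + r y + η * bregman Φ y x) K p

/-- The generalised gradient map `G_K(x, g, η) = η (x - P_K(x, g, η))`. -/
def genGrad {d : ℕ} (K : Set (E d)) (r Φ : E d → ℝ) (x g : E d) (η : ℝ) : E d :=
  η • (x - prox K r Φ x g η)

/-! ### The stochastic composite problem -/

/-- The data of `min_{x ∈ K} f(x) = l(x) + r(x)`, where `l(x) = E_ξ[l(x; ξ)]` and `ξ ∼ P`. -/
structure Problem (d : ℕ) (Ξ : Type u) [MeasurableSpace Ξ] where
  /-- The decision set. -/
  K : Set (E d)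
  /-- The white-box convex part of the objective. -/
  r : E d → ℝ
  /-- The stochastic loss `l(x; ξ)`. -/
  loss : E d → Ξ → ℝ
  /-- The law of `ξ`. -/
  P : Measure Ξ

namespace Problem

variable {d : ℕ} {Ξ : Type u} [MeasurableSpace Ξ]

/-- The gradient in `x` of a realisation, `∇l(x; ξ)`. -/
def sgrad (p : Problem d Ξ) (x : E d) (ξ : Ξ) : E d := gradient (fun y => p.loss y ξ) x

/-- The expected loss `l(x) = E_ξ[l(x; ξ)]`. -/
def l (p : Problem d Ξ) (x : E d) : ℝ := ∫ ξ, p.loss x ξ ∂p.P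

/-- The standing assumptions, with constants `G, L` (for the Euclidean norm), `R`,
`D` (for the `ℓ₁` norm) and `σ`. -/
structure Admissible (p : Problem d Ξ) (G L R D σ : ℝ) : Prop where
  closed : IsClosed p.K
  convex : Convex ℝ p.K
  convex_r : ConvexOn ℝ Set.univ p.r
  prob : IsProbabilityMeasure p.P
  measurable_loss : ∀ x, Measurable (p.loss x)
  integrable_loss : ∀ x, Integrable (p.loss x) p.P
  /-- Every realisation is differentiable, `G`-Lipschitz, with `L`-Lipschitz gradient. -/
  differentiable_loss : ∀ ξ, Differentiable ℝ fun x => p.loss x ξ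
  lipschitz_loss : ∀ ξ x y, |p.loss x ξ - p.loss y ξ| ≤ G * ‖x - y‖
  lipschitz_sgrad : ∀ ξ x y, ‖p.sgrad x ξ - p.sgrad y ξ‖ ≤ L * ‖x - y‖
  /-- Unbiasedness: `l` is differentiable and `∇l(x) = E[∇l(x; ξ)]`. -/
  unbiased : ∀ x, HasGradientAt p.l (∫ ξ, p.sgrad x ξ ∂p.P) x
  /-- `σ²` bounds the variance of the stochastic gradient on `K`. -/
  variance_le : ∀ x ∈ p.K, ∫ ξ, ‖p.sgrad x ξ - gradient p.l x‖ ^ 2 ∂p.P ≤ σ ^ 2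
  /-- The generalised projections onto `K` stay in the `ℓ₁` ball of radius `D`. -/
  bounded : ∀ η > 0, ∀ x ∈ p.K, ∀ g, l1Norm (prox p.K p.r (symEntropy d) x g η) ≤ D
  /-- The objective takes values in `[0, R]` on `K`. -/
  value_mem : ∀ x ∈ p.K, p.l x + p.r x ∈ Set.Icc 0 R

end Problem

/-! ### The parameters of the algorithm -/

/-- `τ_t = (1 + t/m)^{2/3}`. -/
def tau (m t : ℕ) : ℝ := (1 + (t : ℝ) / (m : ℝ)) ^ (2 / 3 : ℝ)

/-- `γ_t = 2 / (1 + τ_t)`. -/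
def gam (m t : ℕ) : ℝ := 2 / (1 + tau m t)

/-- `β_t = max {1, (τ_t - 1) / √τ_t}`. -/
def bet (m t : ℕ) : ℝ := max 1 ((tau m t - 1) / Real.sqrt (tau m t))

/-- `α_t = √(β_t (1 + S))`, where `S = ∑_{s < t} λ_s² α_s² ‖v_s - x_s‖₁²`. -/
def alph (m t : ℕ) (S : ℝ) : ℝ := Real.sqrt (bet m t * (1 + S))

/-! ### The algorithm ZO-ExpStorm -/

/-- The memory of the algorithm at the beginning of iteration `t`. -/
structure State (d : ℕ) where
  /-- `x_t` -/
  x : E d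
  /-- `x_{t-1}` (not used in the first iteration) -/
  xPrev : E d
  /-- `d_{t-1}` (not used in the first iteration) -/
  dPrev : E d
  /-- `∑_{s < t} λ_s² α_s² ‖v_s - x_s‖₁²` -/
  S : ℝ
  /-- the number of evaluations of the oracle `l(·; ·)` so far -/
  calls : ℕ

section Algorithm

variable {d : ℕ} {Ξ : Type u} [MeasurableSpace Ξ]

/-- The mini-batch two-point estimate
`(1 / (mν)) ∑_j (l(x + νu_j; ξ_j) - l(x; ξ_j)) u_j` for the samples `z j = (ξ_j, u_j)`. -/
def estimate (p : Problem d Ξ) {m : ℕ} (ν : ℝ) (z : Fin m → Ξ × E d) (x : E d) : E d :=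
  (1 / ((m : ℝ) * ν)) •
    ∑ j, (p.loss (x + ν • (z j).2) (z j).1 - p.loss x (z j).1) • (z j).2

/-- The number of oracle evaluations made by one mini-batch estimate: two for each sample. -/
def estimateCalls (m : ℕ) : ℕ := ∑ _j : Fin m, 2

/-- Iteration `t` of the algorithm on the mini-batch `z`. The first iteration has no predecessor
and uses `d_1 = g_1`; the later ones use `d_t = g_t + (1 - γ_t)(d_{t-1} - m_t)`. -/
def step (p : Problem d Ξ) (m : ℕ) (ν : ℝ) (lam : ℕ → E d → E d → ℝ) (t : ℕ)
    (z : Fin m → Ξ × E d) (s : State d) : State d :=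
  let gt : E d := estimate p ν z s.x
  let dt : E d :=
    if t = 1 then gt else gt + (1 - gam m t) • (s.dPrev - estimate p ν z s.xPrev)
  let a : ℝ := alph m t s.S
  let vt : E d := prox p.K p.r (symEntropy d) s.x dt a
  let S' : ℝ := s.S + lam t s.x vt ^ 2 * a ^ 2 * l1Norm (vt - s.x) ^ 2
  let a' : ℝ := alph m (t + 1) S'
  { x := (1 - a / a') • s.x + (a / a') • vt
    xPrev := s.x
    dPrev := dt
    S := S'
    calls := s.calls + (if t = 1 then estimateCalls m else estimateCalls m + estimateCalls m) }

/-- The state after `n` iterations started at `x₁` (so at the beginning of iteration `n + 1`);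
`z (t, j) = (ξ_{t,j}, u_{t,j})`. -/
def run (p : Problem d Ξ) (m : ℕ) (ν : ℝ) (lam : ℕ → E d → E d → ℝ) (x₁ : E d)
    (z : ℕ × Fin m → Ξ × E d) : ℕ → State d
  | 0 => { x := x₁, xPrev := x₁, dPrev := 0, S := 0, calls := 0 }
  | n + 1 => step p m ν lam (n + 1) (fun j => z (n + 1, j)) (run p m ν lam x₁ z n)

/-- `x_t`, for `t ≥ 1`. -/
def iter (p : Problem d Ξ) (m : ℕ) (ν : ℝ) (lam : ℕ → E d → E d → ℝ) (x₁ : E d)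
    (z : ℕ × Fin m → Ξ × E d) (t : ℕ) : E d :=
  (run p m ν lam x₁ z (t - 1)).x

/-- `α_t`, for `t ≥ 1`. -/
def iterAlph (p : Problem d Ξ) (m : ℕ) (ν : ℝ) (lam : ℕ → E d → E d → ℝ) (x₁ : E d)
    (z : ℕ × Fin m → Ξ × E d) (t : ℕ) : ℝ :=
  alph m t (run p m ν lam x₁ z (t - 1)).S

/-- `‖G_K(x_t, ∇l(x_t), η_t)‖₁²` for the distance-generating function `(D + 1) φ`, which is
`1`-strongly convex with respect to `‖·‖₁` on the `ℓ₁` ball of radius `D`, and for the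
corresponding stepsize `η_t = α_t / (D + 1)`. -/
def stationarity (p : Problem d Ξ) (D : ℝ) (m : ℕ) (ν : ℝ) (lam : ℕ → E d → E d → ℝ) (x₁ : E d)
    (z : ℕ × Fin m → Ξ × E d) (t : ℕ) : ℝ :=
  l1Norm (genGrad p.K p.r (fun y => (D + 1) * symEntropy d y)
    (iter p m ν lam x₁ z t) (gradient p.l (iter p m ν lam x₁ z t))
    (iterAlph p m ν lam x₁ z t / (D + 1))) ^ 2

end Algorithm

/-! ### The random samples -/

/-- The Rademacher distribution on `ℝ`. -/
def rademacher : Measure ℝ :=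
  (2⁻¹ : ENNReal) • (Measure.dirac (1 : ℝ) + Measure.dirac (-1 : ℝ))

/-- The law of a vector of `d` independent Rademacher variables. -/
def rademacherVec (d : ℕ) : Measure (E d) :=
  (Measure.pi fun _ : Fin d => rademacher).map (WithLp.toLp 2)

/-- `Z (t, j) = (ξ_{t,j}, u_{t,j})` are independent with law `P ⊗ Rademacher^d`, and the output
index `θ` is independent of them and uniform on `{1, …, T}`. -/
structure IsSampling {d : ℕ} {Ξ : Type u} [MeasurableSpace Ξ] {Ω : Type v} [MeasurableSpace Ω]
    (p : Problem d Ξ) (m T : ℕ) (μ : Measure Ω) (Z : ℕ × Fin m → Ω → Ξ × E d) (θ : Ω → ℕ) :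
    Prop where
  prob : IsProbabilityMeasure μ
  measurable_Z : ∀ i, Measurable (Z i)
  measurable_θ : Measurable θ
  law_Z : ∀ i, μ.map (Z i) = p.P.prod (rademacherVec d)
  indep_Z : iIndepFun Z μ
  law_θ : ∀ t ∈ Finset.Icc 1 T, μ (θ ⁻¹' {t}) = (T : ENNReal)⁻¹
  indep_θ : IndepFun θ (fun ω i => Z i ω) μ

/-- `T` iterations with mini-batches of size `m` guarantee
`E ‖G_K(x_θ, ∇l(x_θ), η_θ)‖₁² ≤ b` with at most `N` oracle evaluations, for every problem in
dimension `d` with the constants `G, L, R, D, σ`, every starting point in `K`, every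
`0 < ν ≤ d⁻¹ T^{-2/3}` and all weights `λ_t = λ_t(x_t, v_t)` with values in `[1/(D+1), 1]`. -/
def Guarantee (d T m : ℕ) (G L R D σ b N : ℝ) : Prop :=
  ∀ (Ξ : Type u) [MeasurableSpace Ξ] (p : Problem d Ξ), p.Admissible G L R D σ →
  ∀ x₁ ∈ p.K, ∀ ν : ℝ, 0 < ν → ν ≤ (d : ℝ)⁻¹ * (T : ℝ) ^ (-(2 / 3) : ℝ) →
  ∀ lam : ℕ → E d → E d → ℝ,
    (∀ t, Measurable fun q : E d × E d => lam t q.1 q.2) →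
    (∀ t, ∀ x ∈ p.K, ∀ y ∈ p.K, 1 / (D + 1) ≤ lam t x y ∧ lam t x y ≤ 1) →
  ∀ (Ω : Type v) [MeasurableSpace Ω] (μ : Measure Ω) (Z : ℕ × Fin m → Ω → Ξ × E d) (θ : Ω → ℕ),
    IsSampling p m T μ Z θ →
    Integrable (fun ω => stationarity p D m ν lam x₁ (fun i => Z i ω) (θ ω)) μ ∧
    ∫ ω, stationarity p D m ν lam x₁ (fun i => Z i ω) (θ ω) ∂μ ≤ b ∧
    ∀ ω, ((run p m ν lam x₁ (fun i => Z i ω) T).calls : ℝ) ≤ N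

/-- The explicit bound on `E ‖G_K(x_θ, ∇l(x_θ), η_θ)‖₁²`; here `log⁺ s = max {0, log s}`. -/
def rateBound (d T m : ℕ) (G L R D σ : ℝ) : ℝ :=
  16 * R ^ 2 * (T : ℝ) ^ (-(2 / 3) : ℝ)
  + (T : ℝ)⁻¹ * (4 + 16 * R + 32 * L ^ 2 * (D + 1) ^ 2)
  + 648 * Real.exp 1 ^ 2 * (4 * Real.log d - 2) ^ 2 * (5 * G ^ 2 + 4 * σ ^ 2)
      * (m : ℝ) ^ (-(1 / 3) : ℝ) * (T : ℝ) ^ (-(2 / 3) : ℝ) / 5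
  + 2160 * Real.exp 1 * (2 * Real.log d - 1) * L ^ 2 * (T : ℝ) ^ (-(2 / 3) : ℝ) / 5
  + 72 * L ^ 2 * (T : ℝ) ^ (-(2 / 3) : ℝ)
  + 648 * (D + 1) ^ 2 * L ^ 2 * Real.exp 1 * (2 * Real.log d - 1)
      * (T : ℝ) ^ (-(2 / 3) : ℝ) / 5
    * Real.posLog (324 * (D + 1) ^ 2 * L ^ 2 * Real.exp 1 * (2 * Real.log d - 1)
      * (T : ℝ) ^ (2 / 3 : ℝ) / 5)

end ZOExpStorm

end

/-!
The algorithm is a mirror descent with variance-reduced gradient estimates in the `ℓ₁` geometry,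
and the theorem follows from an expected self-bounding inequality for the total squared length `A`
of its scaled steps.

*Geometry.* The gradient of the symmetric entropy has the coordinates `sgn(xᵢ) ln(d|xᵢ| + 1)`, and
it is strongly monotone: on the `ℓ₁` ball of radius `D` the function `(D + 1) φ` is `1`-strongly
convex (`entGrad_strongly_monotone`). Every point of `K` is the generalised projection of itself
for a suitable `g`, so `K` lies in that ball and is compact; hence the projections exist, are
unique, depend continuously on the data and are `(D + 1)/α`-Lipschitz in `g` from the maximum norm
to the `ℓ₁` norm (`Problem.Admissible.l1Norm_prox_sub_le`).

*Variance reduction.* The error of the gradient estimates is measured by the squared `ℓ_{2q}` norm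
`lpSq q 0` with `q = ln d`, which bounds the squared maximum norm and loses only the factor
`κ = d^{1/q} (2q - 1) = e (2 ln d - 1)`. Its smoothness (`lpSq_add_le`) gives the second-moment
inequality `integral_lpSq_add_sum_le` for sums of independent centred vectors, and
therefore, conditionally on the past, the recursion
`e_{t} ≤ (1 - γ_t)² e_{t-1} + (κ/m) (γ_t² (16 G² + …) + 16 (1 - γ_t)² L² (E‖x_t - x_{t-1}‖² + …))`
(`integral_lpSq_dev_succ_le`). It is summed with the weights `(τ_t + 1)²/τ_t`
(`sum_recursion_le`). Since `β_t ‖x_t - x_{t-1}‖²` is at most `(D + 1)²` times the relative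
increment of `1 + A`, the drift contributes only `ln (1 + A)`.

*Potential argument.* Telescoping the objective along the trajectory bounds `A` by a constant times
`T^{1/3}` plus twice the total squared gradient error (`stepSum_le`), and the squared generalised
gradient is at most twice the squared step plus twice the squared error (`stationarity_le`). In
expectation this gives `A ≲ T^{1/3} + κ T^{1/3} ln (1 + A)`, and the logarithm is absorbed by
the linear term (`mul_log_one_add_le`, `self_bounding`). Averaging over the random index yields the
bound `linRate`, which is linear in `κ` up to a logarithm. The explicit bound is weaker, because
`κ ≥ 1`. The linear dependence on `κ` is what makes `(ln d)²` suffice in the oracle complexity: the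
mini-batch size is `1` and `T` is of order `(ln d)² ε⁻³` up to powers of `ln (1/ε)`.
-/


namespace ZOExpStorm

/-! ### The symmetric entropy -/

/-- The derivative `t ↦ sign(t) log (c|t| + 1)` of the one-dimensional entropy, written without
`sign` so that its continuity is evident. -/
noncomputable def entDeriv (c t : ℝ) : ℝ :=
  Real.log (c * max t 0 + 1) - Real.log (c * max (-t) 0 + 1)

lemma entDeriv_of_nonneg {c t : ℝ} (ht : 0 ≤ t) : entDeriv c t = Real.log (c * t + 1) := by
  simp [entDeriv, ht]

lemma entDeriv_neg (c t : ℝ) : entDeriv c (-t) = -entDeriv c t := by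
  simp [entDeriv]

lemma continuous_entDeriv {c : ℝ} (hc : 0 < c) : Continuous (entDeriv c) := by
  unfold entDeriv
  refine Continuous.sub (Continuous.log (by fun_prop) fun t => ?_)
    (Continuous.log (by fun_prop) fun t => ?_)
  · have := mul_nonneg hc.le (le_max_right t 0); positivity
  · have := mul_nonneg hc.le (le_max_right (-t) 0); positivity

/-- The one-dimensional summand of the symmetric entropy. -/
noncomputable def entFun (c t : ℝ) : ℝ := (|t| + 1 / c) * Real.log (c * |t| + 1) - |t|

lemma entFun_neg (c t : ℝ) : entFun c (-t) = entFun c t := by simp [entFun]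

lemma hasDerivAt_entFun_aux {c t : ℝ} (hc : 0 < c) (ht : 0 ≤ t) :
    HasDerivAt (fun t => (t + 1 / c) * Real.log (c * t + 1) - t) (entDeriv c t) t := by
  have h1 : 0 < c * t + 1 := by positivity
  have h2 : HasDerivAt (fun t => c * t + 1) c t := by
    simpa using ((hasDerivAt_id t).const_mul c).add_const 1
  have h3 := (((hasDerivAt_id t).add_const (1 / c)).mul (h2.log h1.ne')).sub (hasDerivAt_id t)
  rw [entDeriv_of_nonneg ht]
  refine h3.congr_deriv ?_
  have e : (id t + 1 / c) * (c / (c * t + 1)) = 1 := by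
    simp only [id]; field_simp
  rw [e]
  ring

lemma hasDerivWithinAt_entFun_Ici {c t : ℝ} (hc : 0 < c) (ht : 0 ≤ t) :
    HasDerivWithinAt (entFun c) (entDeriv c t) (Set.Ici 0) t :=
  (hasDerivAt_entFun_aux hc ht).hasDerivWithinAt.congr
    (fun x hx => by simp [entFun, abs_of_nonneg (Set.mem_Ici.1 hx)]) (by simp [entFun, abs_of_nonneg ht])

lemma hasDerivAt_entFun {c : ℝ} (hc : 0 < c) (t : ℝ) :
    HasDerivAt (entFun c) (entDeriv c t) t := by
  have pos : ∀ t : ℝ, 0 < t → HasDerivAt (entFun c) (entDeriv c t) t := fun t ht =>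
    (hasDerivWithinAt_entFun_Ici hc ht.le).hasDerivAt (Ici_mem_nhds ht)
  rcases lt_trichotomy t 0 with ht | rfl | ht
  · have h := (pos (-t) (by linarith)).scomp t (hasDerivAt_neg t)
    have e : entFun c ∘ Neg.neg = entFun c := by ext x; exact entFun_neg c x
    rw [e, entDeriv_neg] at h
    simpa using h
  · have h1 := hasDerivWithinAt_entFun_Ici hc (le_refl (0 : ℝ))
    have h0 : entDeriv c 0 = 0 := by simp [entDeriv]
    rw [h0] at h1 ⊢
    have h2 : HasDerivWithinAt (entFun c) 0 (Set.Iic 0) 0 := by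
      have h1' : HasDerivWithinAt (entFun c) 0 (Set.Ici 0) (-0) := by simpa using h1
      have h := h1'.scomp (h := Neg.neg) (s := Set.Iic 0) (0 : ℝ) (hasDerivAt_neg 0).hasDerivWithinAt
        (fun x hx => by simpa using hx)
      have e : entFun c ∘ Neg.neg = entFun c := by ext x; exact entFun_neg c x
      rw [e] at h
      simpa using h
    have := h2.union h1
    rw [Set.Iic_union_Ici] at this
    exact this.hasDerivAt Filter.univ_mem
  · exact pos t ht

/-- The quantitative monotonicity of `sign(t) log (c|t| + 1)`; it rests on
`log (1 + y) ≥ 2y / (y + 2)`. -/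
lemma le_entDeriv_sub {c a b : ℝ} (hc : 0 < c) (hab : b ≤ a) :
    (a - b) / ((|a| + |b|) / 2 + 1 / c) ≤ entDeriv c a - entDeriv c b := by
  have nonneg : ∀ a b : ℝ, 0 ≤ b → b ≤ a →
      (a - b) / ((|a| + |b|) / 2 + 1 / c) ≤ entDeriv c a - entDeriv c b := by
    intro a b hb hab
    have ha := hb.trans hab
    rw [entDeriv_of_nonneg ha, entDeriv_of_nonneg hb, abs_of_nonneg ha, abs_of_nonneg hb]
    have h1 : 0 < c * b + 1 := by positivity
    have h2 : 0 < c * a + 1 := by positivity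
    have h0 : 0 ≤ a - b := by linarith
    have h3 : 0 ≤ c * (a - b) / (c * b + 1) := by positivity
    have h := Real.le_log_one_add_of_nonneg h3
    rw [← Real.log_div h2.ne' h1.ne']
    have e : (c * a + 1) / (c * b + 1) = 1 + c * (a - b) / (c * b + 1) := by
      field_simp; ring
    rw [e]
    refine le_trans (le_of_eq ?_) h
    have : c * (a - b) + 2 * (c * b + 1) ≠ 0 := by positivity
    have : (a + b) * c + 2 ≠ 0 := by positivity
    field_simp
    ring
  rcases le_total 0 b with hb | hb
  · exact nonneg a b hb hab
  rcases le_total a 0 with ha | ha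
  · have h := nonneg (-b) (-a) (by linarith) (by linarith)
    rw [entDeriv_neg, entDeriv_neg, abs_neg, abs_neg] at h
    convert h using 1
    · rw [add_comm |a|]; ring
    · ring
  -- for opposite signs the product of the arguments of the logarithms dominates `1 + c (a - b)`
  · have hb' : entDeriv c b = - Real.log (c * (-b) + 1) := by
      rw [← entDeriv_of_nonneg (by linarith : 0 ≤ -b), entDeriv_neg, neg_neg]
    rw [hb', entDeriv_of_nonneg ha, abs_of_nonneg ha, abs_of_nonpos hb, sub_neg_eq_add]
    have hb0 : 0 ≤ -b := by linarith
    have h1 : 0 < c * (-b) + 1 := by positivity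
    have h2 : 0 < c * a + 1 := by positivity
    rw [← Real.log_mul h2.ne' h1.ne']
    have h3 : 0 ≤ c * (a + -b) := by positivity
    have h := Real.le_log_one_add_of_nonneg h3
    have h4 : 1 + c * (a + -b) ≤ (c * a + 1) * (c * (-b) + 1) := by
      have : 0 ≤ (c * a) * (c * (-b)) := by positivity
      nlinarith
    refine le_trans (le_trans (le_of_eq ?_) h) (Real.log_le_log (by positivity) h4)
    have : c * (a + -b) + 2 ≠ 0 := by positivity
    have : (a + -b) * c + 2 ≠ 0 := by positivity
    field_simp
    ring

lemma mul_entDeriv_sub_ge {c : ℝ} (hc : 0 < c) (a b : ℝ) :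
    (a - b) ^ 2 / ((|a| + |b|) / 2 + 1 / c) ≤ (entDeriv c a - entDeriv c b) * (a - b) := by
  have main : ∀ a b : ℝ, b ≤ a →
      (a - b) ^ 2 / ((|a| + |b|) / 2 + 1 / c) ≤ (entDeriv c a - entDeriv c b) * (a - b) := by
    intro a b hab
    have := mul_le_mul_of_nonneg_right (le_entDeriv_sub hc hab) (sub_nonneg.2 hab)
    rwa [div_mul_eq_mul_div, ← sq] at this
  rcases le_total b a with h | h
  · exact main a b h
  · have := main b a h
    rw [add_comm |b|] at this
    calc _ = (b - a) ^ 2 / ((|a| + |b|) / 2 + 1 / c) := by ring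
      _ ≤ _ := this
      _ = _ := by ring

lemma monotone_entDeriv {c : ℝ} (hc : 0 < c) : Monotone (entDeriv c) := by
  intro b a hab
  have h := le_entDeriv_sub hc hab
  have : 0 ≤ (a - b) / ((|a| + |b|) / 2 + 1 / c) := div_nonneg (by linarith) (by positivity)
  linarith

lemma entFun_tangent_le {c : ℝ} (hc : 0 < c) (x y : ℝ) :
    entFun c x + entDeriv c x * (y - x) ≤ entFun c y := by
  have hd : deriv (entFun c) = entDeriv c := funext fun t => (hasDerivAt_entFun hc t).deriv
  have hD : Differentiable ℝ (entFun c) := fun t => (hasDerivAt_entFun hc t).differentiableAt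
  have hconv : ConvexOn ℝ Set.univ (entFun c) :=
    Monotone.convexOn_univ_of_deriv hD (by rw [hd]; exact monotone_entDeriv hc)
  rcases lt_trichotomy x y with h | rfl | h
  · have h1 := hconv.deriv_le_slope (Set.mem_univ x) (Set.mem_univ y) h (hD x)
    rw [hd, slope_def_field, le_div_iff₀ (by linarith)] at h1
    linarith
  · simp
  · have h1 := hconv.slope_le_deriv (Set.mem_univ y) (Set.mem_univ x) h (hD x)
    rw [hd, slope_def_field, div_le_iff₀ (by linarith)] at h1
    linarith

/-- The gradient of the symmetric entropy. -/
noncomputable def entGrad (d : ℕ) (x : E d) : E d := WithLp.toLp 2 fun i => entDeriv d (x i)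

lemma symEntropy_eq_sum (d : ℕ) (x : E d) : symEntropy d x = ∑ i, entFun d (x i) := rfl

lemma hasGradientAt_symEntropy {d : ℕ} (x : E d) :
    HasGradientAt (symEntropy d) (entGrad d x) x := by
  rw [hasGradientAt_iff_hasFDerivAt]
  have h : ∀ i ∈ (Finset.univ : Finset (Fin d)), HasFDerivAt (fun x : E d => entFun d (x i))
      (entDeriv d (x i) • (EuclideanSpace.proj i : E d →L[ℝ] ℝ)) x := fun i _ => by
    have hd : (0 : ℝ) < d := by exact_mod_cast i.pos
    exact (hasDerivAt_entFun hd (x i)).comp_hasFDerivAt x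
      (EuclideanSpace.proj i : E d →L[ℝ] ℝ).hasFDerivAt
  have h2 := HasFDerivAt.fun_sum h
  have e : InnerProductSpace.toDual ℝ (E d) (entGrad d x) =
      ∑ i, entDeriv d (x i) • (EuclideanSpace.proj i : E d →L[ℝ] ℝ) := by
    ext y
    simp [entGrad, PiLp.inner_apply, mul_comm]
  rw [e]
  exact h2

lemma gradient_symEntropy {d : ℕ} (x : E d) : gradient (symEntropy d) x = entGrad d x :=
  (hasGradientAt_symEntropy x).gradient

lemma continuous_entGrad (d : ℕ) : Continuous (entGrad d) := by
  refine (PiLp.continuous_toLp 2 _).comp (continuous_pi fun i => ?_)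
  have hd : (0 : ℝ) < d := by exact_mod_cast i.pos
  exact (continuous_entDeriv hd).comp (by fun_prop)

lemma l1Norm_nonneg {d : ℕ} (x : E d) : 0 ≤ l1Norm x := Finset.sum_nonneg fun _ _ => abs_nonneg _

/-- The symmetric entropy is strongly convex on `ℓ₁` balls, in the form of strong monotonicity of
its gradient: the Hessian is diagonal with entries `1 / (|xᵢ| + 1/d)`, and Cauchy–Schwarz gives
`‖y‖₁² ≤ (∑ (|xᵢ| + 1/d)) ∑ yᵢ² / (|xᵢ| + 1/d)`. -/
lemma entGrad_strongly_monotone {d : ℕ} (hd : 0 < d) (x y : E d) :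
    l1Norm (x - y) ^ 2 / ((l1Norm x + l1Norm y) / 2 + 1) ≤
      inner ℝ (entGrad d x - entGrad d y) (x - y) := by
  have hd' : (0 : ℝ) < d := by exact_mod_cast hd
  have h1 := Finset.sq_sum_div_le_sum_sq_div (Finset.univ : Finset (Fin d))
    (fun i => |x i - y i|) (g := fun i => (|x i| + |y i|) / 2 + 1 / (d : ℝ))
    (fun i _ => by positivity)
  have e : ∑ i : Fin d, ((|x i| + |y i|) / 2 + 1 / (d : ℝ)) = (l1Norm x + l1Norm y) / 2 + 1 := by
    rw [Finset.sum_add_distrib, ← Finset.sum_div, Finset.sum_add_distrib]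
    simp [l1Norm, hd'.ne']
  rw [e] at h1
  have h2 : inner ℝ (entGrad d x - entGrad d y) (x - y) =
      ∑ i, (entDeriv d (x i) - entDeriv d (y i)) * (x i - y i) := by
    simp [entGrad, PiLp.inner_apply, mul_comm]
  rw [h2]
  refine le_trans (le_trans (le_of_eq ?_) h1) (Finset.sum_le_sum fun i _ => ?_)
  · simp [l1Norm]
  · rw [sq_abs]; exact mul_entDeriv_sub_ge hd' _ _

lemma bregman_symEntropy {d : ℕ} (y x : E d) :
    bregman (symEntropy d) y x =
      symEntropy d y - symEntropy d x - inner ℝ (entGrad d x) (y - x) := by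
  rw [bregman, gradient_symEntropy]

lemma bregman_symEntropy_nonneg {d : ℕ} (y x : E d) : 0 ≤ bregman (symEntropy d) y x := by
  rw [bregman_symEntropy, symEntropy_eq_sum, symEntropy_eq_sum]
  have h2 : inner ℝ (entGrad d x) (y - x) = ∑ i, entDeriv d (x i) * (y i - x i) := by
    simp [entGrad, PiLp.inner_apply, mul_comm]
  rw [h2, ← Finset.sum_sub_distrib, ← Finset.sum_sub_distrib]
  refine Finset.sum_nonneg fun i _ => ?_
  have hd : (0 : ℝ) < d := by exact_mod_cast i.pos
  have := entFun_tangent_le hd (x i) (y i)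
  linarith


/-! ### The generalised projection -/

/-- The `ℓ_∞` norm on `ℝ^d`, dual to `l1Norm`. -/
noncomputable def lInf {d : ℕ} (x : E d) : ℝ := ‖x.ofLp‖

lemma lInf_nonneg {d : ℕ} (x : E d) : 0 ≤ lInf x := norm_nonneg _

lemma abs_le_lInf {d : ℕ} (x : E d) (i : Fin d) : |x i| ≤ lInf x := norm_le_pi_norm x.ofLp i

lemma lInf_le {d : ℕ} {x : E d} {c : ℝ} (hc : 0 ≤ c) (h : ∀ i, |x i| ≤ c) : lInf x ≤ c :=
  (pi_norm_le_iff_of_nonneg hc).2 h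

lemma lInf_add_le {d : ℕ} (x y : E d) : lInf (x + y) ≤ lInf x + lInf y := by
  simpa [lInf] using norm_add_le x.ofLp y.ofLp

lemma lInf_neg {d : ℕ} (x : E d) : lInf (-x) = lInf x := by
  simp [lInf]

lemma inner_le_lInf_mul_l1Norm {d : ℕ} (x y : E d) : inner ℝ x y ≤ lInf x * l1Norm y := by
  rw [PiLp.inner_apply, l1Norm, Finset.mul_sum]
  refine Finset.sum_le_sum fun i _ => ?_
  calc inner ℝ (x i) (y i) = x i * y i := by simp [mul_comm]
    _ ≤ |x i| * |y i| := by rw [← abs_mul]; exact le_abs_self _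
    _ ≤ _ := mul_le_mul_of_nonneg_right (abs_le_lInf x i) (abs_nonneg _)

lemma norm_le_l1Norm {d : ℕ} (x : E d) : ‖x‖ ≤ l1Norm x := by
  rw [EuclideanSpace.norm_eq]
  refine Real.sqrt_le_iff.2 ⟨l1Norm_nonneg x, ?_⟩
  simpa [l1Norm] using Finset.sum_sq_le_sq_sum_of_nonneg
    (s := (Finset.univ : Finset (Fin d))) (f := fun i => |x i|) fun i _ => abs_nonneg _

lemma l1Norm_neg {d : ℕ} (x : E d) : l1Norm (-x) = l1Norm x := by simp [l1Norm]

lemma l1Norm_sub_comm {d : ℕ} (x y : E d) : l1Norm (x - y) = l1Norm (y - x) := by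
  rw [← l1Norm_neg, neg_sub]

lemma l1Norm_add_le {d : ℕ} (x y : E d) : l1Norm (x + y) ≤ l1Norm x + l1Norm y := by
  simp only [l1Norm, ← Finset.sum_add_distrib]
  exact Finset.sum_le_sum fun i _ => abs_add_le _ _

lemma l1Norm_smul {d : ℕ} (c : ℝ) (x : E d) : l1Norm (c • x) = |c| * l1Norm x := by
  simp [l1Norm, Finset.mul_sum, abs_mul]

lemma continuous_l1Norm {d : ℕ} : Continuous (l1Norm : E d → ℝ) := by
  unfold l1Norm; fun_prop

lemma continuous_symEntropy (d : ℕ) : Continuous (symEntropy d) :=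
  continuous_iff_continuousAt.2 fun x => (hasGradientAt_symEntropy x).continuousAt

lemma convexOn_continuous {d : ℕ} {r : E d → ℝ} (hr : ConvexOn ℝ Set.univ r) : Continuous r :=
  continuousOn_univ.1 (hr.continuousOn isOpen_univ)

/-- A convex function on `ℝ^d` has a subgradient at each point: separate the point of the graph
from the strict epigraph. -/
lemma exists_subgradient {d : ℕ} {r : E d → ℝ} (hr : ConvexOn ℝ Set.univ r) (x : E d) :
    ∃ g : E d, ∀ y, r x + inner ℝ g (y - x) ≤ r y := by
  have hc := convexOn_continuous hr
  have hopen : IsOpen {q : E d × ℝ | q.1 ∈ Set.univ ∧ r q.1 < q.2} := by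
    simp only [Set.mem_univ, true_and]
    exact isOpen_lt (hc.comp continuous_fst) continuous_snd
  obtain ⟨F, hF⟩ := geometric_hahn_banach_point_open hr.convex_strict_epigraph hopen
    (x := (x, r x)) (by simp)
  have split : ∀ (y : E d) (s : ℝ), F (y, s) = F (y, 0) + s * F (0, 1) := by
    intro y s
    have : (y, s) = (y, (0 : ℝ)) + s • ((0 : E d), (1 : ℝ)) := by simp
    rw [this, map_add, map_smul, smul_eq_mul]
  have hpos : 0 < F (0, 1) := by
    have := hF (x, r x + 1) (by simp)
    rw [split x (r x), split x (r x + 1)] at this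
    linarith
  have hle : ∀ y, F (x, 0) + r x * F (0, 1) ≤ F (y, 0) + r y * F (0, 1) := by
    intro y
    refine le_of_forall_pos_le_add fun ε hε => ?_
    have := hF (y, r y + ε / F (0, 1)) (by simp; positivity)
    rw [split x, split y, add_mul, div_mul_cancel₀ _ hpos.ne'] at this
    linarith
  let u : E d →L[ℝ] ℝ := F.comp (ContinuousLinearMap.inl ℝ (E d) ℝ)
  refine ⟨-(F (0, 1))⁻¹ • (InnerProductSpace.toDual ℝ (E d)).symm u, fun y => ?_⟩
  rw [inner_smul_left, InnerProductSpace.toDual_symm_apply, map_sub]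
  have hu : ∀ z, u z = F (z, 0) := fun z => by simp [u]
  rw [hu, hu]
  have := hle y
  have h2 : r x + (F (0, 1))⁻¹ * (F (x, 0) - F (y, 0)) ≤ r y := by
    rw [← le_sub_iff_add_le', inv_mul_le_iff₀ hpos]
    linarith
  simp only [conj_trivial]
  linarith

/-- The first-order optimality condition of the generalised projection. -/
lemma variational_of_isMinOn {d : ℕ} {K : Set (E d)} {r : E d → ℝ} (hK : Convex ℝ K)
    (hr : ConvexOn ℝ Set.univ r) {x g v : E d} {a : ℝ} (hv : v ∈ K)
    (hmin : IsMinOn (fun y => inner ℝ g y + r y + a * bregman (symEntropy d) y x) K v)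
    {y : E d} (hy : y ∈ K) :
    0 ≤ inner ℝ (g + a • (entGrad d v - entGrad d x)) (y - v) + r y - r v := by
  set w := y - v with hw
  set q : ℝ → ℝ := fun s => s * (inner ℝ g w + r y - r v - a * inner ℝ (entGrad d x) w) +
    a * symEntropy d (v + s • w) with hq
  have hlin : HasDerivAt (fun s : ℝ => v + s • w) w 0 := by
    simpa using ((hasDerivAt_id (0 : ℝ)).smul_const w).const_add v
  have hder : HasDerivAt q ((inner ℝ g w + r y - r v - a * inner ℝ (entGrad d x) w) +
      a * inner ℝ (entGrad d v) w) 0 := by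
    have h1 := (hasGradientAt_symEntropy (v + (0 : ℝ) • w)).hasFDerivAt.comp_hasDerivAt (0 : ℝ) hlin
    have h2 := ((hasDerivAt_id (0 : ℝ)).mul_const
      (inner ℝ g w + r y - r v - a * inner ℝ (entGrad d x) w)).add (h1.const_mul a)
    refine (h2.congr_deriv ?_).congr_of_eventuallyEq (Filter.Eventually.of_forall fun s => ?_)
    · simp
    · simp [hq]
  have hslope := hder.tendsto_slope_zero_right
  have hnn : 0 ≤ (inner ℝ g w + r y - r v - a * inner ℝ (entGrad d x) w) +
      a * inner ℝ (entGrad d v) w := by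
    refine ge_of_tendsto hslope ?_
    filter_upwards [Ioo_mem_nhdsGT (zero_lt_one' ℝ)] with s hs
    have hmem : v + s • w ∈ K := by
      have := hK hv hy (sub_nonneg.2 hs.2.le) hs.1.le (by ring)
      convert this using 1
      rw [hw, smul_sub, sub_smul, one_smul]; abel
    have h1 := hmin hmem
    have h2 : r (v + s • w) ≤ (1 - s) * r v + s * r y := by
      have := hr.2 (Set.mem_univ v) (Set.mem_univ y) (sub_nonneg.2 hs.2.le) hs.1.le (by ring)
      rw [smul_eq_mul, smul_eq_mul] at this
      have e : (1 - s) • v + s • y = v + s • w := by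
        rw [hw, smul_sub, sub_smul, one_smul]; abel
      rwa [e] at this
    simp only [Set.mem_ofPred_eq, bregman_symEntropy] at h1
    have e1 : v + s • w - x = (v - x) + s • w := by abel
    rw [e1, inner_add_right, inner_add_right, inner_smul_right, inner_smul_right] at h1
    have h3 : 0 ≤ q (0 + s) - q 0 := by
      simp only [hq, zero_add, zero_mul, zero_smul, add_zero]
      nlinarith
    rw [smul_eq_mul]
    exact mul_nonneg (inv_nonneg.2 hs.1.le) h3
  rw [inner_add_left, inner_smul_left, inner_sub_left]
  simp only [conj_trivial]
  linarith

/-- Two points that satisfy the optimality condition for different data are close. -/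
lemma variational_stability {d : ℕ} (hd : 0 < d) {D : ℝ} {r : E d → ℝ}
    {x x' g g' v v' : E d} {a a' : ℝ} (ha : 0 ≤ a)
    (h : 0 ≤ inner ℝ (g + a • (entGrad d v - entGrad d x)) (v' - v) + r v' - r v)
    (h' : 0 ≤ inner ℝ (g' + a' • (entGrad d v' - entGrad d x')) (v - v') + r v - r v')
    (hv : l1Norm v ≤ D) (hv' : l1Norm v' ≤ D) :
    a / (D + 1) * l1Norm (v - v') ^ 2 ≤
      inner ℝ (g - g' - a • entGrad d x + a' • entGrad d x' + (a - a') • entGrad d v')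
        (v' - v) := by
  have h1 := entGrad_strongly_monotone hd v v'
  have hD : 0 ≤ D := (l1Norm_nonneg v).trans hv
  have h2 : l1Norm (v - v') ^ 2 / (D + 1) ≤
      l1Norm (v - v') ^ 2 / ((l1Norm v + l1Norm v') / 2 + 1) := by
    have := l1Norm_nonneg v
    have := l1Norm_nonneg v'
    gcongr
    linarith
  have h3 := mul_le_mul_of_nonneg_left (h2.trans h1) ha
  have e : v - v' = -(v' - v) := by abel
  have e1 : a / (D + 1) * l1Norm (v - v') ^ 2 = a * (l1Norm (v - v') ^ 2 / (D + 1)) := by ring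
  rw [e1]
  refine h3.trans ?_
  rw [e, inner_neg_right] at h' ⊢
  simp only [inner_add_left, inner_sub_left, inner_smul_left, conj_trivial, sub_mul, mul_sub] at *
  linarith

/-- Strict monotonicity makes the solution of the optimality condition unique. -/
lemma variational_unique {d : ℕ} (hd : 0 < d) {r : E d → ℝ} {x g v v' : E d} {a : ℝ} (ha : 0 < a)
    (h : 0 ≤ inner ℝ (g + a • (entGrad d v - entGrad d x)) (v' - v) + r v' - r v)
    (h' : 0 ≤ inner ℝ (g + a • (entGrad d v' - entGrad d x)) (v - v') + r v - r v') :
    v = v' := by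
  have hs := variational_stability hd ha.le h h' (le_max_left (l1Norm v) (l1Norm v'))
    (le_max_right _ _)
  have hz : g - g - a • entGrad d x + a • entGrad d x + (a - a) • entGrad d v' = 0 := by
    simp
  rw [hz, inner_zero_left] at hs
  have hD : 0 ≤ max (l1Norm v) (l1Norm v') := (l1Norm_nonneg v).trans (le_max_left _ _)
  have h0 : l1Norm (v - v') ^ 2 ≤ 0 := by
    by_contra hcon
    push Not at hcon
    have : 0 < a / (max (l1Norm v) (l1Norm v') + 1) * l1Norm (v - v') ^ 2 := by positivity
    linarith
  have h1 : l1Norm (v - v') = 0 := pow_eq_zero_iff (two_ne_zero) |>.1 (le_antisymm h0 (sq_nonneg _))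
  have h2 := norm_le_l1Norm (v - v')
  rw [h1] at h2
  exact sub_eq_zero.1 (norm_le_zero_iff.1 h2)

/-- Rescaling the distance-generating function rescales the step size. -/
lemma prox_mul_symEntropy {d : ℕ} (K : Set (E d)) (r : E d → ℝ) (x g : E d) {c a : ℝ}
    (hc : c ≠ 0) :
    prox K r (fun y => c * symEntropy d y) x g (a / c) = prox K r (symEntropy d) x g a := by
  have hg : gradient (fun y => c * symEntropy d y) x = c • entGrad d x := by
    refine HasGradientAt.gradient ?_
    rw [hasGradientAt_iff_hasFDerivAt, map_smul]
    exact (hasGradientAt_symEntropy x).hasFDerivAt.const_mul c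
  have hb : ∀ y, a / c * bregman (fun y => c * symEntropy d y) y x =
      a * bregman (symEntropy d) y x := by
    intro y
    rw [bregman, hg, bregman_symEntropy, inner_smul_left]
    simp only [conj_trivial]
    field_simp
  simp only [prox, hb]

namespace Problem.Admissible

variable {d : ℕ} {Ξ : Type u} [MeasurableSpace Ξ] {p : Problem d Ξ} {G L R D σ : ℝ}

/-- Every point of `K` is the generalised projection of itself for `g` the negative of a
subgradient of `r`, so `K` lies in the `ℓ₁` ball of radius `D`. -/
lemma l1Norm_le (h : p.Admissible G L R D σ) (hd : 0 < d) {x : E d} (hx : x ∈ p.K) :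
    l1Norm x ≤ D := by
  obtain ⟨s, hs⟩ := exists_subgradient h.convex_r x
  have hmin : IsMinOn (fun y => inner ℝ (-s) y + p.r y + 1 * bregman (symEntropy d) y x) p.K x := by
    intro y _
    have h1 := hs y
    have h2 := bregman_symEntropy_nonneg y x
    have h3 : bregman (symEntropy d) x x = 0 := by simp [bregman]
    simp only [Set.mem_ofPred_eq, h3, inner_neg_left]
    rw [inner_sub_right] at h1
    linarith
  have hspec : prox p.K p.r (symEntropy d) x (-s) 1 ∈ p.K ∧
      IsMinOn (fun y => inner ℝ (-s) y + p.r y + 1 * bregman (symEntropy d) y x) p.K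
        (prox p.K p.r (symEntropy d) x (-s) 1) :=
    Classical.epsilon_spec (p := fun q => q ∈ p.K ∧
      IsMinOn (fun y => inner ℝ (-s) y + p.r y + 1 * bregman (symEntropy d) y x) p.K q)
      ⟨x, hx, hmin⟩
  have e := variational_unique hd one_pos
    (variational_of_isMinOn h.convex h.convex_r hx hmin hspec.1)
    (variational_of_isMinOn h.convex h.convex_r hspec.1 hspec.2 hx)
  rw [e]
  exact h.bounded 1 one_pos x hx (-s)

lemma isCompact (h : p.Admissible G L R D σ) (hd : 0 < d) : IsCompact p.K := by
  refine Metric.isCompact_of_isClosed_isBounded h.closed ?_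
  refine (Metric.isBounded_closedBall (x := (0 : E d)) (r := D)).subset fun x hx => ?_
  rw [mem_closedBall_zero_iff]
  exact (norm_le_l1Norm x).trans (h.l1Norm_le hd hx)

lemma prox_spec (h : p.Admissible G L R D σ) (hd : 0 < d) (hne : p.K.Nonempty)
    (x g : E d) (a : ℝ) :
    prox p.K p.r (symEntropy d) x g a ∈ p.K ∧
      IsMinOn (fun y => inner ℝ g y + p.r y + a * bregman (symEntropy d) y x) p.K
        (prox p.K p.r (symEntropy d) x g a) := by
  have hc : Continuous fun y => inner ℝ g y + p.r y + a * bregman (symEntropy d) y x := by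
    have h1 := convexOn_continuous h.convex_r
    have h2 := continuous_symEntropy d
    simp only [bregman]
    fun_prop
  obtain ⟨v, hv, hm⟩ := (h.isCompact hd).exists_isMinOn hne hc.continuousOn
  exact Classical.epsilon_spec (p := fun q => q ∈ p.K ∧
      IsMinOn (fun y => inner ℝ g y + p.r y + a * bregman (symEntropy d) y x) p.K q) ⟨v, hv, hm⟩

lemma prox_mem (h : p.Admissible G L R D σ) (hd : 0 < d) (hne : p.K.Nonempty)
    (x g : E d) (a : ℝ) : prox p.K p.r (symEntropy d) x g a ∈ p.K :=
  (h.prox_spec hd hne x g a).1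

lemma prox_variational (h : p.Admissible G L R D σ) (hd : 0 < d) (x g : E d) (a : ℝ)
    {y : E d} (hy : y ∈ p.K) :
    0 ≤ inner ℝ (g + a • (entGrad d (prox p.K p.r (symEntropy d) x g a) - entGrad d x))
      (y - prox p.K p.r (symEntropy d) x g a) + p.r y -
        p.r (prox p.K p.r (symEntropy d) x g a) :=
  variational_of_isMinOn h.convex h.convex_r (h.prox_spec hd ⟨y, hy⟩ x g a).1
    (h.prox_spec hd ⟨y, hy⟩ x g a).2 hy

/-- One projection step decreases the linearised objective. -/
lemma prox_decrease (h : p.Admissible G L R D σ) (hd : 0 < d) {x : E d} (hx : x ∈ p.K)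
    (g : E d) {a : ℝ} (ha : 0 ≤ a) :
    inner ℝ g (prox p.K p.r (symEntropy d) x g a - x) +
      p.r (prox p.K p.r (symEntropy d) x g a) - p.r x ≤
      -(a / (D + 1) * l1Norm (prox p.K p.r (symEntropy d) x g a - x) ^ 2) := by
  set v := prox p.K p.r (symEntropy d) x g a with hv
  have hvK : v ∈ p.K := h.prox_mem hd ⟨x, hx⟩ x g a
  have h1 := h.prox_variational hd x g a hx
  rw [← hv] at h1
  -- `x` itself is optimal for a problem without linear term, so stability applies to `(v, x)`
  have h2 := variational_stability (r := fun _ => 0) (g := -(a • (entGrad d v - entGrad d x)))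
    (g' := 0) (a' := 0) (x := x) (x' := x) hd ha (v := v) (v' := x) (by simp) (by simp)
    (h.l1Norm_le hd hvK) (h.l1Norm_le hd hx)
  refine le_trans ?_ (neg_le_neg h2)
  have e : v - x = -(x - v) := by abel
  rw [e, inner_neg_right]
  simp only [inner_add_left, inner_sub_left, inner_smul_left, inner_neg_left, conj_trivial,
    sub_mul, mul_sub, inner_zero_left, zero_mul] at *
  linarith

/-- The projection is Lipschitz in the linear term, in the dual norm. -/
lemma l1Norm_prox_sub_le (h : p.Admissible G L R D σ) (hd : 0 < d) {x : E d} (hx : x ∈ p.K)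
    (g g' : E d) {a : ℝ} (ha : 0 < a) :
    a / (D + 1) * l1Norm (prox p.K p.r (symEntropy d) x g a - prox p.K p.r (symEntropy d) x g' a) ≤
      lInf (g - g') := by
  have hv := h.prox_mem hd ⟨x, hx⟩ x g a
  have hv' := h.prox_mem hd ⟨x, hx⟩ x g' a
  have h1 := variational_stability hd ha.le (h.prox_variational hd x g a hv')
    (h.prox_variational hd x g' a hv) (h.l1Norm_le hd hv) (h.l1Norm_le hd hv')
  set v := prox p.K p.r (symEntropy d) x g a
  set v' := prox p.K p.r (symEntropy d) x g' a
  have e : g - g' - a • entGrad d x + a • entGrad d x + (a - a) • entGrad d v' = g - g' := by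
    simp
  rw [e] at h1
  have h2 := h1.trans (inner_le_lInf_mul_l1Norm _ _)
  rw [l1Norm_sub_comm v' v, sq, ← mul_assoc] at h2
  rcases (l1Norm_nonneg (v - v')).eq_or_lt with h0 | h0
  · rw [← h0, mul_zero]; exact lInf_nonneg _
  · exact le_of_mul_le_mul_right h2 h0

/-- The projection depends continuously on its data. -/
lemma continuousOn_prox (h : p.Admissible G L R D σ) (hd : 0 < d) :
    ContinuousOn (fun q : E d × E d × ℝ => prox p.K p.r (symEntropy d) q.1 q.2.1 q.2.2)
      {q | q.1 ∈ p.K ∧ 0 < q.2.2} := by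
  rintro ⟨x, g, a⟩ ⟨hx, ha⟩
  simp only at hx ha
  obtain ⟨C, hC⟩ := (h.isCompact hd).exists_bound_of_continuousOn
    (continuous_entGrad d).continuousOn
  have hD : 0 ≤ D := (l1Norm_nonneg x).trans (h.l1Norm_le hd hx)
  set v := prox p.K p.r (symEntropy d) x g a with hv
  rw [ContinuousWithinAt, tendsto_iff_norm_sub_tendsto_zero]
  have hb : Filter.Tendsto (fun q : E d × E d × ℝ => (D + 1) / a *
      (‖g - q.2.1 - a • entGrad d x + q.2.2 • entGrad d q.1‖ + |a - q.2.2| * C))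
      (nhdsWithin (x, g, a) {q | q.1 ∈ p.K ∧ 0 < q.2.2}) (nhds 0) := by
    have hcont : Continuous (fun q : E d × E d × ℝ => (D + 1) / a *
      (‖g - q.2.1 - a • entGrad d x + q.2.2 • entGrad d q.1‖ + |a - q.2.2| * C)) := by
      have := continuous_entGrad d
      fun_prop
    have := hcont.tendsto (x, g, a)
    simp only [sub_self, zero_sub, neg_add_cancel, norm_zero, abs_zero, zero_mul, add_zero,
      mul_zero] at this
    exact this.mono_left nhdsWithin_le_nhds
  refine squeeze_zero' (Filter.Eventually.of_forall fun _ => norm_nonneg _) ?_ hb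
  filter_upwards [self_mem_nhdsWithin] with q hq
  obtain ⟨x', g', a'⟩ := q
  simp only at hq ⊢
  set v' := prox p.K p.r (symEntropy d) x' g' a' with hv'
  have hvK : v ∈ p.K := h.prox_mem hd ⟨x, hx⟩ x g a
  have hvK' : v' ∈ p.K := h.prox_mem hd ⟨x, hx⟩ x' g' a'
  have h1 := variational_stability hd ha.le (h.prox_variational hd x g a hvK')
    (h.prox_variational hd x' g' a' hvK) (h.l1Norm_le hd hvK) (h.l1Norm_le hd hvK')
  rw [← hv] at h1 ⊢
  have h2 := h1.trans (real_inner_le_norm _ _)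
  have h3 : ‖g - g' - a • entGrad d x + a' • entGrad d x' + (a - a') • entGrad d v'‖ ≤
      ‖g - g' - a • entGrad d x + a' • entGrad d x'‖ + |a - a'| * C := by
    refine (norm_add_le _ _).trans ?_
    rw [norm_smul, Real.norm_eq_abs]
    have := hC v' hvK'
    gcongr
  have h4 : a / (D + 1) * ‖v' - v‖ ^ 2 ≤
      (‖g - g' - a • entGrad d x + a' • entGrad d x'‖ + |a - a'| * C) * ‖v' - v‖ := by
    have h5 : ‖v' - v‖ ^ 2 ≤ l1Norm (v - v') ^ 2 := by
      rw [l1Norm_sub_comm]; have := norm_le_l1Norm (v' - v); gcongr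
    calc _ ≤ a / (D + 1) * l1Norm (v - v') ^ 2 := by gcongr
      _ ≤ _ := h2
      _ ≤ _ := by gcongr
  rcases (norm_nonneg (v' - v)).eq_or_lt with h0 | h0
  · rw [← h0]
    have : 0 ≤ C := (norm_nonneg _).trans (hC v' hvK')
    positivity
  · rw [sq, ← mul_assoc] at h4
    have h6 := le_of_mul_le_mul_right h4 h0
    calc ‖v' - v‖ = (D + 1) / a * (a / (D + 1) * ‖v' - v‖) := by field_simp
      _ ≤ _ := by gcongr

open Classical in
/-- A measurable function that agrees with the generalised projection on the relevant data. -/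
lemma exists_measurable_prox (h : p.Admissible G L R D σ) (hd : 0 < d) :
    ∃ F : E d × E d × ℝ → E d, Measurable F ∧ ∀ x g a, x ∈ p.K → 0 < a →
      F (x, g, a) = prox p.K p.r (symEntropy d) x g a := by
  refine ⟨Set.piecewise {q : E d × E d × ℝ | q.1 ∈ p.K ∧ 0 < q.2.2}
    (fun q => prox p.K p.r (symEntropy d) q.1 q.2.1 q.2.2) (fun _ => 0), ?_, ?_⟩
  · refine (h.continuousOn_prox hd).measurable_piecewise continuousOn_const ?_
    exact (measurable_fst h.closed.measurableSet).inter
      (measurableSet_lt measurable_const (measurable_snd.comp measurable_snd))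
  · intro x g a hx ha
    exact Set.piecewise_eq_of_mem _ _ _ ⟨hx, ha⟩

end Problem.Admissible


/-! ### Smoothness of the squared `ℓ_{2q}` norm -/

/-- The regularised squared `ℓ_{2q}` norm `(∑ᵢ (xᵢ² + δ)^q)^{1/q}`. For `δ = 0` it is the square of
the `ℓ_{2q}` norm; for `δ > 0` it is smooth everywhere. -/
noncomputable def lpSq {d : ℕ} (q δ : ℝ) (x : E d) : ℝ := (∑ i, (x i ^ 2 + δ) ^ q) ^ (1 / q)

/-- The gradient of `lpSq q δ`. -/
noncomputable def lpSqGrad {d : ℕ} (q δ : ℝ) (x : E d) : E d :=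
  WithLp.toLp 2 fun i =>
    2 * (∑ j, (x j ^ 2 + δ) ^ q) ^ (1 / q - 1) * ((x i ^ 2 + δ) ^ (q - 1) * x i)

variable {d : ℕ}

lemma lpSq_nonneg {q δ : ℝ} (hδ : 0 ≤ δ) (x : E d) : 0 ≤ lpSq q δ x :=
  Real.rpow_nonneg (Finset.sum_nonneg fun i _ => Real.rpow_nonneg (by positivity) _) _

lemma continuous_lpSq {q : ℝ} (hq : 0 < q) (δ : ℝ) : Continuous (lpSq q δ : E d → ℝ) := by
  unfold lpSq
  refine Continuous.rpow_const (continuous_finsetSum _ fun i _ =>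
    Continuous.rpow_const (by fun_prop) fun _ => Or.inr hq.le) fun _ => Or.inr (by positivity)

lemma continuous_lpSq_reg {q : ℝ} (hq : 0 < q) (x : E d) : Continuous fun δ => lpSq q δ x := by
  unfold lpSq
  refine Continuous.rpow_const (continuous_finsetSum _ fun i _ =>
    Continuous.rpow_const (by fun_prop) fun _ => Or.inr hq.le) fun _ => Or.inr (by positivity)

lemma sum_reg_pos (hd : 0 < d) {q δ : ℝ} (hδ : 0 < δ) (x : E d) :
    0 < ∑ i, (x i ^ 2 + δ) ^ q := by
  have : Nonempty (Fin d) := ⟨⟨0, hd⟩⟩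
  exact Finset.sum_pos (fun i _ => Real.rpow_pos_of_pos (by positivity) _) Finset.univ_nonempty

lemma continuous_lpSqGrad (hd : 0 < d) {q δ : ℝ} (hδ : 0 < δ) :
    Continuous (lpSqGrad q δ : E d → E d) := by
  have hpos : ∀ (x : E d) i, x i ^ 2 + δ ≠ 0 := fun x i => by positivity
  refine (PiLp.continuous_toLp 2 _).comp (continuous_pi fun i => ?_)
  refine ((continuous_const.mul (Continuous.rpow_const (continuous_finsetSum _ fun j _ =>
    Continuous.rpow_const (by fun_prop) fun x => Or.inl (hpos x j))
    fun x => Or.inl (sum_reg_pos hd hδ x).ne')).mul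
    ((Continuous.rpow_const (by fun_prop) fun x => Or.inl (hpos x i)).mul (by fun_prop)))

lemma lpSq_mono_reg {q δ : ℝ} (hq : 0 < q) (hδ : 0 ≤ δ) (x : E d) : lpSq q 0 x ≤ lpSq q δ x := by
  have h0 : 0 ≤ ∑ i, (x i ^ 2 + 0) ^ q :=
    Finset.sum_nonneg fun i _ => Real.rpow_nonneg (by positivity) _
  refine Real.rpow_le_rpow h0 (Finset.sum_le_sum fun i _ => ?_) (by positivity)
  exact Real.rpow_le_rpow (by positivity) (by linarith) hq.le

lemma sq_coord_le_lpSq {q : ℝ} (hq : 0 < q) (x : E d) (i : Fin d) : x i ^ 2 ≤ lpSq q 0 x := by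
  have h1 : (x i ^ 2) ^ q ≤ ∑ i, (x i ^ 2 + 0) ^ q := by
    simp only [add_zero]
    exact Finset.single_le_sum (f := fun i => (x i ^ 2) ^ q)
      (fun j _ => Real.rpow_nonneg (sq_nonneg _) _) (Finset.mem_univ i)
  have h2 := Real.rpow_le_rpow (Real.rpow_nonneg (sq_nonneg _) _) h1 (by positivity : 0 ≤ 1 / q)
  rwa [← Real.rpow_mul (sq_nonneg _), mul_one_div_cancel hq.ne', Real.rpow_one] at h2

lemma sq_lInf_le_lpSq {q : ℝ} (hq : 0 < q) (x : E d) : lInf x ^ 2 ≤ lpSq q 0 x := by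
  have h0 := lpSq_nonneg (q := q) le_rfl x
  have : lInf x ≤ Real.sqrt (lpSq q 0 x) :=
    lInf_le (Real.sqrt_nonneg _) fun i => Real.abs_le_sqrt (sq_coord_le_lpSq hq x i)
  calc lInf x ^ 2 ≤ Real.sqrt (lpSq q 0 x) ^ 2 := by gcongr; exact lInf_nonneg x
    _ = _ := Real.sq_sqrt h0

lemma lpSq_le_of_abs_le {q c : ℝ} (hq : 0 < q) {x : E d} (h : ∀ i, |x i| ≤ c) :
    lpSq q 0 x ≤ (d : ℝ) ^ (1 / q) * c ^ 2 := by
  have h1 : ∑ i, (x i ^ 2 + 0) ^ q ≤ d * (c ^ 2) ^ q := by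
    calc ∑ i, (x i ^ 2 + 0) ^ q ≤ ∑ _i : Fin d, (c ^ 2) ^ q := by
          refine Finset.sum_le_sum fun i _ => Real.rpow_le_rpow (by positivity) ?_ hq.le
          rw [add_zero]
          exact sq_le_sq' (neg_le_of_abs_le (h i)) (le_of_abs_le (h i))
      _ = _ := by simp
  have h0 : 0 ≤ ∑ i, (x i ^ 2 + 0) ^ q :=
    Finset.sum_nonneg fun i _ => Real.rpow_nonneg (by positivity) _
  calc lpSq q 0 x ≤ (d * (c ^ 2) ^ q) ^ (1 / q) := Real.rpow_le_rpow h0 h1 (by positivity)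
    _ = _ := by
      rw [Real.mul_rpow (by positivity) (by positivity), ← Real.rpow_mul (by positivity),
        mul_one_div_cancel hq.ne', Real.rpow_one]

lemma lpSq_smul {q : ℝ} (hq : 0 < q) (c : ℝ) (x : E d) :
    lpSq q 0 (c • x) = c ^ 2 * lpSq q 0 x := by
  have h0 : 0 ≤ ∑ i, (x i ^ 2 + 0) ^ q :=
    Finset.sum_nonneg fun i _ => Real.rpow_nonneg (by positivity) _
  have : ∑ i, ((c • x) i ^ 2 + 0) ^ q = (c ^ 2) ^ q * ∑ i, (x i ^ 2 + 0) ^ q := by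
    rw [Finset.mul_sum]
    refine Finset.sum_congr rfl fun i _ => ?_
    rw [add_zero, add_zero, ← Real.mul_rpow (by positivity) (by positivity)]
    simp [mul_pow]
  rw [lpSq, lpSq, this, Real.mul_rpow (by positivity) h0, ← Real.rpow_mul (by positivity),
    mul_one_div_cancel hq.ne', Real.rpow_one]

/-- Hölder's inequality in the form used to bound the Hessian of `lpSq`. -/
lemma sum_rpow_mul_sq_le {q δ : ℝ} (hq : 1 < q) (hδ : 0 < δ) (x y : E d) :
    ∑ i, (x i ^ 2 + δ) ^ (q - 1) * y i ^ 2 ≤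
      (∑ i, (x i ^ 2 + δ) ^ q) ^ (1 - 1 / q) * lpSq q 0 y := by
  have hconj : (q / (q - 1)).HolderConjugate q :=
    (Real.HolderConjugate.conjExponent hq).symm
  have h := Real.inner_le_Lp_mul_Lq Finset.univ (fun i => (x i ^ 2 + δ) ^ (q - 1))
    (fun i => y i ^ 2) hconj
  have hq1 : q - 1 ≠ 0 := by linarith
  have e1 : ∀ i, |(x i ^ 2 + δ) ^ (q - 1)| ^ (q / (q - 1)) = (x i ^ 2 + δ) ^ q := fun i => by
    rw [abs_of_nonneg (Real.rpow_nonneg (by positivity) _), ← Real.rpow_mul (by positivity),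
      mul_div_cancel₀ _ hq1]
  have e2 : 1 / (q / (q - 1)) = 1 - 1 / q := by
    have : q ≠ 0 := by linarith
    field_simp
  simp only [e1, e2] at h
  refine h.trans (le_of_eq ?_)
  simp [lpSq]

/-- The function `lpSq q δ` is smooth with constant `2 (2q - 1)` for the `ℓ_{2q}` norm. -/
lemma lpSq_add_le (hd : 0 < d) {q δ : ℝ} (hq : 1 < q) (hδ : 0 < δ) (x y : E d) :
    lpSq q δ (x + y) ≤
      lpSq q δ x + inner ℝ (lpSqGrad q δ x) y + (2 * q - 1) * lpSq q 0 y := by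
  have hq0 : 0 < q := by linarith
  set z : ℝ → E d := fun t => x + t • y with hz
  set r : Fin d → ℝ → ℝ := fun i t => z t i ^ 2 + δ with hr
  have hr0 : ∀ i t, 0 < r i t := fun i t => by positivity
  set P : ℝ → ℝ := fun t => ∑ i, r i t ^ q with hP
  have hP0 : ∀ t, 0 < P t := fun t => sum_reg_pos hd hδ (z t)
  set Q : ℝ → ℝ := fun t => ∑ i, r i t ^ (q - 1) * z t i * y i with hQ
  set M : ℝ := (2 * q - 1) * lpSq q 0 y with hM
  have hzd : ∀ i t, HasDerivAt (fun t => z t i) (y i) t := fun i t => by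
    have : (fun t => z t i) = fun t => x i + t * y i := by ext t; simp [hz]
    rw [this]
    simpa using ((hasDerivAt_id t).mul_const (y i)).const_add (x i)
  have hrd : ∀ i t, HasDerivAt (r i) (2 * z t i * y i) t := fun i t => by
    refine (((hzd i t).pow 2).add_const δ).congr_deriv ?_
    simp
  have hPd : ∀ t, HasDerivAt P (2 * q * Q t) t := fun t => by
    have h := HasDerivAt.fun_sum (u := Finset.univ) (A := fun i t => r i t ^ q)
      fun i _ => (hrd i t).rpow_const (p := q) (Or.inl (hr0 i t).ne')
    refine h.congr_deriv ?_
    rw [hQ, Finset.mul_sum]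
    exact Finset.sum_congr rfl fun i _ => by ring
  have hQd : ∀ t, HasDerivAt Q (∑ i, ((2 * z t i * y i * (q - 1) * r i t ^ (q - 1 - 1)) * z t i +
      r i t ^ (q - 1) * y i) * y i) t := fun t => by
    refine HasDerivAt.fun_sum fun i _ => ?_
    exact (((hrd i t).rpow_const (p := q - 1) (Or.inl (hr0 i t).ne')).mul (hzd i t)).mul_const _
  set h1 : ℝ → ℝ := fun t => 2 * P t ^ (1 / q - 1) * Q t with hh1
  have hhd : ∀ t, HasDerivAt (fun t => P t ^ (1 / q)) (h1 t) t := fun t => by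
    refine ((hPd t).rpow_const (p := 1 / q) (Or.inl (hP0 t).ne')).congr_deriv ?_
    rw [hh1]
    field_simp
  have hh1d : ∀ t, HasDerivAt h1 (2 * (2 * q * Q t * (1 / q - 1) * P t ^ (1 / q - 1 - 1)) * Q t +
      2 * P t ^ (1 / q - 1) * (∑ i, ((2 * z t i * y i * (q - 1) * r i t ^ (q - 1 - 1)) * z t i +
      r i t ^ (q - 1) * y i) * y i)) t := fun t =>
    (((hPd t).rpow_const (p := 1 / q - 1) (Or.inl (hP0 t).ne')).const_mul 2).mul (hQd t)
  -- the second derivative along the segment is at most `2 M`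
  have hbound : ∀ t, 2 * (2 * q * Q t * (1 / q - 1) * P t ^ (1 / q - 1 - 1)) * Q t +
      2 * P t ^ (1 / q - 1) * (∑ i, ((2 * z t i * y i * (q - 1) * r i t ^ (q - 1 - 1)) * z t i +
      r i t ^ (q - 1) * y i) * y i) ≤ 2 * M := fun t => by
    -- the derivative of the outer power contributes a nonpositive term since `q > 1`
    have hfirst : 2 * (2 * q * Q t * (1 / q - 1) * P t ^ (1 / q - 1 - 1)) * Q t ≤ 0 := by
      have e : 2 * (2 * q * Q t * (1 / q - 1) * P t ^ (1 / q - 1 - 1)) * Q t =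
          -(4 * (q - 1) * (P t ^ (1 / q - 1 - 1) * Q t ^ 2)) := by
        field_simp
        ring
      rw [e]
      have : 0 ≤ P t ^ (1 / q - 1 - 1) * Q t ^ 2 :=
        mul_nonneg (Real.rpow_nonneg (hP0 t).le _) (sq_nonneg _)
      have : 0 ≤ 4 * (q - 1) * (P t ^ (1 / q - 1 - 1) * Q t ^ 2) :=
        mul_nonneg (by linarith) this
      linarith
    have hsecond : ∑ i, ((2 * z t i * y i * (q - 1) * r i t ^ (q - 1 - 1)) * z t i +
        r i t ^ (q - 1) * y i) * y i ≤ (2 * q - 1) * ∑ i, r i t ^ (q - 1) * y i ^ 2 := by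
      rw [Finset.mul_sum]
      refine Finset.sum_le_sum fun i _ => ?_
      have h3 : z t i ^ 2 * r i t ^ (q - 1 - 1) ≤ r i t ^ (q - 1) := by
        have h4 : r i t * r i t ^ (q - 1 - 1) = r i t ^ (q - 1) := by
          rw [mul_comm, ← Real.rpow_add_one (hr0 i t).ne']; congr 1; ring
        rw [← h4]
        refine mul_le_mul_of_nonneg_right ?_ (Real.rpow_nonneg (hr0 i t).le _)
        simp only [hr]; linarith
      have h5 := mul_le_mul_of_nonneg_left h3 (by positivity : 0 ≤ y i ^ 2)
      have h6 := mul_le_mul_of_nonneg_left h5 (by linarith : 0 ≤ 2 * (q - 1))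
      nlinarith
    have hH := sum_rpow_mul_sq_le hq hδ (z t) y
    have h7 : P t ^ (1 / q - 1) * ∑ i, r i t ^ (q - 1) * y i ^ 2 ≤ lpSq q 0 y := by
      have h8 := mul_le_mul_of_nonneg_left hH (Real.rpow_nonneg (hP0 t).le (1 / q - 1))
      refine h8.trans (le_of_eq ?_)
      rw [← mul_assoc]
      change P t ^ (1 / q - 1) * P t ^ (1 - 1 / q) * _ = _
      rw [← Real.rpow_add (hP0 t)]
      simp
    have h9 := mul_le_mul_of_nonneg_left hsecond (Real.rpow_nonneg (hP0 t).le (1 / q - 1))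
    have h10 := mul_le_mul_of_nonneg_left h7 (by linarith : 0 ≤ 2 * q - 1)
    rw [hM]
    nlinarith
  have hanti : Antitone fun t => h1 t - 2 * M * t := by
    refine antitone_of_hasDerivAt_nonpos (f' := fun t => _ - 2 * M)
      (fun t => ((hh1d t).sub (((hasDerivAt_id t).const_mul (2 * M)).congr_deriv (mul_one _)))) ?_
    intro t
    exact sub_nonpos.2 (hbound t)
  -- the remainder of the quadratic expansion decreases along the segment
  set g : ℝ → ℝ := fun t => P t ^ (1 / q) - h1 0 * t - M * t ^ 2 with hg
  have hgd : ∀ t, HasDerivAt g (h1 t - h1 0 - 2 * M * t) t := fun t => by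
    refine ((hhd t).sub ((hasDerivAt_id t).const_mul (h1 0))).sub
      (((hasDerivAt_id t).pow 2).const_mul M) |>.congr_deriv ?_
    simp; ring
  have hganti : AntitoneOn g (Set.Ici 0) := by
    refine antitoneOn_of_deriv_nonpos (convex_Ici 0)
      (fun t _ => (hgd t).continuousAt.continuousWithinAt)
      (fun t _ => (hgd t).differentiableAt.differentiableWithinAt) fun t ht => ?_
    rw [interior_Ici] at ht
    rw [(hgd t).deriv]
    have h0 := hanti (Set.mem_Ioi.1 ht).le
    simp only at h0
    linarith
  have hfin := hganti (Set.mem_Ici.2 le_rfl) (Set.mem_Ici.2 zero_le_one) zero_le_one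
  have eg0 : g 0 = lpSq q δ x := by simp [hg, hP, hr, hz, lpSq]
  have eg1 : g 1 = lpSq q δ (x + y) - h1 0 - M := by simp [hg, hP, hr, hz, lpSq]
  have eh1 : h1 0 = inner ℝ (lpSqGrad q δ x) y := by
    simp only [hh1, hQ, PiLp.inner_apply, lpSqGrad, hP, hr, hz]
    simp only [zero_smul, add_zero, RCLike.inner_apply, conj_trivial, Finset.mul_sum]
    exact Finset.sum_congr rfl fun i _ => by ring
  rw [eg0, eg1, eh1] at hfin
  linarith

/-! ### Sums of independent centred vectors -/

section Moments

variable {Ω : Type*} [MeasurableSpace Ω] {μ : Measure Ω}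

lemma integrable_comp_of_bounded [IsFiniteMeasure μ] {X : Ω → E d} (hX : Measurable X) {C : ℝ}
    (hC : ∀ᵐ ω ∂μ, ‖X ω‖ ≤ C) {ψ : E d → ℝ} (hψ : Continuous ψ) :
    Integrable (fun ω => ψ (X ω)) μ := by
  obtain ⟨B, hB⟩ := (isCompact_closedBall (0 : E d) C).exists_bound_of_continuousOn hψ.continuousOn
  refine Integrable.of_bound (hψ.measurable.comp hX).aestronglyMeasurable B ?_
  filter_upwards [hC] with ω hω
  exact hB _ (mem_closedBall_zero_iff.2 hω)

/-- The type-2 inequality for `lpSq q δ`: each independent centred summand contributes only its own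
second moment, because the first-order term of the smoothness inequality vanishes on average. -/
lemma integral_lpSq_reg_add_sum_le [IsProbabilityMeasure μ] (hd : 0 < d) {q δ : ℝ} (hq : 1 < q)
    (hδ : 0 < δ) {ι : Type*} {X : ι → Ω → E d} (hX : ∀ i, Measurable (X i)) {C : ℝ}
    (hC : ∀ i, ∀ᵐ ω ∂μ, ‖X i ω‖ ≤ C) (hind : iIndepFun X μ)
    (hmean : ∀ i k, ∫ ω, X i ω k ∂μ = 0) (a : E d) (s : Finset ι) :
    ∫ ω, lpSq q δ (a + ∑ i ∈ s, X i ω) ∂μ ≤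
      lpSq q δ a + (2 * q - 1) * ∑ i ∈ s, ∫ ω, lpSq q 0 (X i ω) ∂μ := by
  classical
  have hq0 : 0 < q := by linarith
  induction s using Finset.induction_on with
  | empty => simp
  | insert j s hj ih =>
    set Y : Ω → E d := fun ω => a + ∑ i ∈ s, X i ω with hY
    have hYm : Measurable Y := measurable_const.add (Finset.measurable_fun_sum s fun i _ => hX i)
    have hYb : ∀ᵐ ω ∂μ, ‖Y ω‖ ≤ ‖a‖ + ∑ _i ∈ s, C := by
      have : ∀ᵐ ω ∂μ, ∀ i ∈ s, ‖X i ω‖ ≤ C := (Finset.eventually_all s).2 fun i _ => hC i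
      filter_upwards [this] with ω hω
      exact (norm_add_le _ _).trans (add_le_add le_rfl
        ((norm_sum_le _ _).trans (Finset.sum_le_sum hω)))
    have hindep : IndepFun Y (X j) μ := by
      have h := hind.indepFun_finsetSum_of_notMem hX hj
      have h2 := h.comp (φ := fun x => a + x) (ψ := id) (by fun_prop) measurable_id
      have e : Y = (fun x => a + x) ∘ ∑ i ∈ s, X i := by ext ω : 1; simp [hY]
      rw [e]
      exact h2
    have hpt : ∀ ω, lpSq q δ (a + ∑ i ∈ insert j s, X i ω) ≤ lpSq q δ (Y ω) +
        (∑ k, lpSqGrad q δ (Y ω) k * X j ω k) + (2 * q - 1) * lpSq q 0 (X j ω) := fun ω => by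
      have h := lpSq_add_le hd hq hδ (Y ω) (X j ω)
      have e : a + ∑ i ∈ insert j s, X i ω = Y ω + X j ω := by
        rw [Finset.sum_insert hj, hY, add_comm (X j ω), add_assoc]
      have e2 : inner ℝ (lpSqGrad q δ (Y ω)) (X j ω) =
          ∑ k, lpSqGrad q δ (Y ω) k * X j ω k := by
        rw [PiLp.inner_apply]; exact Finset.sum_congr rfl fun k _ => by simp [mul_comm]
      rw [e, ← e2]
      exact h
    have hi1 : Integrable (fun ω => lpSq q δ (Y ω)) μ :=
      integrable_comp_of_bounded hYm hYb (continuous_lpSq hq0 δ)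
    have hgk : ∀ k : Fin d, Continuous fun x : E d => lpSqGrad q δ x k := fun k => by
      exact (EuclideanSpace.proj k : E d →L[ℝ] ℝ).continuous.comp (continuous_lpSqGrad hd hδ)
    have hi2a : ∀ k, Integrable (fun ω => lpSqGrad q δ (Y ω) k) μ := fun k =>
      integrable_comp_of_bounded hYm hYb (hgk k)
    have hi2b : ∀ k, Integrable (fun ω => X j ω k) μ := fun k =>
      integrable_comp_of_bounded (hX j) (hC j) (ψ := fun x => x k) (by fun_prop)
    have hik : ∀ k, IndepFun (fun ω => lpSqGrad q δ (Y ω) k) (fun ω => X j ω k) μ := fun k =>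
      hindep.comp (φ := fun x : E d => lpSqGrad q δ x k) (ψ := fun x : E d => x k)
        (hgk k).measurable (by fun_prop)
    have hi2 : ∀ k, Integrable (fun ω => lpSqGrad q δ (Y ω) k * X j ω k) μ := fun k =>
      (hik k).integrable_mul (hi2a k) (hi2b k)
    have hi3 : Integrable (fun ω => lpSq q 0 (X j ω)) μ :=
      integrable_comp_of_bounded (hX j) (hC j) (continuous_lpSq hq0 0)
    have hi0 : Integrable (fun ω => lpSq q δ (a + ∑ i ∈ insert j s, X i ω)) μ := by
      have : (fun ω => lpSq q δ (a + ∑ i ∈ insert j s, X i ω)) =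
          fun ω => lpSq q δ (Y ω + X j ω) := by
        ext ω; congr 1; rw [Finset.sum_insert hj, hY, add_comm (X j ω), add_assoc]
      rw [this]
      refine integrable_comp_of_bounded (hYm.add (hX j)) (C := ‖a‖ + ∑ _i ∈ s, C + C) ?_
        (continuous_lpSq hq0 δ)
      filter_upwards [hYb, hC j] with ω h1 h2
      exact (norm_add_le _ _).trans (add_le_add h1 h2)
    have hisum : Integrable (fun ω => ∑ k, lpSqGrad q δ (Y ω) k * X j ω k) μ :=
      integrable_finsetSum _ fun k _ => hi2 k
    have hi12 : Integrable (fun ω => lpSq q δ (Y ω) +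
        ∑ k, lpSqGrad q δ (Y ω) k * X j ω k) μ := hi1.add hisum
    -- the summand is centred and independent of the partial sum `Y`
    have hzero : ∫ ω, ∑ k, lpSqGrad q δ (Y ω) k * X j ω k ∂μ = 0 := by
      rw [integral_finsetSum _ fun k _ => hi2 k]
      refine Finset.sum_eq_zero fun k _ => ?_
      rw [(hik k).integral_fun_mul_eq_mul_integral (hi2a k).1 (hi2b k).1, hmean, mul_zero]
    calc ∫ ω, lpSq q δ (a + ∑ i ∈ insert j s, X i ω) ∂μ
        ≤ ∫ ω, (lpSq q δ (Y ω) + (∑ k, lpSqGrad q δ (Y ω) k * X j ω k) +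
            (2 * q - 1) * lpSq q 0 (X j ω)) ∂μ :=
          integral_mono hi0 (hi12.add (hi3.const_mul _)) hpt
      _ = ∫ ω, lpSq q δ (Y ω) ∂μ + (2 * q - 1) * ∫ ω, lpSq q 0 (X j ω) ∂μ := by
          rw [integral_add hi12 (hi3.const_mul _), integral_add hi1 hisum, hzero,
            integral_const_mul, add_zero]
      _ ≤ _ := by rw [Finset.sum_insert hj]; linarith

/-- The type-2 inequality for the squared `ℓ_{2q}` norm, the limit `δ → 0` of the regularised one;
the norm itself is not smooth at `0`. -/
lemma integral_lpSq_add_sum_le [IsProbabilityMeasure μ] (hd : 0 < d) {q : ℝ} (hq : 1 < q)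
    {ι : Type*} {X : ι → Ω → E d} (hX : ∀ i, Measurable (X i)) {C : ℝ}
    (hC : ∀ i, ∀ᵐ ω ∂μ, ‖X i ω‖ ≤ C) (hind : iIndepFun X μ)
    (hmean : ∀ i k, ∫ ω, X i ω k ∂μ = 0) (a : E d) (s : Finset ι) :
    ∫ ω, lpSq q 0 (a + ∑ i ∈ s, X i ω) ∂μ ≤
      lpSq q 0 a + (2 * q - 1) * ∑ i ∈ s, ∫ ω, lpSq q 0 (X i ω) ∂μ := by
  have hq0 : 0 < q := by linarith
  have hYm : Measurable fun ω => a + ∑ i ∈ s, X i ω :=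
    measurable_const.add (Finset.measurable_fun_sum s fun i _ => hX i)
  have hYb : ∀ᵐ ω ∂μ, ‖a + ∑ i ∈ s, X i ω‖ ≤ ‖a‖ + ∑ _i ∈ s, C := by
    have : ∀ᵐ ω ∂μ, ∀ i ∈ s, ‖X i ω‖ ≤ C := (Finset.eventually_all s).2 fun i _ => hC i
    filter_upwards [this] with ω hω
    exact (norm_add_le _ _).trans (add_le_add le_rfl
      ((norm_sum_le _ _).trans (Finset.sum_le_sum hω)))
  have hlim : Filter.Tendsto (fun δ => lpSq q δ a +
      (2 * q - 1) * ∑ i ∈ s, ∫ ω, lpSq q 0 (X i ω) ∂μ) (nhdsWithin 0 (Set.Ioi 0))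
      (nhds (lpSq q 0 a + (2 * q - 1) * ∑ i ∈ s, ∫ ω, lpSq q 0 (X i ω) ∂μ)) :=
    (((continuous_lpSq_reg hq0 a).tendsto 0).mono_left nhdsWithin_le_nhds).add_const _
  refine ge_of_tendsto hlim ?_
  filter_upwards [self_mem_nhdsWithin] with δ hδ
  refine le_trans ?_ (integral_lpSq_reg_add_sum_le hd hq hδ hX hC hind hmean a s)
  exact integral_mono (integrable_comp_of_bounded hYm hYb (continuous_lpSq hq0 0))
    (integrable_comp_of_bounded hYm hYb (continuous_lpSq hq0 δ))
    fun ω => lpSq_mono_reg hq0 (Set.mem_Ioi.1 hδ).le _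

end Moments


/-! ### Rademacher vectors -/

instance isProbabilityMeasure_rademacher : IsProbabilityMeasure rademacher := by
  constructor
  simp only [rademacher, Measure.smul_apply, Measure.add_apply, measure_univ, smul_eq_mul]
  rw [one_add_one_eq_two]
  exact ENNReal.inv_mul_cancel two_ne_zero ENNReal.ofNat_ne_top

instance isProbabilityMeasure_rademacherVec (d : ℕ) : IsProbabilityMeasure (rademacherVec d) :=
  Measure.isProbabilityMeasure_map (by fun_prop)

lemma ae_rademacher : ∀ᵐ t ∂rademacher, |t| = 1 := by
  refine Measure.ae_smul_measure ?_ _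
  rw [ae_add_measure_iff]
  have hm : MeasurableSet {t : ℝ | |t| = 1} := measurableSet_eq_fun (by fun_prop) (by fun_prop)
  exact ⟨(ae_dirac_iff hm).2 (by simp), (ae_dirac_iff hm).2 (by simp)⟩

lemma integral_rademacher (f : ℝ → ℝ) : ∫ t, f t ∂rademacher = (f 1 + f (-1)) / 2 := by
  rw [rademacher, integral_smul_measure, integral_add_measure (integrable_dirac (by simp))
    (integrable_dirac (by simp)), integral_dirac, integral_dirac]
  simp
  ring

variable {d : ℕ}

lemma ae_rademacherVec : ∀ᵐ u ∂rademacherVec d, ∀ i, |u i| = 1 := by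
  have hm : Measurable (WithLp.toLp 2 : (Fin d → ℝ) → E d) := by fun_prop
  rw [rademacherVec]
  refine (ae_map_iff hm.aemeasurable ?_).2 ?_
  · have : {u : E d | ∀ i, |u i| = 1} = ⋂ i, {u : E d | |u i| = 1} := by ext; simp
    change MeasurableSet {u : E d | ∀ i, |u i| = 1}
    rw [this]
    exact MeasurableSet.iInter fun i => measurableSet_eq_fun (by fun_prop) (by fun_prop)
  · rw [ae_all_iff]
    intro i
    exact (measurePreserving_eval (fun _ : Fin d => rademacher) i).quasiMeasurePreserving.ae
      ae_rademacher

lemma sq_norm_of_abs_eq_one {u : E d} (hu : ∀ i, |u i| = 1) : ‖u‖ ^ 2 = d := by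
  rw [EuclideanSpace.norm_sq_eq]
  simp [hu]

lemma ae_norm_rademacherVec : ∀ᵐ u ∂rademacherVec d, ‖u‖ ≤ d := by
  filter_upwards [ae_rademacherVec] with u hu
  have h := sq_norm_of_abs_eq_one hu
  rcases Nat.eq_zero_or_pos d with rfl | hd
  · simp at h; simp [h]
  · have hd1 : (1 : ℝ) ≤ d := by exact_mod_cast hd
    have h0 := norm_nonneg u
    nlinarith

lemma integral_rademacherVec_mul (i j : Fin d) :
    ∫ u, u i * u j ∂rademacherVec d = if i = j then 1 else 0 := by
  have hm : Measurable (WithLp.toLp 2 : (Fin d → ℝ) → E d) := by fun_prop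
  rw [rademacherVec, integral_map hm.aemeasurable (by fun_prop)]
  have hI : ∀ i : Fin d, ∀ f : ℝ → ℝ, Measurable f →
      ∫ x : Fin d → ℝ, f (x i) ∂(Measure.pi fun _ => rademacher) = (f 1 + f (-1)) / 2 := by
    intro i f hf
    rw [← integral_rademacher f]
    have h := (measurePreserving_eval (fun _ : Fin d => rademacher) i)
    have h2 := integral_map h.measurable.aemeasurable
      (hf.aestronglyMeasurable (μ := (Measure.pi fun _ => rademacher).map (Function.eval i)))
    rw [h.map_eq] at h2
    exact h2.symm
  split_ifs with hij
  · subst hij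
    have := hI i (fun t => t * t) (by fun_prop)
    rw [this]; norm_num
  · have hind : iIndepFun (fun (i : Fin d) (x : Fin d → ℝ) => x i)
        (Measure.pi fun _ => rademacher) :=
      iIndepFun_pi (μ := fun _ : Fin d => rademacher) (X := fun _ t => t)
        fun i => aemeasurable_id
    have := (hind.indepFun hij).integral_fun_mul_eq_mul_integral
      (measurable_pi_apply i).aestronglyMeasurable (measurable_pi_apply j).aestronglyMeasurable
    rw [this, hI i (fun t => t) measurable_id]
    simp

lemma integrable_rademacherVec {f : E d → ℝ} (hf : Continuous f) :
    Integrable f (rademacherVec d) :=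
  integrable_comp_of_bounded measurable_id ae_norm_rademacherVec hf

/-- The vector `⟨a, u⟩ u` has mean `a`, since the coordinates of `u` are orthonormal. -/
lemma integral_inner_mul_rademacherVec (a : E d) (i : Fin d) :
    ∫ u, inner ℝ a u * u i ∂rademacherVec d = a i := by
  have e : ∀ u : E d, inner ℝ a u * u i = ∑ j, a j * (u j * u i) := fun u => by
    rw [PiLp.inner_apply, Finset.sum_mul]
    exact Finset.sum_congr rfl fun j _ => by simp; ring
  simp only [e]
  rw [integral_finsetSum _ fun j _ => integrable_rademacherVec (by fun_prop)]
  simp only [integral_const_mul, integral_rademacherVec_mul]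
  simp

lemma integral_inner_sq_rademacherVec (a : E d) :
    ∫ u, inner ℝ a u ^ 2 ∂rademacherVec d = ‖a‖ ^ 2 := by
  have e : ∀ u : E d, inner ℝ a u ^ 2 = ∑ j, a j * (inner ℝ a u * u j) := fun u => by
    rw [sq]
    nth_rewrite 2 [PiLp.inner_apply]
    rw [Finset.mul_sum]
    exact Finset.sum_congr rfl fun j _ => by simp; ring
  simp only [e]
  rw [integral_finsetSum _ fun j _ => integrable_rademacherVec (by fun_prop)]
  simp only [integral_const_mul, integral_inner_mul_rademacherVec]
  rw [EuclideanSpace.norm_sq_eq]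
  exact Finset.sum_congr rfl fun j _ => by rw [Real.norm_eq_abs, sq_abs, sq]

/-! ### Smooth losses -/

/-- The quadratic upper bound for a function with Lipschitz gradient. -/
lemma le_quadratic_of_lipschitz_gradient {F : E d → ℝ} {g : E d → E d} {L : ℝ}
    (hF : ∀ x, HasGradientAt F (g x) x) (hg : ∀ x y, ‖g x - g y‖ ≤ L * ‖x - y‖) (x w : E d) :
    F (x + w) ≤ F x + inner ℝ (g x) w + L / 2 * ‖w‖ ^ 2 := by
  set k : ℝ → ℝ := fun t => F (x + t • w) - inner ℝ (g x) w * t - L / 2 * ‖w‖ ^ 2 * t ^ 2 with hk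
  have hlin : ∀ t : ℝ, HasDerivAt (fun s : ℝ => x + s • w) w t := fun t => by
    simpa using ((hasDerivAt_id t).smul_const w).const_add x
  have hkd : ∀ t, HasDerivAt k (inner ℝ (g (x + t • w)) w - inner ℝ (g x) w -
      L * ‖w‖ ^ 2 * t) t := fun t => by
    have h1 := (hF (x + t • w)).hasFDerivAt.comp_hasDerivAt t (hlin t)
    refine ((h1.sub ((hasDerivAt_id t).const_mul (inner ℝ (g x) w))).sub
      (((hasDerivAt_id t).pow 2).const_mul (L / 2 * ‖w‖ ^ 2))).congr_deriv ?_
    simp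
    ring
  have hanti : AntitoneOn k (Set.Ici 0) := by
    refine antitoneOn_of_deriv_nonpos (convex_Ici 0)
      (fun t _ => (hkd t).continuousAt.continuousWithinAt)
      (fun t _ => (hkd t).differentiableAt.differentiableWithinAt) fun t ht => ?_
    rw [interior_Ici] at ht
    have ht0 : 0 < t := ht
    rw [(hkd t).deriv, ← inner_sub_left]
    have h1 := real_inner_le_norm (g (x + t • w) - g x) w
    have h2 := hg (x + t • w) x
    rw [add_sub_cancel_left, norm_smul, Real.norm_eq_abs, abs_of_pos ht0] at h2
    have h3 := mul_le_mul_of_nonneg_right h2 (norm_nonneg w)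
    nlinarith
  have h := hanti (Set.mem_Ici.2 le_rfl) (Set.mem_Ici.2 zero_le_one) zero_le_one
  simp only [hk, one_smul, zero_smul, add_zero, mul_one, mul_zero, sub_zero, one_pow,
    zero_pow two_ne_zero] at h
  linarith

lemma abs_sub_le_quadratic_of_lipschitz_gradient {F : E d → ℝ} {g : E d → E d} {L : ℝ}
    (hF : ∀ x, HasGradientAt F (g x) x) (hg : ∀ x y, ‖g x - g y‖ ≤ L * ‖x - y‖) (x w : E d) :
    |F (x + w) - F x - inner ℝ (g x) w| ≤ L / 2 * ‖w‖ ^ 2 := by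
  have h1 := le_quadratic_of_lipschitz_gradient hF hg x w
  have h2 := le_quadratic_of_lipschitz_gradient (F := fun y => -F y) (g := fun y => -g y) (L := L)
    (fun x => by
      have := (hF x).hasFDerivAt.neg
      rw [hasGradientAt_iff_hasFDerivAt, map_neg]
      exact this)
    (fun x y => by rw [← norm_neg]; simpa [neg_add_eq_sub] using hg x y) x w
  rw [inner_neg_left] at h2
  rw [abs_le]
  constructor <;> linarith

namespace Problem.Admissible

variable {Ξ : Type u} [MeasurableSpace Ξ] {p : Problem d Ξ} {G L R D σ : ℝ}

lemma hasGradientAt_loss (h : p.Admissible G L R D σ) (x : E d) (ξ : Ξ) :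
    HasGradientAt (fun y => p.loss y ξ) (p.sgrad x ξ) x :=
  (h.differentiable_loss ξ x).hasGradientAt

lemma nonempty_sample (h : p.Admissible G L R D σ) : Nonempty Ξ := by
  have := h.prob
  exact nonempty_of_isProbabilityMeasure p.P

lemma G_nonneg (h : p.Admissible G L R D σ) (hd : 0 < d) : 0 ≤ G := by
  obtain ⟨ξ⟩ := h.nonempty_sample
  have := (abs_nonneg _).trans (h.lipschitz_loss ξ (EuclideanSpace.single ⟨0, hd⟩ 1) 0)
  simpa using this

lemma L_nonneg (h : p.Admissible G L R D σ) (hd : 0 < d) : 0 ≤ L := by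
  obtain ⟨ξ⟩ := h.nonempty_sample
  have := (norm_nonneg _).trans (h.lipschitz_sgrad ξ (EuclideanSpace.single ⟨0, hd⟩ 1) 0)
  simpa using this

lemma norm_sgrad_le (h : p.Admissible G L R D σ) (hd : 0 < d) (x : E d) (ξ : Ξ) :
    ‖p.sgrad x ξ‖ ≤ G := by
  have h1 := (h.hasGradientAt_loss x ξ).hasFDerivAt.le_of_lip' (h.G_nonneg hd)
    (Filter.Eventually.of_forall fun y => h.lipschitz_loss ξ y x)
  simpa using h1

lemma abs_loss_sub_le (h : p.Admissible G L R D σ) (x w : E d) (ξ : Ξ) :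
    |p.loss (x + w) ξ - p.loss x ξ - inner ℝ (p.sgrad x ξ) w| ≤ L / 2 * ‖w‖ ^ 2 :=
  abs_sub_le_quadratic_of_lipschitz_gradient (fun x => h.hasGradientAt_loss x ξ)
    (h.lipschitz_sgrad ξ) x w

/-- The stochastic gradient is measurable in `ξ`, as a limit of difference quotients. -/
lemma measurable_sgrad (h : p.Admissible G L R D σ) (x : E d) : Measurable (p.sgrad x) := by
  have hc : ∀ i : Fin d, Measurable fun ξ => p.sgrad x ξ i := by
    intro i
    set e : E d := EuclideanSpace.single i 1 with he
    have hlin : HasDerivAt (fun s : ℝ => x + s • e) e 0 := by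
      simpa using ((hasDerivAt_id (0 : ℝ)).smul_const e).const_add x
    have hder : ∀ ξ, HasDerivAt (fun s : ℝ => p.loss (x + s • e) ξ) (p.sgrad x ξ i) 0 := fun ξ => by
      have h1 := (h.hasGradientAt_loss (x + (0 : ℝ) • e) ξ).hasFDerivAt.comp_hasDerivAt (0 : ℝ) hlin
      refine h1.congr_deriv ?_
      simp [he, EuclideanSpace.inner_single_right]
    have hseq : Filter.Tendsto (fun n : ℕ => (1 / ((n : ℝ) + 1))) Filter.atTop
        (nhdsWithin 0 {0}ᶜ) := by
      refine tendsto_nhdsWithin_iff.2 ⟨tendsto_one_div_add_atTop_nhds_zero_nat, ?_⟩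
      exact Filter.Eventually.of_forall fun n => by
        have : (0 : ℝ) < 1 / ((n : ℝ) + 1) := by positivity
        exact this.ne'
    refine measurable_of_tendsto_metrizable (f := fun (n : ℕ) ξ => (1 / ((n : ℝ) + 1))⁻¹ •
      (p.loss (x + (0 + 1 / ((n : ℝ) + 1)) • e) ξ - p.loss (x + (0 : ℝ) • e) ξ)) ?_ ?_
    · intro n
      have h1 := h.measurable_loss (x + (0 + 1 / ((n : ℝ) + 1)) • e)
      have h2 := h.measurable_loss (x + (0 : ℝ) • e)
      exact (h1.sub h2).const_smul (1 / ((n : ℝ) + 1))⁻¹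
    · rw [tendsto_pi_nhds]
      intro ξ
      exact (hder ξ).tendsto_slope_zero.comp hseq
  have : p.sgrad x = fun ξ => WithLp.toLp 2 (fun i => p.sgrad x ξ i) := by ext; rfl
  rw [this]
  exact (by fun_prop : Measurable (WithLp.toLp 2 : (Fin d → ℝ) → E d)).comp
    (measurable_pi_lambda _ hc)

lemma integrable_sgrad (h : p.Admissible G L R D σ) (hd : 0 < d) (x : E d) :
    Integrable (p.sgrad x) p.P := by
  have := h.prob
  exact Integrable.of_bound (h.measurable_sgrad x).aestronglyMeasurable G
    (Filter.Eventually.of_forall fun ξ => h.norm_sgrad_le hd x ξ)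

lemma gradient_l (h : p.Admissible G L R D σ) (x : E d) :
    gradient p.l x = ∫ ξ, p.sgrad x ξ ∂p.P := (h.unbiased x).gradient

lemma norm_gradient_l_sub_le (h : p.Admissible G L R D σ) (hd : 0 < d) (x y : E d) :
    ‖gradient p.l x - gradient p.l y‖ ≤ L * ‖x - y‖ := by
  have := h.prob
  rw [h.gradient_l, h.gradient_l, ← integral_sub (h.integrable_sgrad hd x) (h.integrable_sgrad hd y)]
  refine (norm_integral_le_of_norm_le_const (C := L * ‖x - y‖)
    (Filter.Eventually.of_forall fun ξ => h.lipschitz_sgrad ξ x y)).trans (le_of_eq ?_)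
  simp

lemma continuous_gradient_l (h : p.Admissible G L R D σ) (hd : 0 < d) :
    Continuous (gradient p.l) := by
  refine (LipschitzWith.of_dist_le_mul (K := L.toNNReal) fun x y => ?_).continuous
  rw [dist_eq_norm, dist_eq_norm, Real.coe_toNNReal _ (h.L_nonneg hd)]
  exact h.norm_gradient_l_sub_le hd x y

lemma l_add_le (h : p.Admissible G L R D σ) (hd : 0 < d) (x w : E d) :
    p.l (x + w) ≤ p.l x + inner ℝ (gradient p.l x) w + L / 2 * ‖w‖ ^ 2 :=
  le_quadratic_of_lipschitz_gradient
    (fun x => by rw [h.gradient_l]; exact h.unbiased x) (h.norm_gradient_l_sub_le hd) x w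

lemma measurable_uncurry_loss (h : p.Admissible G L R D σ) :
    Measurable fun q : E d × Ξ => p.loss q.1 q.2 :=
  measurable_uncurry_of_continuous_of_measurable (u := p.loss)
    (fun ξ => (h.differentiable_loss ξ).continuous) h.measurable_loss

end Problem.Admissible


/-! ### The two-point gradient estimate -/

variable {d : ℕ} {Ξ : Type u} [MeasurableSpace Ξ]

/-- The law of one sample `(ξ, u)`. -/
noncomputable def sampleLaw (p : Problem d Ξ) : Measure (Ξ × E d) := p.P.prod (rademacherVec d)

/-- The difference quotient `(l(x + νu; ξ) - l(x; ξ)) / ν` for the sample `z = (ξ, u)`. -/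
noncomputable def diffQuot (p : Problem d Ξ) (ν : ℝ) (x : E d) (z : Ξ × E d) : ℝ :=
  (p.loss (x + ν • z.2) z.1 - p.loss x z.1) / ν

/-- The expectation of `ζ(z) u` for a sample `z = (ξ, u)`. -/
noncomputable def meanVec (p : Problem d Ξ) (ζ : Ξ × E d → ℝ) : E d :=
  WithLp.toLp 2 fun i => ∫ z, ζ z * z.2 i ∂sampleLaw p

/-- The expectation of the two-point gradient estimate at `x`. -/
noncomputable def meanEst (p : Problem d Ξ) (ν : ℝ) (x : E d) : E d := meanVec p (diffQuot p ν x)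

lemma estimate_eq (p : Problem d Ξ) {m : ℕ} {ν : ℝ} (z : Fin m → Ξ × E d) (x : E d) :
    estimate p ν z x = ∑ j, (1 / (m : ℝ)) • (diffQuot p ν x (z j) • (z j).2) := by
  rw [estimate, Finset.smul_sum]
  refine Finset.sum_congr rfl fun j _ => ?_
  rw [smul_smul, smul_smul, diffQuot]
  congr 1
  rw [one_div, mul_inv]; ring

/-- The expectation of `h ≤ 2 f + 2 g²`, with `f` bounded in expectation and `g²` almost surely. -/
lemma integral_add_sq_le {Ω : Type*} [MeasurableSpace Ω] {μ : Measure Ω} [IsProbabilityMeasure μ]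
    {f g : Ω → ℝ} {A B : ℝ} (hf : Integrable f μ) (hA : ∫ ω, f ω ∂μ ≤ A)
    {h : Ω → ℝ} (hh : Integrable h μ) (hB : ∀ᵐ ω ∂μ, g ω ^ 2 ≤ B)
    (hle : ∀ᵐ ω ∂μ, h ω ≤ 2 * f ω + 2 * g ω ^ 2) : ∫ ω, h ω ∂μ ≤ 2 * A + 2 * B := by
  have h1 : ∫ ω, h ω ∂μ ≤ ∫ ω, (2 * f ω + 2 * B) ∂μ := by
    refine integral_mono_ae hh ((hf.const_mul 2).add (integrable_const _)) ?_
    filter_upwards [hB, hle] with ω h2 h3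
    linarith
  rw [integral_add (hf.const_mul 2) (integrable_const _), integral_const_mul] at h1
  simp only [integral_const, probReal_univ, one_smul] at h1
  linarith

namespace Problem.Admissible

variable {p : Problem d Ξ} {G L R D σ : ℝ}

lemma isProbabilityMeasure_sampleLaw (h : p.Admissible G L R D σ) :
    IsProbabilityMeasure (sampleLaw p) := by
  have := h.prob
  unfold sampleLaw
  infer_instance

lemma ae_sample (h : p.Admissible G L R D σ) : ∀ᵐ z ∂sampleLaw p, ∀ i, |z.2 i| = 1 := by
  have := h.prob
  exact (Measure.quasiMeasurePreserving_snd (μ := p.P) (ν := rademacherVec d)).ae ae_rademacherVec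

lemma measurable_uncurry_diffQuot (h : p.Admissible G L R D σ) (ν : ℝ) :
    Measurable fun q : E d × (Ξ × E d) => diffQuot p ν q.1 q.2 := by
  have h1 := h.measurable_uncurry_loss
  unfold diffQuot
  refine ((h1.comp (f := fun q : E d × (Ξ × E d) => (q.1 + ν • q.2.2, q.2.1)) (by fun_prop)).sub
    (h1.comp (f := fun q : E d × (Ξ × E d) => (q.1, q.2.1)) (by fun_prop))).div_const ν

lemma measurable_diffQuot (h : p.Admissible G L R D σ) (ν : ℝ) (x : E d) :
    Measurable (diffQuot p ν x) :=
  (h.measurable_uncurry_diffQuot ν).comp (f := fun z => (x, z)) (by fun_prop)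

lemma abs_diffQuot_le (h : p.Admissible G L R D σ) (hd : 0 < d) {ν : ℝ} (hν : 0 < ν) (x : E d)
    {z : Ξ × E d} (hz : ∀ i, |z.2 i| = 1) : |diffQuot p ν x z| ≤ G * d := by
  have h1 := h.lipschitz_loss z.1 (x + ν • z.2) x
  rw [add_sub_cancel_left, norm_smul, Real.norm_eq_abs, abs_of_pos hν] at h1
  have h2 := sq_norm_of_abs_eq_one hz
  have h3 : ‖z.2‖ ≤ d := by
    have hd1 : (1 : ℝ) ≤ d := by exact_mod_cast hd
    have h0 := norm_nonneg z.2
    nlinarith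
  rw [diffQuot, abs_div, abs_of_pos hν, div_le_iff₀ hν]
  calc _ ≤ G * (ν * ‖z.2‖) := h1
    _ ≤ G * (ν * d) := by have := h.G_nonneg hd; gcongr
    _ = _ := by ring

lemma abs_diffQuot_sub_inner_le (h : p.Admissible G L R D σ) (hd : 0 < d) {ν b : ℝ} (hν : 0 < ν)
    (hb : ν * d ≤ b) (x : E d) {z : Ξ × E d} (hz : ∀ i, |z.2 i| = 1) :
    |diffQuot p ν x z - inner ℝ (p.sgrad x z.1) z.2| ≤ L * b / 2 := by
  have h1 := h.abs_loss_sub_le x (ν • z.2) z.1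
  rw [norm_smul, mul_pow, sq_norm_of_abs_eq_one hz, Real.norm_eq_abs, abs_of_pos hν,
    inner_smul_right] at h1
  have e : diffQuot p ν x z - inner ℝ (p.sgrad x z.1) z.2 =
      (p.loss (x + ν • z.2) z.1 - p.loss x z.1 - ν * inner ℝ (p.sgrad x z.1) z.2) / ν := by
    rw [diffQuot]; field_simp
  rw [e, abs_div, abs_of_pos hν, div_le_iff₀ hν]
  calc _ ≤ L / 2 * (ν ^ 2 * d) := h1
    _ = L / 2 * (ν * d) * ν := by ring
    _ ≤ L / 2 * b * ν := by have := h.L_nonneg hd; gcongr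
    _ = _ := by ring

lemma integrable_of_bound (h : p.Admissible G L R D σ) {f : Ξ × E d → ℝ} (hf : Measurable f)
    {C : ℝ} (hC : ∀ z : Ξ × E d, (∀ i, |z.2 i| = 1) → |f z| ≤ C) : Integrable f (sampleLaw p) := by
  have := h.isProbabilityMeasure_sampleLaw
  refine Integrable.of_bound hf.aestronglyMeasurable C ?_
  filter_upwards [h.ae_sample] with z hz
  exact hC z hz

lemma abs_inner_le_of_abs_eq_one {a u : E d} {C : ℝ} (ha : ‖a‖ ≤ C) (hu : ∀ i, |u i| = 1) :
    |inner ℝ a u| ≤ C * d := by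
  have h2 := sq_norm_of_abs_eq_one hu
  have h3 : ‖u‖ ≤ d := by
    rcases Nat.eq_zero_or_pos d with rfl | hd
    · simp at h2; simp [h2]
    · have hd1 : (1 : ℝ) ≤ d := by exact_mod_cast hd
      have h0 := norm_nonneg u
      nlinarith
  have hC : 0 ≤ C := (norm_nonneg a).trans ha
  calc _ ≤ ‖a‖ * ‖u‖ := abs_real_inner_le_norm _ _
    _ ≤ _ := by gcongr

/-- Averaging over the Rademacher direction removes the dependence on the dimension. -/
lemma integral_inner_sq_le (h : p.Admissible G L R D σ) {A : Ξ → E d} (hA : Measurable A) {C : ℝ}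
    (hC : ∀ ξ, ‖A ξ‖ ≤ C) :
    Integrable (fun z : Ξ × E d => inner ℝ (A z.1) z.2 ^ 2) (sampleLaw p) ∧
      ∫ z, inner ℝ (A z.1) z.2 ^ 2 ∂sampleLaw p ≤ C ^ 2 := by
  have := h.prob
  have hm : Measurable fun z : Ξ × E d => inner ℝ (A z.1) z.2 ^ 2 :=
    ((hA.comp measurable_fst).inner measurable_snd).pow_const 2
  have hi : Integrable (fun z : Ξ × E d => inner ℝ (A z.1) z.2 ^ 2) (sampleLaw p) :=
    h.integrable_of_bound hm (C := (C * d) ^ 2) fun z hz => by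
      rw [abs_pow]
      have := abs_inner_le_of_abs_eq_one (hC z.1) hz
      gcongr
  refine ⟨hi, ?_⟩
  have hi' := hi
  rw [sampleLaw] at hi' ⊢
  rw [integral_prod _ hi']
  simp only [integral_inner_sq_rademacherVec]
  have h1 : ∀ ξ, ‖A ξ‖ ^ 2 ≤ C ^ 2 := fun ξ => by have := hC ξ; gcongr
  calc ∫ ξ, ‖A ξ‖ ^ 2 ∂p.P ≤ ∫ _ξ, C ^ 2 ∂p.P := by
        refine integral_mono ?_ (integrable_const _) h1
        exact Integrable.of_bound (hA.norm.pow_const 2).aestronglyMeasurable (C ^ 2)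
          (Filter.Eventually.of_forall fun ξ => by
            rw [Real.norm_eq_abs, abs_of_nonneg (sq_nonneg _)]; exact h1 ξ)
    _ = C ^ 2 := by simp

lemma integrable_diffQuot_sq (h : p.Admissible G L R D σ) (hd : 0 < d) {ν : ℝ} (hν : 0 < ν)
    (x : E d) : Integrable (fun z => diffQuot p ν x z ^ 2) (sampleLaw p) :=
  h.integrable_of_bound ((h.measurable_diffQuot ν x).pow_const 2) (C := (G * d) ^ 2) fun z hz => by
    rw [abs_pow]; have := h.abs_diffQuot_le hd hν x hz; gcongr

lemma integrable_diffQuot_sub_sq (h : p.Admissible G L R D σ) (hd : 0 < d) {ν : ℝ} (hν : 0 < ν)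
    (x y : E d) :
    Integrable (fun z => (diffQuot p ν x z - diffQuot p ν y z) ^ 2) (sampleLaw p) :=
  h.integrable_of_bound (((h.measurable_diffQuot ν x).sub (h.measurable_diffQuot ν y)).pow_const 2)
    (C := (G * d + G * d) ^ 2) fun z hz => by
    rw [abs_pow]
    have h1 := (abs_sub (diffQuot p ν x z) (diffQuot p ν y z)).trans
      (add_le_add (h.abs_diffQuot_le hd hν x hz) (h.abs_diffQuot_le hd hν y hz))
    gcongr

lemma integral_diffQuot_sq_le (h : p.Admissible G L R D σ) (hd : 0 < d) {ν b : ℝ} (hν : 0 < ν)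
    (hb : ν * d ≤ b) (x : E d) :
    ∫ z, diffQuot p ν x z ^ 2 ∂sampleLaw p ≤ 2 * G ^ 2 + 2 * (L * b / 2) ^ 2 := by
  have := h.isProbabilityMeasure_sampleLaw
  obtain ⟨hi, hle⟩ := h.integral_inner_sq_le (h.measurable_sgrad x) (h.norm_sgrad_le hd x)
  refine integral_add_sq_le (g := fun z => diffQuot p ν x z - inner ℝ (p.sgrad x z.1) z.2) hi hle
    (h.integrable_diffQuot_sq hd hν x) ?_ (Filter.Eventually.of_forall fun z => ?_)
  · filter_upwards [h.ae_sample] with z hz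
    have := h.abs_diffQuot_sub_inner_le hd hν hb x hz
    rw [← sq_abs]; gcongr
  · nlinarith [sq_nonneg (diffQuot p ν x z - 2 * inner ℝ (p.sgrad x z.1) z.2)]

lemma integral_diffQuot_sub_sq_le (h : p.Admissible G L R D σ) (hd : 0 < d) {ν b : ℝ} (hν : 0 < ν)
    (hb : ν * d ≤ b) (x y : E d) :
    ∫ z, (diffQuot p ν x z - diffQuot p ν y z) ^ 2 ∂sampleLaw p ≤
      2 * (L * ‖x - y‖) ^ 2 + 2 * (L * b) ^ 2 := by
  have := h.isProbabilityMeasure_sampleLaw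
  obtain ⟨hi, hle⟩ := h.integral_inner_sq_le (A := fun ξ => p.sgrad x ξ - p.sgrad y ξ)
    ((h.measurable_sgrad x).sub (h.measurable_sgrad y)) (fun ξ => h.lipschitz_sgrad ξ x y)
  refine integral_add_sq_le (g := fun z => (diffQuot p ν x z - inner ℝ (p.sgrad x z.1) z.2) -
    (diffQuot p ν y z - inner ℝ (p.sgrad y z.1) z.2)) hi hle
    (h.integrable_diffQuot_sub_sq hd hν x y) ?_ (Filter.Eventually.of_forall fun z => ?_)
  · filter_upwards [h.ae_sample] with z hz
    have h1 := (abs_sub _ _).trans (add_le_add (h.abs_diffQuot_sub_inner_le hd hν hb x hz)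
      (h.abs_diffQuot_sub_inner_le hd hν hb y hz))
    rw [← sq_abs]
    have e : L * b = L * b / 2 + L * b / 2 := by ring
    rw [e]
    gcongr
  · simp only [inner_sub_left]
    nlinarith [sq_nonneg (diffQuot p ν x z - diffQuot p ν y z -
      2 * (inner ℝ (p.sgrad x z.1) z.2 - inner ℝ (p.sgrad y z.1) z.2))]

/-- The second moment of the scalar `c(x) - θ c(y)` that drives the recursive estimate. -/
lemma integral_recursive_diffQuot_sq_le (h : p.Admissible G L R D σ) (hd : 0 < d) {ν b : ℝ}
    (hν : 0 < ν) (hb : ν * d ≤ b) (x y : E d) (θ : ℝ) :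
    ∫ z, (diffQuot p ν x z - θ * diffQuot p ν y z) ^ 2 ∂sampleLaw p ≤
      (1 - θ) ^ 2 * (4 * G ^ 2 + L ^ 2 * b ^ 2) +
        θ ^ 2 * (4 * L ^ 2 * (‖x - y‖ ^ 2 + b ^ 2)) := by
  have h1 := h.integral_diffQuot_sq_le hd hν hb x
  have h2 := h.integral_diffQuot_sub_sq_le hd hν hb x y
  have i1 := h.integrable_diffQuot_sq hd hν x
  have i2 := h.integrable_diffQuot_sub_sq hd hν x y
  have i3 : Integrable (fun z => (diffQuot p ν x z - θ * diffQuot p ν y z) ^ 2) (sampleLaw p) :=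
    h.integrable_of_bound (((h.measurable_diffQuot ν x).sub
      ((h.measurable_diffQuot ν y).const_mul θ)).pow_const 2)
      (C := (G * d + |θ| * (G * d)) ^ 2) fun z hz => by
      rw [abs_pow]
      have h1 := abs_sub (diffQuot p ν x z) (θ * diffQuot p ν y z)
      rw [abs_mul] at h1
      have h2 := h.abs_diffQuot_le hd hν x hz
      have h3 := mul_le_mul_of_nonneg_left (h.abs_diffQuot_le hd hν y hz) (abs_nonneg θ)
      have h4 := h1.trans (add_le_add h2 h3)
      gcongr
  have h3 : ∫ z, (diffQuot p ν x z - θ * diffQuot p ν y z) ^ 2 ∂sampleLaw p ≤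
      ∫ z, (2 * (1 - θ) ^ 2 * diffQuot p ν x z ^ 2 +
        2 * θ ^ 2 * (diffQuot p ν x z - diffQuot p ν y z) ^ 2) ∂sampleLaw p := by
    refine integral_mono i3 ((i1.const_mul _).add (i2.const_mul _)) fun z => ?_
    simp only
    nlinarith [sq_nonneg ((1 - θ) * diffQuot p ν x z -
      θ * (diffQuot p ν x z - diffQuot p ν y z))]
  rw [integral_add (i1.const_mul _) (i2.const_mul _), integral_const_mul, integral_const_mul] at h3
  have h4 := mul_le_mul_of_nonneg_left h1 (by positivity : 0 ≤ 2 * (1 - θ) ^ 2)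
  have h5 := mul_le_mul_of_nonneg_left h2 (by positivity : 0 ≤ 2 * θ ^ 2)
  linarith

/-- The two-point estimate is nearly unbiased. -/
lemma lInf_meanEst_sub_le (h : p.Admissible G L R D σ) (hd : 0 < d) {ν b : ℝ} (hν : 0 < ν)
    (hb : ν * d ≤ b) (x : E d) : lInf (meanEst p ν x - gradient p.l x) ≤ L * b / 2 := by
  have := h.prob
  have := h.isProbabilityMeasure_sampleLaw
  have hLb : 0 ≤ L * b / 2 := by
    have := h.L_nonneg hd
    have : 0 ≤ b := le_trans (by positivity) hb
    positivity
  refine lInf_le hLb fun i => ?_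
  have hm1 : Measurable fun z : Ξ × E d => inner ℝ (p.sgrad x z.1) z.2 * z.2 i :=
    (((h.measurable_sgrad x).comp measurable_fst).inner measurable_snd).mul (by fun_prop)
  have hi1 : Integrable (fun z : Ξ × E d => inner ℝ (p.sgrad x z.1) z.2 * z.2 i) (sampleLaw p) :=
    h.integrable_of_bound hm1 (C := G * d) fun z hz => by
      rw [abs_mul, hz i, mul_one]
      exact abs_inner_le_of_abs_eq_one (h.norm_sgrad_le hd x z.1) hz
  have hi2 : Integrable (fun z : Ξ × E d => diffQuot p ν x z * z.2 i) (sampleLaw p) :=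
    h.integrable_of_bound ((h.measurable_diffQuot ν x).mul (by fun_prop)) (C := G * d)
      fun z hz => by
      rw [abs_mul, hz i, mul_one]
      exact h.abs_diffQuot_le hd hν x hz
  have e1 : gradient p.l x i = ∫ z, inner ℝ (p.sgrad x z.1) z.2 * z.2 i ∂sampleLaw p := by
    have hi1' := hi1
    rw [sampleLaw] at hi1' ⊢
    rw [integral_prod _ hi1', h.gradient_l]
    simp only [integral_inner_mul_rademacherVec]
    exact ((EuclideanSpace.proj i : E d →L[ℝ] ℝ).integral_comp_comm (h.integrable_sgrad hd x)).symm
  have e2 : (meanEst p ν x - gradient p.l x) i =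
      ∫ z, (diffQuot p ν x z * z.2 i - inner ℝ (p.sgrad x z.1) z.2 * z.2 i) ∂sampleLaw p := by
    rw [integral_sub hi2 hi1, ← e1]
    rfl
  rw [e2, ← Real.norm_eq_abs]
  refine (norm_integral_le_of_norm_le_const (C := L * b / 2) ?_).trans (by simp)
  filter_upwards [h.ae_sample] with z hz
  rw [← sub_mul, Real.norm_eq_abs, abs_mul, hz i, mul_one]
  exact h.abs_diffQuot_sub_inner_le hd hν hb x hz

/-- The mini-batch mean of `ζ(z) u` in the squared `ℓ_{2q}` norm, where `ζ` is any bounded scalar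
function of the sample. -/
lemma integral_lpSq_batch_le (h : p.Admissible G L R D σ) (hd : 0 < d) {q : ℝ} (hq : 1 < q)
    {m : ℕ} (hm : 0 < m) {ζ : Ξ × E d → ℝ} (hζ : Measurable ζ) {C : ℝ}
    (hC : ∀ z : Ξ × E d, (∀ i, |z.2 i| = 1) → |ζ z| ≤ C) (a : E d) :
    ∫ z, lpSq q 0 (a + ∑ j, (1 / (m : ℝ)) • (ζ (z j) • (z j).2 - meanVec p ζ))
        ∂Measure.pi (fun _ : Fin m => sampleLaw p) ≤
      lpSq q 0 a + (2 * q - 1) * ((d : ℝ) ^ (1 / q) * (4 * ∫ z, ζ z ^ 2 ∂sampleLaw p)) / m := by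
  have := h.prob
  have := h.isProbabilityMeasure_sampleLaw
  have hq0 : 0 < q := by linarith
  have hm0 : (0 : ℝ) < m := by exact_mod_cast hm
  set W : Ξ × E d → E d := fun z => (1 / (m : ℝ)) • (ζ z • z.2 - meanVec p ζ) with hW
  have hWm : Measurable W := ((hζ.smul measurable_snd).sub measurable_const).const_smul (1 / (m : ℝ))
  have hiζ : Integrable ζ (sampleLaw p) := h.integrable_of_bound hζ hC
  have hiabs := hiζ.abs
  have hisq : Integrable (fun z => ζ z ^ 2) (sampleLaw p) :=
    h.integrable_of_bound (hζ.pow_const 2) (C := C ^ 2) fun z hz => by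
      rw [abs_pow]; have := hC z hz; gcongr
  have hiu : ∀ i, Integrable (fun z => ζ z * z.2 i) (sampleLaw p) := fun i =>
    h.integrable_of_bound (hζ.mul (by fun_prop)) (C := C) fun z hz => by
      rw [abs_mul, hz i, mul_one]; exact hC z hz
  set B : ℝ := ∫ z, |ζ z| ∂sampleLaw p with hB
  have hB0 : 0 ≤ B := integral_nonneg fun z => abs_nonneg _
  have hmean_le : ∀ i, |meanVec p ζ i| ≤ B := fun i => by
    change |∫ z, ζ z * z.2 i ∂sampleLaw p| ≤ B
    refine (abs_integral_le_integral_abs).trans (integral_mono_ae (hiu i).abs hiabs ?_)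
    filter_upwards [h.ae_sample] with z hz
    rw [abs_mul, hz i, mul_one]
  -- Jensen's inequality
  have hBsq : B ^ 2 ≤ ∫ z, ζ z ^ 2 ∂sampleLaw p := by
    have h1 : 0 ≤ ∫ z, (ζ z ^ 2 - 2 * B * |ζ z| + B ^ 2) ∂sampleLaw p :=
      integral_nonneg fun z => by
        have := sq_nonneg (|ζ z| - B)
        have e := sq_abs (ζ z)
        simp only [Pi.zero_apply]
        nlinarith
    have hi : Integrable (fun z => ζ z ^ 2 - 2 * B * |ζ z|) (sampleLaw p) :=
      hisq.sub (hiabs.const_mul (2 * B))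
    rw [integral_add hi (integrable_const _), integral_sub hisq (hiabs.const_mul _),
      integral_const_mul, ← hB] at h1
    simp only [integral_const, probReal_univ, one_smul] at h1
    nlinarith
  have hcoord : ∀ z : Ξ × E d, (∀ i, |z.2 i| = 1) → ∀ i,
      |(ζ z • z.2 - meanVec p ζ) i| ≤ |ζ z| + B := fun z hz i => by
    have e : (ζ z • z.2 - meanVec p ζ) i = ζ z * z.2 i - meanVec p ζ i := by simp
    rw [e]
    refine (abs_sub _ _).trans (add_le_add ?_ (hmean_le i))
    rw [abs_mul, hz i, mul_one]
  have hlp : ∀ z : Ξ × E d, (∀ i, |z.2 i| = 1) → lpSq q 0 (W z) ≤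
      (1 / (m : ℝ)) ^ 2 * ((d : ℝ) ^ (1 / q) * (2 * ζ z ^ 2 + 2 * B ^ 2)) := fun z hz => by
    rw [hW, lpSq_smul hq0]
    have h1 := lpSq_le_of_abs_le hq0 (hcoord z hz)
    have h2 : (|ζ z| + B) ^ 2 ≤ 2 * ζ z ^ 2 + 2 * B ^ 2 := by
      rw [← sq_abs (ζ z)]; nlinarith [sq_nonneg (|ζ z| - B)]
    gcongr
    exact h1.trans (by gcongr)
  have hWb : ∀ᵐ z ∂sampleLaw p, ‖W z‖ ≤ (1 / (m : ℝ)) * (∑ _i : Fin d, (C + B)) := by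
    filter_upwards [h.ae_sample] with z hz
    rw [hW, norm_smul, Real.norm_eq_abs, abs_of_pos (by positivity)]
    gcongr
    refine (norm_le_l1Norm _).trans (Finset.sum_le_sum fun i _ => ?_)
    exact (hcoord z hz i).trans (add_le_add (hC z hz) le_rfl)
  have hiW : Integrable (fun z => lpSq q 0 (W z)) (sampleLaw p) :=
    integrable_comp_of_bounded hWm hWb (continuous_lpSq hq0 0)
  have hEW : ∫ z, lpSq q 0 (W z) ∂sampleLaw p ≤
      (1 / (m : ℝ)) ^ 2 * ((d : ℝ) ^ (1 / q) * (4 * ∫ z, ζ z ^ 2 ∂sampleLaw p)) := by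
    have h1 : ∫ z, lpSq q 0 (W z) ∂sampleLaw p ≤
        ∫ z, (1 / (m : ℝ)) ^ 2 * ((d : ℝ) ^ (1 / q) * (2 * ζ z ^ 2 + 2 * B ^ 2)) ∂sampleLaw p := by
      refine integral_mono_ae hiW ?_ ?_
      · exact (((hisq.const_mul 2).add (integrable_const _)).const_mul _).const_mul _
      · filter_upwards [h.ae_sample] with z hz using hlp z hz
    rw [integral_const_mul, integral_const_mul, integral_add (hisq.const_mul 2)
      (integrable_const _), integral_const_mul] at h1
    simp only [integral_const, probReal_univ, one_smul] at h1
    refine h1.trans ?_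
    gcongr
    linarith
  have hmean : ∀ k, ∫ z, W z k ∂sampleLaw p = 0 := fun k => by
    have e : ∀ z, W z k = (1 / (m : ℝ)) * (ζ z * z.2 k - meanVec p ζ k) := fun z => by
      simp [hW]
    simp only [e]
    rw [integral_const_mul, integral_sub (hiu k) (integrable_const _)]
    simp [meanVec]
  -- the coordinate samples on the product space
  have hmp : ∀ j : Fin m, MeasurePreserving (Function.eval j)
      (Measure.pi fun _ : Fin m => sampleLaw p) (sampleLaw p) :=
    fun j => measurePreserving_eval (fun _ : Fin m => sampleLaw p) j
  have hint : ∀ (j : Fin m) (f : Ξ × E d → ℝ), Measurable f →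
      ∫ z, f (z j) ∂(Measure.pi fun _ : Fin m => sampleLaw p) = ∫ z, f z ∂sampleLaw p := by
    intro j f hf
    have h2 := integral_map (hmp j).measurable.aemeasurable (hf.aestronglyMeasurable
      (μ := (Measure.pi fun _ : Fin m => sampleLaw p).map (Function.eval j)))
    rw [(hmp j).map_eq] at h2
    exact h2.symm
  have hind : iIndepFun (fun (j : Fin m) (z : Fin m → Ξ × E d) => W (z j))
      (Measure.pi fun _ : Fin m => sampleLaw p) :=
    iIndepFun_pi (μ := fun _ : Fin m => sampleLaw p) (X := fun _ => W) fun _ => hWm.aemeasurable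
  have hfin := integral_lpSq_add_sum_le hd hq
    (X := fun (j : Fin m) (z : Fin m → Ξ × E d) => W (z j)) (fun j => hWm.comp (measurable_pi_apply j))
    (fun j => (hmp j).quasiMeasurePreserving.ae hWb) hind
    (fun j k => (hint j (fun z => W z k) (by fun_prop)).trans (hmean k)) a Finset.univ
  refine hfin.trans ?_
  have h2 : ∑ j : Fin m, ∫ z, lpSq q 0 (W (z j)) ∂(Measure.pi fun _ : Fin m => sampleLaw p) ≤
      m * ((1 / (m : ℝ)) ^ 2 * ((d : ℝ) ^ (1 / q) * (4 * ∫ z, ζ z ^ 2 ∂sampleLaw p))) := by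
    have : ∀ j : Fin m, ∫ z, lpSq q 0 (W (z j)) ∂(Measure.pi fun _ : Fin m => sampleLaw p) ≤
        (1 / (m : ℝ)) ^ 2 * ((d : ℝ) ^ (1 / q) * (4 * ∫ z, ζ z ^ 2 ∂sampleLaw p)) := fun j => by
      rw [hint j (fun z => lpSq q 0 (W z)) ((continuous_lpSq hq0 0).measurable.comp hWm)]
      exact hEW
    refine (Finset.sum_le_sum fun j _ => this j).trans (le_of_eq ?_)
    simp
  have h3 := mul_le_mul_of_nonneg_left h2 (by linarith : 0 ≤ 2 * q - 1)
  have e : (2 * q - 1) * ((m : ℝ) * ((1 / (m : ℝ)) ^ 2 *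
      ((d : ℝ) ^ (1 / q) * (4 * ∫ z, ζ z ^ 2 ∂sampleLaw p)))) =
      (2 * q - 1) * ((d : ℝ) ^ (1 / q) * (4 * ∫ z, ζ z ^ 2 ∂sampleLaw p)) / m := by
    field_simp
  linarith

/-- One step of the variance-reduced recursion, conditionally on the past: `a` is the previous
error, `y` and `x` the previous and the current iterate, `θ = 1 - γ`. -/
lemma integral_lpSq_recursion_le (h : p.Admissible G L R D σ) (hd : 0 < d) {q : ℝ} (hq : 1 < q)
    {m : ℕ} (hm : 0 < m) {ν b : ℝ} (hν : 0 < ν) (hb : ν * d ≤ b) (x y a : E d) (θ : ℝ) :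
    ∫ z, lpSq q 0 (θ • a + (estimate p ν z x - meanEst p ν x) -
        θ • (estimate p ν z y - meanEst p ν y)) ∂Measure.pi (fun _ : Fin m => sampleLaw p) ≤
      θ ^ 2 * lpSq q 0 a + (d : ℝ) ^ (1 / q) * (2 * q - 1) / m *
        ((1 - θ) ^ 2 * (16 * G ^ 2 + 4 * L ^ 2 * b ^ 2) +
          θ ^ 2 * (16 * L ^ 2 * (‖x - y‖ ^ 2 + b ^ 2))) := by
  have hq0 : 0 < q := by linarith
  have hm0 : (0 : ℝ) < m := by exact_mod_cast hm
  set ζ : Ξ × E d → ℝ := fun z => diffQuot p ν x z - θ * diffQuot p ν y z with hζ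
  have hζm : Measurable ζ :=
    (h.measurable_diffQuot ν x).sub ((h.measurable_diffQuot ν y).const_mul θ)
  have hζb : ∀ z : Ξ × E d, (∀ i, |z.2 i| = 1) → |ζ z| ≤ G * d + |θ| * (G * d) := fun z hz => by
    have h1 := abs_sub (diffQuot p ν x z) (θ * diffQuot p ν y z)
    rw [abs_mul] at h1
    have h2 := h.abs_diffQuot_le hd hν x hz
    have h3 := mul_le_mul_of_nonneg_left (h.abs_diffQuot_le hd hν y hz) (abs_nonneg θ)
    exact h1.trans (add_le_add h2 h3)
  have hi : ∀ (x : E d) i, Integrable (fun z => diffQuot p ν x z * z.2 i) (sampleLaw p) :=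
    fun x i => h.integrable_of_bound ((h.measurable_diffQuot ν x).mul (by fun_prop)) (C := G * d)
      fun z hz => by
      rw [abs_mul, hz i, mul_one]
      exact h.abs_diffQuot_le hd hν x hz
  have hmv : meanVec p ζ = meanEst p ν x - θ • meanEst p ν y := by
    ext i
    have e : ∀ z : Ξ × E d, ζ z * z.2 i =
        diffQuot p ν x z * z.2 i - θ * (diffQuot p ν y z * z.2 i) := fun z => by
      simp only [hζ]; ring
    simp only [meanVec, meanEst, e]
    rw [integral_sub (hi x i) ((hi y i).const_mul θ), integral_const_mul]
    simp
  -- both estimates use the same samples, so their errors combine to one centred mini-batch mean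
  have hpt : ∀ z : Fin m → Ξ × E d, θ • a + (estimate p ν z x - meanEst p ν x) -
        θ • (estimate p ν z y - meanEst p ν y) =
      θ • a + ∑ j, (1 / (m : ℝ)) • (ζ (z j) • (z j).2 - meanVec p ζ) := fun z => by
    have e1 : ∑ j, (1 / (m : ℝ)) • (ζ (z j) • (z j).2 - meanVec p ζ) =
        (estimate p ν z x - θ • estimate p ν z y) - meanVec p ζ := by
      simp only [smul_sub, Finset.sum_sub_distrib]
      congr 1
      · rw [estimate_eq, estimate_eq, Finset.smul_sum, ← Finset.sum_sub_distrib]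
        refine Finset.sum_congr rfl fun j _ => ?_
        simp only [hζ, sub_smul, smul_sub, smul_smul]
        congr 2
        ring
      · rw [Finset.sum_const, Finset.card_univ, Fintype.card_fin, ← Nat.cast_smul_eq_nsmul ℝ,
          smul_smul, mul_one_div_cancel hm0.ne', one_smul]
    rw [e1, hmv, smul_sub]
    abel
  simp only [hpt]
  refine (h.integral_lpSq_batch_le hd hq hm hζm hζb (θ • a)).trans ?_
  rw [lpSq_smul hq0]
  have h1 := h.integral_recursive_diffQuot_sq_le hd hν hb x y θ
  have h2 : (2 * q - 1) * ((d : ℝ) ^ (1 / q) * (4 * ∫ z, ζ z ^ 2 ∂sampleLaw p)) / m ≤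
      (2 * q - 1) * ((d : ℝ) ^ (1 / q) * (4 * ((1 - θ) ^ 2 * (4 * G ^ 2 + L ^ 2 * b ^ 2) +
        θ ^ 2 * (4 * L ^ 2 * (‖x - y‖ ^ 2 + b ^ 2))))) / m := by
    have : 0 ≤ 2 * q - 1 := by linarith
    gcongr
  have e : (2 * q - 1) * ((d : ℝ) ^ (1 / q) * (4 * ((1 - θ) ^ 2 * (4 * G ^ 2 + L ^ 2 * b ^ 2) +
        θ ^ 2 * (4 * L ^ 2 * (‖x - y‖ ^ 2 + b ^ 2))))) / m =
      (d : ℝ) ^ (1 / q) * (2 * q - 1) / m *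
        ((1 - θ) ^ 2 * (16 * G ^ 2 + 4 * L ^ 2 * b ^ 2) +
          θ ^ 2 * (16 * L ^ 2 * (‖x - y‖ ^ 2 + b ^ 2))) := by
    ring
  linarith

end Problem.Admissible


/-! ### The parameters -/

lemma tau_eq_sq (m t : ℕ) : tau m t = ((1 + (t : ℝ) / m) ^ (1 / 3 : ℝ)) ^ 2 := by
  rw [tau, ← Real.rpow_natCast, ← Real.rpow_mul (by positivity)]
  norm_num

lemma one_le_tau (m t : ℕ) : 1 ≤ tau m t :=
  Real.one_le_rpow (by have : 0 ≤ (t : ℝ) / m := by positivity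
                       linarith) (by norm_num)

lemma tau_mono (m : ℕ) {s t : ℕ} (hst : s ≤ t) : tau m s ≤ tau m t := by
  unfold tau
  gcongr

lemma tau_succ_le {m : ℕ} (hm : 1 ≤ m) (t : ℕ) : tau m (t + 1) ≤ tau m t + 1 := by
  have hm1 : (1 : ℝ) ≤ m := by exact_mod_cast hm
  have e : 1 + ((t + 1 : ℕ) : ℝ) / m = (1 + (t : ℝ) / m) + 1 / m := by push_cast; ring
  rw [tau, e]
  refine (Real.rpow_add_le_add_rpow (by positivity) (by positivity) (by norm_num)
    (by norm_num)).trans ?_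
  have h1 : (1 : ℝ) / m ≤ 1 := by rw [div_le_one (by linarith)]; exact hm1
  have h2 : ((1 : ℝ) / m) ^ (2 / 3 : ℝ) ≤ 1 := Real.rpow_le_one (by positivity) h1 (by norm_num)
  unfold tau
  linarith

lemma tau_zero (m : ℕ) : tau m 0 = 1 := by simp [tau]

lemma one_sub_gam (m t : ℕ) : 1 - gam m t = (tau m t - 1) / (tau m t + 1) := by
  have := one_le_tau m t
  rw [gam]
  field_simp
  ring

lemma one_sub_gam_nonneg (m t : ℕ) : 0 ≤ 1 - gam m t := by
  have := one_le_tau m t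
  rw [one_sub_gam]
  exact div_nonneg (by linarith) (by linarith)

lemma one_sub_gam_le_one (m t : ℕ) : 1 - gam m t ≤ 1 := by
  have := one_le_tau m t
  rw [one_sub_gam, div_le_one (by linarith)]
  linarith

lemma one_le_bet (m t : ℕ) : 1 ≤ bet m t := le_max_left _ _

lemma sub_one_div_sqrt_le {x y : ℝ} (hx : 1 ≤ x) (hxy : x ≤ y) :
    (x - 1) / Real.sqrt x ≤ (y - 1) / Real.sqrt y := by
  have e : ∀ z : ℝ, 1 ≤ z → (z - 1) / Real.sqrt z = Real.sqrt z - 1 / Real.sqrt z := by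
    intro z hz
    have h0 : 0 < Real.sqrt z := Real.sqrt_pos.2 (by linarith)
    rw [sub_div, Real.div_sqrt]
  rw [e x hx, e y (hx.trans hxy)]
  have h0 : 0 < Real.sqrt x := Real.sqrt_pos.2 (by linarith)
  have h1 := Real.sqrt_le_sqrt hxy
  have h2 := one_div_le_one_div_of_le h0 h1
  linarith

lemma bet_mono (m : ℕ) {s t : ℕ} (hst : s ≤ t) : bet m s ≤ bet m t :=
  max_le_max le_rfl (sub_one_div_sqrt_le (one_le_tau m s) (tau_mono m hst))

/-- With `a = (1 + (T + 1)/m)^{1/3}` and `c = T^{1/3}` the claim is `a - 1/a ≤ c`, where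
`a³ ≤ c³ + 2`. -/
lemma bet_succ_le {m T : ℕ} (hm : 1 ≤ m) (hT : 1 ≤ T) :
    bet m (T + 1) ≤ (T : ℝ) ^ (1 / 3 : ℝ) := by
  have hm1 : (1 : ℝ) ≤ m := by exact_mod_cast hm
  have hT1 : (1 : ℝ) ≤ T := by exact_mod_cast hT
  set c : ℝ := (T : ℝ) ^ (1 / 3 : ℝ) with hc
  set a : ℝ := (1 + ((T + 1 : ℕ) : ℝ) / m) ^ (1 / 3 : ℝ) with ha
  have hc1 : 1 ≤ c := Real.one_le_rpow hT1 (by norm_num)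
  have ha0 : 0 < a := Real.rpow_pos_of_pos (by positivity) _
  have hc3 : c ^ 3 = T := by
    rw [hc, ← Real.rpow_natCast, ← Real.rpow_mul (by positivity)]; norm_num
  have ha3 : a ^ 3 ≤ 2 + c ^ 3 := by
    rw [hc3, ha, ← Real.rpow_natCast, ← Real.rpow_mul (by positivity)]
    norm_num
    have : ((T : ℝ) + 1) / m ≤ T + 1 := div_le_self (by positivity) hm1
    linarith
  refine max_le hc1 ?_
  rw [tau_eq_sq, ← ha, Real.sqrt_sq ha0.le, div_le_iff₀ ha0]
  by_contra hcon
  push Not at hcon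
  have h1 : c < a := by
    by_contra h2
    push Not at h2
    nlinarith
  have h2 : c * a ^ 2 + a < a ^ 3 := by nlinarith
  have h3 : c ^ 3 + c < c * a ^ 2 := by
    have h4 := mul_lt_mul_of_pos_left hcon (by linarith : 0 < c)
    have h5 := mul_lt_mul_of_pos_left h1 (by positivity : 0 < c ^ 2)
    linarith
  linarith

/-- The weights `(τ_t + 1)² / τ_t` that turn the error recursion into a telescoping sum. -/
noncomputable def errWeight (m t : ℕ) : ℝ := (tau m t + 1) ^ 2 / tau m t

lemma errWeight_mul_gam_sq (m t : ℕ) : errWeight m t * gam m t ^ 2 = 4 / tau m t := by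
  have := one_le_tau m t
  rw [errWeight, gam]
  field_simp
  ring

lemma errWeight_mul_one_sub_gam_sq (m t : ℕ) :
    errWeight m t * (1 - gam m t) ^ 2 = (tau m t - 1) ^ 2 / tau m t := by
  have := one_le_tau m t
  rw [errWeight, one_sub_gam]
  field_simp

/-- The parameter `β_t` is just large enough to dominate the weight of the drift term. -/
lemma errWeight_mul_one_sub_gam_sq_le (m t : ℕ) :
    errWeight m t * (1 - gam m t) ^ 2 ≤ bet m t ^ 2 := by
  have h1 := one_le_tau m t
  have h2 : (tau m t - 1) ^ 2 / tau m t = ((tau m t - 1) / Real.sqrt (tau m t)) ^ 2 := by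
    rw [div_pow, Real.sq_sqrt (by linarith)]
  rw [errWeight_mul_one_sub_gam_sq, h2]
  have h3 : 0 ≤ (tau m t - 1) / Real.sqrt (tau m t) := div_nonneg (by linarith) (Real.sqrt_nonneg _)
  exact pow_le_pow_left₀ h3 (le_max_right _ _) 2

lemma errWeight_nonneg (m t : ℕ) : 0 ≤ errWeight m t := by
  have h1 := one_le_tau m t
  unfold errWeight
  positivity

lemma three_le_errWeight (m t : ℕ) : 3 ≤ errWeight m t := by
  have h1 := one_le_tau m t
  rw [errWeight, le_div_iff₀ (by linarith)]
  nlinarith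

lemma errWeight_one_le {m : ℕ} (hm : 1 ≤ m) : errWeight m 1 ≤ 9 / 2 := by
  have h1 := one_le_tau m 1
  have h2 := tau_succ_le hm 0
  rw [tau_zero, zero_add] at h2
  rw [errWeight, div_le_iff₀ (by linarith)]
  nlinarith

/-- The weights decrease along the recursion by at least `3`, because `τ_{t+1} ≤ τ_t + 1`. -/
lemma three_add_errWeight_le {m : ℕ} (hm : 1 ≤ m) (t : ℕ) :
    3 + errWeight m (t + 1) * (1 - gam m (t + 1)) ^ 2 ≤ errWeight m t := by
  have h1 := one_le_tau m t
  have h2 := tau_succ_le hm t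
  have h3 := tau_mono m (Nat.le_succ t)
  have h4 := one_div_le_one_div_of_le (by linarith) h3
  have e1 : errWeight m t = tau m t + 2 + 1 / tau m t := by
    rw [errWeight]; field_simp; ring
  have e2 : (tau m (t + 1) - 1) ^ 2 / tau m (t + 1) =
      tau m (t + 1) - 2 + 1 / tau m (t + 1) := by
    have := h1.trans h3
    field_simp; ring
  rw [errWeight_mul_one_sub_gam_sq, e1, e2]
  linarith

/-- The increments of the cube root of `1 + t/m` dominate `1/τ_t`. -/
lemma one_div_tau_succ_le {m : ℕ} (hm : 1 ≤ m) (t : ℕ) :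
    1 / tau m (t + 1) ≤ 3 * m * ((1 + ((t + 1 : ℕ) : ℝ) / m) ^ (1 / 3 : ℝ) -
      (1 + (t : ℝ) / m) ^ (1 / 3 : ℝ)) := by
  have hm1 : (1 : ℝ) ≤ m := by exact_mod_cast hm
  rw [tau_eq_sq]
  set b : ℝ := (1 + ((t + 1 : ℕ) : ℝ) / m) ^ (1 / 3 : ℝ) with hb
  set a : ℝ := (1 + (t : ℝ) / m) ^ (1 / 3 : ℝ) with ha
  have ha0 : 0 < a := Real.rpow_pos_of_pos (by positivity) _
  have hb0 : 0 < b := Real.rpow_pos_of_pos (by positivity) _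
  have ha3 : a ^ 3 = 1 + (t : ℝ) / m := by
    rw [ha, ← Real.rpow_natCast, ← Real.rpow_mul (by positivity)]; norm_num
  have hb3 : b ^ 3 = 1 + ((t + 1 : ℕ) : ℝ) / m := by
    rw [hb, ← Real.rpow_natCast, ← Real.rpow_mul (by positivity)]; norm_num
  have hab : a ≤ b := by rw [ha, hb]; gcongr; norm_num
  have hdiff : m * (b ^ 3 - a ^ 3) = 1 := by
    rw [ha3, hb3]; push_cast; field_simp; ring
  have h1 : b ^ 3 - a ^ 3 ≤ 3 * (b - a) * b ^ 2 := by
    nlinarith [mul_nonneg (sub_nonneg.2 hab) (sub_nonneg.2 hab), mul_pos ha0 hb0,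
      mul_nonneg (mul_nonneg (sub_nonneg.2 hab) (sub_nonneg.2 hab)) (add_pos ha0 hb0).le]
  rw [div_le_iff₀ (by positivity), ← hdiff]
  have h2 := mul_le_mul_of_nonneg_left h1 (by linarith : (0 : ℝ) ≤ m)
  linarith

lemma sum_one_div_tau_le {m : ℕ} (hm : 1 ≤ m) (T : ℕ) :
    ∑ n ∈ Finset.range T, 1 / tau m (n + 1) ≤ 3 * m * ((T : ℝ) / m) ^ (1 / 3 : ℝ) := by
  have hm1 : (1 : ℝ) ≤ m := by exact_mod_cast hm
  have h1 : ∑ n ∈ Finset.range T, 1 / tau m (n + 1) ≤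
      3 * m * ((1 + (T : ℝ) / m) ^ (1 / 3 : ℝ) - 1) := by
    induction T with
    | zero => simp
    | succ T ih =>
      rw [Finset.sum_range_succ]
      have := one_div_tau_succ_le hm T
      nlinarith
  refine h1.trans ?_
  have h2 := Real.rpow_add_le_add_rpow (a := 1) (b := (T : ℝ) / m) (p := 1 / 3) zero_le_one
    (by positivity) (by norm_num) (by norm_num)
  rw [Real.one_rpow] at h2
  have : (0 : ℝ) ≤ 3 * m := by positivity
  exact mul_le_mul_of_nonneg_left (by linarith) this

lemma alph_pos {m t : ℕ} {S : ℝ} (hS : 0 ≤ S) : 0 < alph m t S := by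
  have := one_le_bet m t
  exact Real.sqrt_pos.2 (by positivity)

lemma alph_sq {m t : ℕ} {S : ℝ} (hS : 0 ≤ S) : alph m t S ^ 2 = bet m t * (1 + S) := by
  have := one_le_bet m t
  exact Real.sq_sqrt (by positivity)

lemma alph_mono (m : ℕ) {s t : ℕ} (hst : s ≤ t) {S S' : ℝ} (hS : 0 ≤ S) (hSS : S ≤ S') :
    alph m s S ≤ alph m t S' := by
  have h1 := bet_mono m hst
  have h2 := one_le_bet m s
  have h3 := h2.trans h1
  unfold alph
  gcongr

lemma measurable_alph (m t : ℕ) : Measurable (alph m t) := by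
  unfold alph; fun_prop

/-! ### The trajectory of the algorithm -/

section Trajectory

variable {d : ℕ} {Ξ : Type u} [MeasurableSpace Ξ]
variable (p : Problem d Ξ) (m : ℕ) (ν : ℝ) (lam : ℕ → E d → E d → ℝ) (x₁ : E d)

/-- The iterate `x_{n+1}`, after `n` iterations. -/
noncomputable def xs (n : ℕ) (z : ℕ × Fin m → Ξ × E d) : E d := (run p m ν lam x₁ z n).x

/-- The sum `∑_{s ≤ n} λ_s² α_s² ‖v_s - x_s‖₁²`, after `n` iterations. -/
noncomputable def Ss (n : ℕ) (z : ℕ × Fin m → Ξ × E d) : ℝ := (run p m ν lam x₁ z n).S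

/-- The step size `α_{n+1}`, which is determined by the first `n` iterations. -/
noncomputable def al (n : ℕ) (z : ℕ × Fin m → Ξ × E d) : ℝ := alph m (n + 1) (Ss p m ν lam x₁ n z)

/-- The gradient estimate `d_{n+1}`. -/
noncomputable def ds (n : ℕ) (z : ℕ × Fin m → Ξ × E d) : E d := (run p m ν lam x₁ z (n + 1)).dPrev

/-- The projection `v_{n+1}`. -/
noncomputable def vs (n : ℕ) (z : ℕ × Fin m → Ξ × E d) : E d :=
  prox p.K p.r (symEntropy d) (xs p m ν lam x₁ n z) (ds p m ν lam x₁ n z) (al p m ν lam x₁ n z)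

variable {p m ν lam x₁}

lemma xs_zero (z : ℕ × Fin m → Ξ × E d) : xs p m ν lam x₁ 0 z = x₁ := rfl

lemma Ss_zero (z : ℕ × Fin m → Ξ × E d) : Ss p m ν lam x₁ 0 z = 0 := rfl

lemma xs_succ (n : ℕ) (z : ℕ × Fin m → Ξ × E d) :
    xs p m ν lam x₁ (n + 1) z =
      (1 - al p m ν lam x₁ n z / al p m ν lam x₁ (n + 1) z) • xs p m ν lam x₁ n z +
        (al p m ν lam x₁ n z / al p m ν lam x₁ (n + 1) z) • vs p m ν lam x₁ n z := rfl

lemma Ss_succ (n : ℕ) (z : ℕ × Fin m → Ξ × E d) :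
    Ss p m ν lam x₁ (n + 1) z = Ss p m ν lam x₁ n z +
      lam (n + 1) (xs p m ν lam x₁ n z) (vs p m ν lam x₁ n z) ^ 2 * al p m ν lam x₁ n z ^ 2 *
        l1Norm (vs p m ν lam x₁ n z - xs p m ν lam x₁ n z) ^ 2 := rfl

lemma ds_zero (z : ℕ × Fin m → Ξ × E d) :
    ds p m ν lam x₁ 0 z = estimate p ν (fun j => z (1, j)) x₁ := rfl

lemma ds_succ (n : ℕ) (z : ℕ × Fin m → Ξ × E d) :
    ds p m ν lam x₁ (n + 1) z = estimate p ν (fun j => z (n + 2, j)) (xs p m ν lam x₁ (n + 1) z) +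
      (1 - gam m (n + 2)) • (ds p m ν lam x₁ n z -
        estimate p ν (fun j => z (n + 2, j)) (xs p m ν lam x₁ n z)) := by
  have h : ¬ (n + 1 + 1 = 1) := by omega
  change (if n + 1 + 1 = 1 then estimate p ν (fun j => z (n + 2, j)) (xs p m ν lam x₁ (n + 1) z)
    else estimate p ν (fun j => z (n + 2, j)) (xs p m ν lam x₁ (n + 1) z) +
      (1 - gam m (n + 2)) • (ds p m ν lam x₁ n z -
        estimate p ν (fun j => z (n + 2, j)) (xs p m ν lam x₁ n z))) = _
  rw [if_neg h]

lemma run_calls_le (z : ℕ × Fin m → Ξ × E d) (n : ℕ) :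
    (run p m ν lam x₁ z n).calls ≤ 4 * m * n := by
  induction n with
  | zero => simp [run]
  | succ n ih =>
    change (run p m ν lam x₁ z n).calls +
      (if n + 1 = 1 then estimateCalls m else estimateCalls m + estimateCalls m) ≤ _
    have : estimateCalls m = 2 * m := by simp [estimateCalls, mul_comm]
    rw [this]
    split_ifs <;> nlinarith

/-- The state after `n` iterations depends only on the first `n` mini-batches. -/
lemma run_congr {z z' : ℕ × Fin m → Ξ × E d} {n : ℕ}
    (h : ∀ k ∈ Finset.Icc 1 n, ∀ j, z (k, j) = z' (k, j)) :
    run p m ν lam x₁ z n = run p m ν lam x₁ z' n := by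
  induction n with
  | zero => rfl
  | succ n ih =>
    have h1 : run p m ν lam x₁ z n = run p m ν lam x₁ z' n :=
      ih fun k hk j => h k (Finset.Icc_subset_Icc le_rfl (Nat.le_succ n) hk) j
    have h2 : (fun j => z (n + 1, j)) = fun j => z' (n + 1, j) :=
      funext fun j => h (n + 1) (Finset.mem_Icc.2 ⟨by omega, le_rfl⟩) j
    rw [run, run, h1, h2]

variable {G L R D σ : ℝ}

lemma Ss_nonneg (n : ℕ) (z : ℕ × Fin m → Ξ × E d) : 0 ≤ Ss p m ν lam x₁ n z := by
  induction n with
  | zero => rw [Ss_zero]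
  | succ n ih => rw [Ss_succ]; positivity

lemma Ss_le_succ (n : ℕ) (z : ℕ × Fin m → Ξ × E d) :
    Ss p m ν lam x₁ n z ≤ Ss p m ν lam x₁ (n + 1) z := by
  rw [Ss_succ]
  have : 0 ≤ lam (n + 1) (xs p m ν lam x₁ n z) (vs p m ν lam x₁ n z) ^ 2 *
    al p m ν lam x₁ n z ^ 2 * l1Norm (vs p m ν lam x₁ n z - xs p m ν lam x₁ n z) ^ 2 := by
    positivity
  linarith

lemma al_pos (n : ℕ) (z : ℕ × Fin m → Ξ × E d) : 0 < al p m ν lam x₁ n z :=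
  alph_pos (Ss_nonneg n z)

lemma al_le_succ (n : ℕ) (z : ℕ × Fin m → Ξ × E d) :
    al p m ν lam x₁ n z ≤ al p m ν lam x₁ (n + 1) z :=
  alph_mono m (by omega) (Ss_nonneg n z) (Ss_le_succ n z)

lemma al_div_succ_mem (n : ℕ) (z : ℕ × Fin m → Ξ × E d) :
    0 ≤ al p m ν lam x₁ n z / al p m ν lam x₁ (n + 1) z ∧
      al p m ν lam x₁ n z / al p m ν lam x₁ (n + 1) z ≤ 1 :=
  ⟨div_nonneg (al_pos n z).le (al_pos (n + 1) z).le,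
    (div_le_one (al_pos (n + 1) z)).2 (al_le_succ n z)⟩

lemma xs_mem (h : p.Admissible G L R D σ) (hd : 0 < d) (hx₁ : x₁ ∈ p.K) (n : ℕ)
    (z : ℕ × Fin m → Ξ × E d) : xs p m ν lam x₁ n z ∈ p.K := by
  induction n with
  | zero => exact hx₁
  | succ n ih =>
    have h1 := al_div_succ_mem (p := p) (ν := ν) (lam := lam) (x₁ := x₁) n z
    rw [xs_succ]
    exact h.convex ih (h.prox_mem hd ⟨_, hx₁⟩ _ _ _) (by linarith [h1.2]) h1.1 (by ring)

lemma vs_mem (h : p.Admissible G L R D σ) (hd : 0 < d) (hx₁ : x₁ ∈ p.K) (n : ℕ)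
    (z : ℕ × Fin m → Ξ × E d) : vs p m ν lam x₁ n z ∈ p.K :=
  h.prox_mem hd ⟨_, hx₁⟩ _ _ _

lemma measurable_uncurry_estimate (h : p.Admissible G L R D σ) (ν : ℝ) (m : ℕ) :
    Measurable fun q : (Fin m → Ξ × E d) × E d => estimate p ν q.1 q.2 := by
  simp only [estimate_eq]
  refine Finset.measurable_fun_sum _ fun j _ => Measurable.const_smul ?_ (1 / (m : ℝ))
  have h1 : Measurable fun q : (Fin m → Ξ × E d) × E d => q.1 j :=
    (measurable_pi_apply j).comp measurable_fst
  exact ((h.measurable_uncurry_diffQuot ν).comp (measurable_snd.prodMk h1)).smul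
    (measurable_snd.comp h1)

lemma measurable_estimate_comp (h : p.Admissible G L R D σ) (ν : ℝ) {m : ℕ} {Ω : Type*}
    [MeasurableSpace Ω] {b : Ω → Fin m → Ξ × E d} {x : Ω → E d} (hb : Measurable b)
    (hx : Measurable x) : Measurable fun ω => estimate p ν (b ω) (x ω) := by
  have h1 := hb.prodMk hx
  have h2 := (measurable_uncurry_estimate h ν m).comp h1
  exact h2

lemma measurable_batch (m n : ℕ) :
    Measurable fun (z : ℕ × Fin m → Ξ × E d) (j : Fin m) => z (n, j) :=
  measurable_pi_lambda _ fun j => measurable_pi_apply (n, j)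

/-- All parts of the trajectory are measurable functions of the samples. -/
lemma measurable_trajectory (h : p.Admissible G L R D σ) (hd : 0 < d) (hx₁ : x₁ ∈ p.K)
    (hlam : ∀ t, Measurable fun q : E d × E d => lam t q.1 q.2) (n : ℕ) :
    Measurable (xs p m ν lam x₁ n) ∧ Measurable (Ss p m ν lam x₁ n) ∧
      Measurable (ds p m ν lam x₁ n) := by
  induction n with
  | zero =>
    have e1 : xs p m ν lam x₁ 0 = fun _ => x₁ := funext xs_zero
    have e2 : Ss p m ν lam x₁ 0 = fun _ => 0 := funext Ss_zero
    have e3 : ds p m ν lam x₁ 0 = fun z => estimate p ν (fun j => z (1, j)) x₁ := funext ds_zero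
    rw [e1, e2, e3]
    exact ⟨measurable_const, measurable_const,
      measurable_estimate_comp h ν (measurable_batch m 1) measurable_const⟩
  | succ n ih =>
    obtain ⟨hx, hS, hds⟩ := ih
    obtain ⟨F, hF, hFp⟩ := h.exists_measurable_prox hd
    have ha : Measurable (al p m ν lam x₁ n) := (measurable_alph m (n + 1)).comp hS
    have hv : Measurable (vs p m ν lam x₁ n) := by
      have e : vs p m ν lam x₁ n = fun z =>
          F (xs p m ν lam x₁ n z, ds p m ν lam x₁ n z, al p m ν lam x₁ n z) := by
        ext1 z
        rw [hFp _ _ _ (xs_mem h hd hx₁ n z) (al_pos n z)]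
        rfl
      rw [e]
      exact hF.comp (hx.prodMk (hds.prodMk ha))
    have hS' : Measurable (Ss p m ν lam x₁ (n + 1)) := by
      have e : Ss p m ν lam x₁ (n + 1) = fun z => Ss p m ν lam x₁ n z +
          lam (n + 1) (xs p m ν lam x₁ n z) (vs p m ν lam x₁ n z) ^ 2 *
            al p m ν lam x₁ n z ^ 2 *
            l1Norm (vs p m ν lam x₁ n z - xs p m ν lam x₁ n z) ^ 2 := funext fun z => Ss_succ n z
      rw [e]
      have hl : Measurable fun z => lam (n + 1) (xs p m ν lam x₁ n z) (vs p m ν lam x₁ n z) :=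
        (hlam (n + 1)).comp (hx.prodMk hv)
      exact hS.add (((hl.pow_const 2).mul (ha.pow_const 2)).mul
        ((continuous_l1Norm.measurable.comp (hv.sub hx)).pow_const 2))
    have ha' : Measurable (al p m ν lam x₁ (n + 1)) := (measurable_alph m (n + 2)).comp hS'
    have hx' : Measurable (xs p m ν lam x₁ (n + 1)) := by
      have e : xs p m ν lam x₁ (n + 1) = fun z =>
          (1 - al p m ν lam x₁ n z / al p m ν lam x₁ (n + 1) z) • xs p m ν lam x₁ n z +
          (al p m ν lam x₁ n z / al p m ν lam x₁ (n + 1) z) • vs p m ν lam x₁ n z :=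
        funext fun z => xs_succ n z
      rw [e]
      exact ((measurable_const.sub (ha.div ha')).smul hx).add ((ha.div ha').smul hv)
    refine ⟨hx', hS', ?_⟩
    have e : ds p m ν lam x₁ (n + 1) = fun z =>
        estimate p ν (fun j => z (n + 2, j)) (xs p m ν lam x₁ (n + 1) z) +
        (1 - gam m (n + 2)) • (ds p m ν lam x₁ n z -
        estimate p ν (fun j => z (n + 2, j)) (xs p m ν lam x₁ n z)) := funext fun z => ds_succ n z
    rw [e]
    have hb := measurable_batch (Ξ := Ξ) (d := d) m (n + 2)
    exact (measurable_estimate_comp h ν hb hx').add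
      ((hds.sub (measurable_estimate_comp h ν hb hx)).const_smul (1 - gam m (n + 2)))

lemma measurable_al (h : p.Admissible G L R D σ) (hd : 0 < d) (hx₁ : x₁ ∈ p.K)
    (hlam : ∀ t, Measurable fun q : E d × E d => lam t q.1 q.2) (n : ℕ) :
    Measurable (al p m ν lam x₁ n) :=
  (measurable_alph m (n + 1)).comp (measurable_trajectory h hd hx₁ hlam n).2.1

lemma measurable_vs (h : p.Admissible G L R D σ) (hd : 0 < d) (hx₁ : x₁ ∈ p.K)
    (hlam : ∀ t, Measurable fun q : E d × E d => lam t q.1 q.2) (n : ℕ) :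
    Measurable (vs p m ν lam x₁ n) := by
  obtain ⟨hx, hS, hds⟩ := measurable_trajectory (m := m) (ν := ν) h hd hx₁ hlam n
  obtain ⟨F, hF, hFp⟩ := h.exists_measurable_prox hd
  have e : vs p m ν lam x₁ n = fun z =>
      F (xs p m ν lam x₁ n z, ds p m ν lam x₁ n z, al p m ν lam x₁ n z) := by
    ext1 z
    rw [hFp _ _ _ (xs_mem h hd hx₁ n z) (al_pos n z)]
    rfl
  rw [e]
  exact hF.comp (hx.prodMk (hds.prodMk (measurable_al h hd hx₁ hlam n)))

lemma l1Norm_vs_sub_le (h : p.Admissible G L R D σ) (hd : 0 < d) (hx₁ : x₁ ∈ p.K) (n : ℕ)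
    (z : ℕ × Fin m → Ξ × E d) :
    l1Norm (vs p m ν lam x₁ n z - xs p m ν lam x₁ n z) ≤ 2 * D := by
  have h1 := h.l1Norm_le hd (vs_mem (ν := ν) (lam := lam) h hd hx₁ n z)
  have h2 := h.l1Norm_le hd (xs_mem (ν := ν) (lam := lam) h hd hx₁ n z)
  have h3 := l1Norm_add_le (vs p m ν lam x₁ n z) (-xs p m ν lam x₁ n z)
  rw [l1Norm_neg, ← sub_eq_add_neg] at h3
  linarith

/-- For each fixed `n` the step sizes are bounded uniformly over all samples. -/
lemma exists_Ss_le (h : p.Admissible G L R D σ) (hd : 0 < d) (hD : 0 < D) (hx₁ : x₁ ∈ p.K)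
    (hlam : ∀ t, ∀ x ∈ p.K, ∀ y ∈ p.K, 1 / (D + 1) ≤ lam t x y ∧ lam t x y ≤ 1) (n : ℕ) :
    ∃ B, ∀ z : ℕ × Fin m → Ξ × E d, Ss p m ν lam x₁ n z ≤ B := by
  induction n with
  | zero => exact ⟨0, fun z => (Ss_zero z).le⟩
  | succ n ih =>
    obtain ⟨B, hB⟩ := ih
    refine ⟨B + 1 ^ 2 * (bet m (n + 1) * (1 + B)) * (2 * D) ^ 2, fun z => ?_⟩
    have h1 := hlam (n + 1) _ (xs_mem (ν := ν) (lam := lam) h hd hx₁ n z) _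
      (vs_mem (ν := ν) (lam := lam) h hd hx₁ n z)
    have hb0 : 0 ≤ B := (Ss_nonneg n z).trans (hB z)
    have hb1 := one_le_bet m (n + 1)
    have h0 : 0 ≤ lam (n + 1) (xs p m ν lam x₁ n z) (vs p m ν lam x₁ n z) :=
      le_trans (by positivity) h1.1
    have h2 : al p m ν lam x₁ n z ^ 2 ≤ bet m (n + 1) * (1 + B) := by
      rw [al, alph_sq (Ss_nonneg n z)]
      have := one_le_bet m (n + 1)
      have := hB z
      gcongr
    have h3 := l1Norm_vs_sub_le (ν := ν) (lam := lam) h hd hx₁ n z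
    have h4 := l1Norm_nonneg (vs p m ν lam x₁ n z - xs p m ν lam x₁ n z)
    rw [Ss_succ]
    have h5 := h1.2
    have h6 := hB z
    gcongr

lemma lInf_estimate_le (h : p.Admissible G L R D σ) (hd : 0 < d) (hν : 0 < ν) (hm : 0 < m)
    {z : Fin m → Ξ × E d} (hz : ∀ j i, |(z j).2 i| = 1) (x : E d) :
    lInf (estimate p ν z x) ≤ G * d := by
  have hG := h.G_nonneg hd
  have hm0 : (0 : ℝ) < m := by exact_mod_cast hm
  refine lInf_le (by positivity) fun i => ?_
  rw [estimate_eq]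
  have e : (∑ j, (1 / (m : ℝ)) • (diffQuot p ν x (z j) • (z j).2)) i =
      ∑ j, (1 / (m : ℝ)) * (diffQuot p ν x (z j) * (z j).2 i) := by
    simp
  rw [e]
  refine (Finset.abs_sum_le_sum_abs _ _).trans ?_
  have : ∀ j ∈ Finset.univ, |(1 / (m : ℝ)) * (diffQuot p ν x (z j) * (z j).2 i)| ≤
      (1 / (m : ℝ)) * (G * d) := fun j _ => by
    rw [abs_mul, abs_mul, hz j i, mul_one, abs_of_pos (by positivity)]
    have := h.abs_diffQuot_le hd hν x (hz j)
    gcongr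
  refine (Finset.sum_le_sum this).trans (le_of_eq ?_)
  simp
  field_simp

lemma exists_lInf_ds_le (h : p.Admissible G L R D σ) (hd : 0 < d) (hν : 0 < ν) (hm : 0 < m)
    (n : ℕ) : ∃ B, ∀ z : ℕ × Fin m → Ξ × E d, (∀ k i, |(z k).2 i| = 1) →
      lInf (ds p m ν lam x₁ n z) ≤ B := by
  induction n with
  | zero => exact ⟨G * d, fun z hz => lInf_estimate_le h hd hν hm (fun j i => hz _ i) _⟩
  | succ n ih =>
    obtain ⟨B, hB⟩ := ih
    refine ⟨G * d + (B + G * d), fun z hz => ?_⟩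
    have h1 := lInf_estimate_le h hd hν hm (z := fun j => z (n + 2, j)) (fun j i => hz _ i)
      (xs p m ν lam x₁ (n + 1) z)
    have h2 := lInf_estimate_le h hd hν hm (z := fun j => z (n + 2, j)) (fun j i => hz _ i)
      (xs p m ν lam x₁ n z)
    have h3 := hB z hz
    rw [ds_succ]
    refine (lInf_add_le _ _).trans (add_le_add h1 ?_)
    set w := ds p m ν lam x₁ n z - estimate p ν (fun j => z (n + 2, j)) (xs p m ν lam x₁ n z) with hw
    have h4 : lInf w ≤ B + G * d := by
      have := lInf_add_le (ds p m ν lam x₁ n z)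
        (-estimate p ν (fun j => z (n + 2, j)) (xs p m ν lam x₁ n z))
      rw [lInf_neg, ← sub_eq_add_neg] at this
      linarith
    have h5 : lInf ((1 - gam m (n + 2)) • w) = |1 - gam m (n + 2)| * lInf w := by
      simp [lInf, norm_smul]
    rw [h5, abs_of_nonneg (one_sub_gam_nonneg _ _)]
    have h6 := mul_le_mul_of_nonneg_right (one_sub_gam_le_one m (n + 2)) (lInf_nonneg w)
    linarith

end Trajectory


/-! ### The potential argument along one trajectory -/

section Pathwise

variable {d : ℕ} {Ξ : Type u} [MeasurableSpace Ξ] {p : Problem d Ξ} {m : ℕ} {ν : ℝ}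
  {lam : ℕ → E d → E d → ℝ} {x₁ : E d} {G L R D σ : ℝ}

variable (p m ν lam x₁ D) in
/-- The squared `ℓ₁` length of the scaled step, `(η_t ‖v_t - x_t‖₁)²` for `t = n + 1`. -/
noncomputable def stepSq (n : ℕ) (z : ℕ × Fin m → Ξ × E d) : ℝ :=
  (al p m ν lam x₁ n z / (D + 1) * l1Norm (vs p m ν lam x₁ n z - xs p m ν lam x₁ n z)) ^ 2

variable (p m ν lam x₁ D) in
/-- The sum of the squared scaled steps of the first `n` iterations. -/
noncomputable def stepSum (n : ℕ) (z : ℕ × Fin m → Ξ × E d) : ℝ :=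
  ∑ k ∈ Finset.range n, stepSq p m ν lam x₁ D k z

variable (p m ν lam x₁) in
/-- The error `‖d_t - ∇l(x_t)‖_∞` of the gradient estimate, for `t = n + 1`. -/
noncomputable def gradErr (n : ℕ) (z : ℕ × Fin m → Ξ × E d) : ℝ :=
  lInf (ds p m ν lam x₁ n z - gradient p.l (xs p m ν lam x₁ n z))

lemma stepSq_nonneg (n : ℕ) (z : ℕ × Fin m → Ξ × E d) : 0 ≤ stepSq p m ν lam x₁ D n z :=
  sq_nonneg _

lemma stepSum_nonneg (n : ℕ) (z : ℕ × Fin m → Ξ × E d) : 0 ≤ stepSum p m ν lam x₁ D n z :=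
  Finset.sum_nonneg fun k _ => stepSq_nonneg k z

lemma stepSum_succ (n : ℕ) (z : ℕ × Fin m → Ξ × E d) : stepSum p m ν lam x₁ D (n + 1) z =
    stepSum p m ν lam x₁ D n z + stepSq p m ν lam x₁ D n z := Finset.sum_range_succ _ _

lemma stepSum_mono {n n' : ℕ} (hn : n ≤ n') (z : ℕ × Fin m → Ξ × E d) :
    stepSum p m ν lam x₁ D n z ≤ stepSum p m ν lam x₁ D n' z :=
  Finset.sum_le_sum_of_subset_of_nonneg (Finset.range_subset_range.2 hn)
    fun k _ _ => stepSq_nonneg k z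

/-- Since `1/(D+1) ≤ λ_t ≤ 1`, the sum in the step size is comparable with `stepSum`. -/
lemma stepSum_le_Ss_le (h : p.Admissible G L R D σ) (hd : 0 < d) (hD : 0 < D) (hx₁ : x₁ ∈ p.K)
    (hlam : ∀ t, ∀ x ∈ p.K, ∀ y ∈ p.K, 1 / (D + 1) ≤ lam t x y ∧ lam t x y ≤ 1) (n : ℕ)
    (z : ℕ × Fin m → Ξ × E d) :
    stepSum p m ν lam x₁ D n z ≤ Ss p m ν lam x₁ n z ∧
      Ss p m ν lam x₁ n z ≤ (D + 1) ^ 2 * stepSum p m ν lam x₁ D n z := by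
  induction n with
  | zero => simp [stepSum, Ss_zero]
  | succ n ih =>
    obtain ⟨h1, h2⟩ := hlam (n + 1) _ (xs_mem (ν := ν) (lam := lam) h hd hx₁ n z) _
      (vs_mem (ν := ν) (lam := lam) h hd hx₁ n z)
    rw [stepSum_succ, Ss_succ, stepSq]
    set l := lam (n + 1) (xs p m ν lam x₁ n z) (vs p m ν lam x₁ n z)
    set a := al p m ν lam x₁ n z
    set δ := l1Norm (vs p m ν lam x₁ n z - xs p m ν lam x₁ n z)
    have h0 : 0 ≤ 1 / (D + 1) := by positivity
    have h3 : (1 / (D + 1)) ^ 2 ≤ l ^ 2 := by gcongr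
    have h4 : l ^ 2 ≤ 1 := by nlinarith
    have h5 : 0 ≤ a ^ 2 * δ ^ 2 := by positivity
    have e1 : (a / (D + 1) * δ) ^ 2 = (1 / (D + 1)) ^ 2 * (a ^ 2 * δ ^ 2) := by field_simp
    have e2 : (D + 1) ^ 2 * (a / (D + 1) * δ) ^ 2 = a ^ 2 * δ ^ 2 := by field_simp
    constructor
    · rw [e1]
      have := mul_le_mul_of_nonneg_right h3 h5
      linarith [ih.1]
    · rw [mul_add, e2]
      have := mul_le_mul_of_nonneg_right h4 h5
      linarith [ih.2]

lemma one_add_stepSum_le_al_sq (h : p.Admissible G L R D σ) (hd : 0 < d) (hD : 0 < D)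
    (hx₁ : x₁ ∈ p.K)
    (hlam : ∀ t, ∀ x ∈ p.K, ∀ y ∈ p.K, 1 / (D + 1) ≤ lam t x y ∧ lam t x y ≤ 1) (n : ℕ)
    (z : ℕ × Fin m → Ξ × E d) :
    bet m (n + 1) * (1 + stepSum p m ν lam x₁ D n z) ≤ al p m ν lam x₁ n z ^ 2 := by
  have h1 := (stepSum_le_Ss_le (ν := ν) h hd hD hx₁ hlam n z).1
  have h2 := one_le_bet m (n + 1)
  rw [al, alph_sq (Ss_nonneg n z)]
  gcongr

lemma xs_succ_sub (n : ℕ) (z : ℕ × Fin m → Ξ × E d) :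
    xs p m ν lam x₁ (n + 1) z - xs p m ν lam x₁ n z =
      (al p m ν lam x₁ n z / al p m ν lam x₁ (n + 1) z) •
        (vs p m ν lam x₁ n z - xs p m ν lam x₁ n z) := by
  rw [xs_succ, sub_smul, one_smul, smul_sub]
  abel

lemma norm_xs_succ_sub_sq_le (h : p.Admissible G L R D σ) (hd : 0 < d) (hD : 0 < D)
    (hx₁ : x₁ ∈ p.K)
    (hlam : ∀ t, ∀ x ∈ p.K, ∀ y ∈ p.K, 1 / (D + 1) ≤ lam t x y ∧ lam t x y ≤ 1) (n : ℕ)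
    (z : ℕ × Fin m → Ξ × E d) :
    bet m (n + 2) * ‖xs p m ν lam x₁ (n + 1) z - xs p m ν lam x₁ n z‖ ^ 2 ≤
      (D + 1) ^ 2 * (stepSq p m ν lam x₁ D n z / (1 + stepSum p m ν lam x₁ D (n + 1) z)) := by
  have h1 := one_add_stepSum_le_al_sq (ν := ν) h hd hD hx₁ hlam (n + 1) z
  have h2 : 0 < al p m ν lam x₁ (n + 1) z := al_pos _ _
  have h3 : 0 < 1 + stepSum p m ν lam x₁ D (n + 1) z := by
    have := stepSum_nonneg (p := p) (ν := ν) (lam := lam) (x₁ := x₁) (D := D) (n + 1) z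
    linarith
  have h4 := norm_le_l1Norm (vs p m ν lam x₁ n z - xs p m ν lam x₁ n z)
  have h0 : 0 < al p m ν lam x₁ n z := al_pos _ _
  rw [xs_succ_sub, norm_smul, Real.norm_eq_abs, abs_of_pos (div_pos h0 h2), stepSq]
  set a := al p m ν lam x₁ n z
  set a' := al p m ν lam x₁ (n + 1) z
  set δ := l1Norm (vs p m ν lam x₁ n z - xs p m ν lam x₁ n z)
  have e2 : (D + 1) ^ 2 * ((a / (D + 1) * δ) ^ 2 / (1 + stepSum p m ν lam x₁ D (n + 1) z)) =
      a ^ 2 * δ ^ 2 / (1 + stepSum p m ν lam x₁ D (n + 1) z) := by field_simp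
  rw [e2, le_div_iff₀ h3]
  calc _ = (bet m (n + 2) * (1 + stepSum p m ν lam x₁ D (n + 1) z)) *
        (a / a' * ‖vs p m ν lam x₁ n z - xs p m ν lam x₁ n z‖) ^ 2 := by ring
    _ ≤ a' ^ 2 * (a / a' * δ) ^ 2 := by gcongr
    _ = a ^ 2 * δ ^ 2 := by field_simp

/-- A harmonic-type sum: the increments of `log (1 + A)` dominate `a / (1 + A)`. -/
lemma sum_stepSq_div_le (n : ℕ) (z : ℕ × Fin m → Ξ × E d) :
    ∑ k ∈ Finset.range n, stepSq p m ν lam x₁ D k z / (1 + stepSum p m ν lam x₁ D (k + 1) z) ≤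
      Real.log (1 + stepSum p m ν lam x₁ D n z) := by
  induction n with
  | zero => simp [stepSum]
  | succ n ih =>
    rw [Finset.sum_range_succ]
    have h0 := stepSum_nonneg (p := p) (ν := ν) (lam := lam) (x₁ := x₁) (D := D) n z
    have h1 := stepSq_nonneg (p := p) (ν := ν) (lam := lam) (x₁ := x₁) (D := D) n z
    have h2 := stepSum_succ (p := p) (ν := ν) (lam := lam) (x₁ := x₁) (D := D) n z
    set A := stepSum p m ν lam x₁ D n z
    set A' := stepSum p m ν lam x₁ D (n + 1) z
    set a := stepSq p m ν lam x₁ D n z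
    have hA : 0 < 1 + A := by linarith
    have hA' : 0 < 1 + A' := by linarith
    have h3 := Real.one_sub_inv_le_log_of_pos (div_pos hA' hA)
    rw [Real.log_div hA'.ne' hA.ne', inv_div] at h3
    have e : a / (1 + A') = 1 - (1 + A) / (1 + A') := by
      rw [h2] at hA' ⊢; field_simp; ring
    linarith

/-- One step decreases the objective, up to the error of the gradient estimate. -/
lemma descent_step (h : p.Admissible G L R D σ) (hd : 0 < d) (hD : 0 < D) (hx₁ : x₁ ∈ p.K)
    (n : ℕ) (z : ℕ × Fin m → Ξ × E d) :
    stepSq p m ν lam x₁ D n z ≤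
      al p m ν lam x₁ (n + 1) z / (D + 1) *
        ((p.l (xs p m ν lam x₁ n z) + p.r (xs p m ν lam x₁ n z)) -
          (p.l (xs p m ν lam x₁ (n + 1) z) + p.r (xs p m ν lam x₁ (n + 1) z))) +
      (gradErr p m ν lam x₁ n z ^ 2 + stepSq p m ν lam x₁ D n z / 4) +
      L / 2 * (D + 1) * (stepSq p m ν lam x₁ D n z / al p m ν lam x₁ (n + 1) z) := by
  have hx := xs_mem (ν := ν) (lam := lam) h hd hx₁ n z
  have hv := vs_mem (ν := ν) (lam := lam) h hd hx₁ n z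
  have h0 : 0 < al p m ν lam x₁ n z := al_pos _ _
  have h0' : 0 < al p m ν lam x₁ (n + 1) z := al_pos _ _
  have hL := h.L_nonneg hd
  have hρ := al_div_succ_mem (p := p) (ν := ν) (lam := lam) (x₁ := x₁) n z
  have hdec := h.prox_decrease hd hx (ds p m ν lam x₁ n z) h0.le
  change inner ℝ (ds p m ν lam x₁ n z) (vs p m ν lam x₁ n z - xs p m ν lam x₁ n z) +
    p.r (vs p m ν lam x₁ n z) - p.r (xs p m ν lam x₁ n z) ≤ _ at hdec
  change _ ≤ -(al p m ν lam x₁ n z / (D + 1) *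
    l1Norm (vs p m ν lam x₁ n z - xs p m ν lam x₁ n z) ^ 2) at hdec
  have hsub := xs_succ_sub (p := p) (ν := ν) (lam := lam) (x₁ := x₁) n z
  have hr : p.r (xs p m ν lam x₁ (n + 1) z) ≤ p.r (xs p m ν lam x₁ n z) +
      al p m ν lam x₁ n z / al p m ν lam x₁ (n + 1) z *
        (p.r (vs p m ν lam x₁ n z) - p.r (xs p m ν lam x₁ n z)) := by
    rw [xs_succ]
    have := h.convex_r.2 (Set.mem_univ (xs p m ν lam x₁ n z)) (Set.mem_univ (vs p m ν lam x₁ n z))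
      (sub_nonneg.2 hρ.2) hρ.1 (by ring)
    rw [smul_eq_mul, smul_eq_mul] at this
    linarith
  have hl := h.l_add_le hd (xs p m ν lam x₁ n z)
    (xs p m ν lam x₁ (n + 1) z - xs p m ν lam x₁ n z)
  rw [add_sub_cancel, hsub, inner_smul_right, norm_smul, Real.norm_eq_abs, abs_of_nonneg hρ.1,
    mul_pow] at hl
  have herr : inner ℝ (gradient p.l (xs p m ν lam x₁ n z))
      (vs p m ν lam x₁ n z - xs p m ν lam x₁ n z) ≤
      inner ℝ (ds p m ν lam x₁ n z) (vs p m ν lam x₁ n z - xs p m ν lam x₁ n z) +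
      gradErr p m ν lam x₁ n z * l1Norm (vs p m ν lam x₁ n z - xs p m ν lam x₁ n z) := by
    have := inner_le_lInf_mul_l1Norm
      (gradient p.l (xs p m ν lam x₁ n z) - ds p m ν lam x₁ n z)
      (vs p m ν lam x₁ n z - xs p m ν lam x₁ n z)
    rw [inner_sub_left, ← lInf_neg, neg_sub] at this
    rw [gradErr]
    linarith
  have hnorm := norm_le_l1Norm (vs p m ν lam x₁ n z - xs p m ν lam x₁ n z)
  have hnn := norm_nonneg (vs p m ν lam x₁ n z - xs p m ν lam x₁ n z)
  rw [stepSq]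
  set a := al p m ν lam x₁ n z
  set a' := al p m ν lam x₁ (n + 1) z
  set δ := l1Norm (vs p m ν lam x₁ n z - xs p m ν lam x₁ n z)
  set N := ‖vs p m ν lam x₁ n z - xs p m ν lam x₁ n z‖
  set e := gradErr p m ν lam x₁ n z
  set lx := p.l (xs p m ν lam x₁ n z)
  set lx' := p.l (xs p m ν lam x₁ (n + 1) z)
  set rx := p.r (xs p m ν lam x₁ n z)
  set rx' := p.r (xs p m ν lam x₁ (n + 1) z)
  have hN2 : N ^ 2 ≤ δ ^ 2 := by gcongr
  have h1 : (lx' + rx') - (lx + rx) ≤ a / a' * (-(a / (D + 1) * δ ^ 2) + e * δ) +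
      L / 2 * ((a / a') ^ 2 * δ ^ 2) := by
    have h2 := mul_le_mul_of_nonneg_left (add_le_add hdec herr) hρ.1
    have h3 : L / 2 * ((a / a') ^ 2 * N ^ 2) ≤ L / 2 * ((a / a') ^ 2 * δ ^ 2) := by gcongr
    nlinarith
  -- scaling by `η_{t+1} = a' / (D + 1)` turns the decrease into the squared scaled step
  have h2 := mul_le_mul_of_nonneg_left h1 (by positivity : 0 ≤ a' / (D + 1))
  have e1 : a' / (D + 1) * (a / a' * (-(a / (D + 1) * δ ^ 2) + e * δ) +
      L / 2 * ((a / a') ^ 2 * δ ^ 2)) = -(a / (D + 1) * δ) ^ 2 + e * (a / (D + 1) * δ) +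
      L / 2 * (D + 1) * ((a / (D + 1) * δ) ^ 2 / a') := by
    field_simp
  rw [e1] at h2
  have h3 := sq_nonneg (e - (a / (D + 1) * δ) / 2)
  nlinarith

/-- The potential inequality: the total squared length of the scaled steps is controlled by the
total squared error of the gradient estimates. -/
lemma stepSum_le (h : p.Admissible G L R D σ) (hd : 0 < d) (hD : 0 < D) (hx₁ : x₁ ∈ p.K)
    (hlam : ∀ t, ∀ x ∈ p.K, ∀ y ∈ p.K, 1 / (D + 1) ≤ lam t x y ∧ lam t x y ≤ 1) {T : ℕ}
    {c : ℝ} (hc : 0 < c) (hbet : bet m (T + 1) ≤ c) (z : ℕ × Fin m → Ξ × E d) :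
    stepSum p m ν lam x₁ D T z ≤ 1 / 2 + 4 * R ^ 2 * c + 4 * L ^ 2 * (D + 1) ^ 2 +
      2 * ∑ n ∈ Finset.range T, gradErr p m ν lam x₁ n z ^ 2 := by
  have hL := h.L_nonneg hd
  have hval : ∀ n, 0 ≤ p.l (xs p m ν lam x₁ n z) + p.r (xs p m ν lam x₁ n z) ∧
      p.l (xs p m ν lam x₁ n z) + p.r (xs p m ν lam x₁ n z) ≤ R := fun n =>
    h.value_mem _ (xs_mem h hd hx₁ n z)
  -- the smoothness error telescopes through the square root of the total squared step
  have hsqrt : ∀ n, stepSq p m ν lam x₁ D n z / al p m ν lam x₁ (n + 1) z ≤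
      2 * (Real.sqrt (1 + stepSum p m ν lam x₁ D (n + 1) z) -
        Real.sqrt (1 + stepSum p m ν lam x₁ D n z)) := fun n => by
    have h0 := stepSum_nonneg (p := p) (ν := ν) (lam := lam) (x₁ := x₁) (D := D) n z
    have h1 := stepSq_nonneg (p := p) (ν := ν) (lam := lam) (x₁ := x₁) (D := D) n z
    have h2 := stepSum_succ (p := p) (ν := ν) (lam := lam) (x₁ := x₁) (D := D) n z
    have h3 := one_add_stepSum_le_al_sq (ν := ν) h hd hD hx₁ hlam (n + 1) z
    have h4 := one_le_bet m (n + 2)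
    have hal : 0 < al p m ν lam x₁ (n + 1) z := al_pos _ _
    set A := stepSum p m ν lam x₁ D n z
    set A' := stepSum p m ν lam x₁ D (n + 1) z
    set a := stepSq p m ν lam x₁ D n z
    have hA' : 0 < 1 + A' := by linarith
    have hs : 0 < Real.sqrt (1 + A') := Real.sqrt_pos.2 hA'
    have hs0 := Real.sqrt_nonneg (1 + A)
    have h5 : Real.sqrt (1 + A') ≤ al p m ν lam x₁ (n + 1) z := by
      refine Real.sqrt_le_iff.2 ⟨hal.le, le_trans ?_ h3⟩
      exact le_mul_of_one_le_left hA'.le h4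
    have h6 : Real.sqrt (1 + A) ≤ Real.sqrt (1 + A') := Real.sqrt_le_sqrt (by linarith)
    have h7 : a / al p m ν lam x₁ (n + 1) z ≤ a / Real.sqrt (1 + A') := by gcongr
    refine h7.trans ?_
    rw [div_le_iff₀ hs]
    have e1 := Real.sq_sqrt hA'.le
    have e2 := Real.sq_sqrt (by linarith : 0 ≤ 1 + A)
    nlinarith
  -- Abel summation: the gap `R - f` is nonnegative and its coefficient `η_t` is nondecreasing
  have hsum : ∀ T, 3 / 4 * stepSum p m ν lam x₁ D T z ≤
      al p m ν lam x₁ T z / (D + 1) *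
        (R - (p.l (xs p m ν lam x₁ T z) + p.r (xs p m ν lam x₁ T z))) +
      ∑ n ∈ Finset.range T, gradErr p m ν lam x₁ n z ^ 2 +
      L * (D + 1) * (Real.sqrt (1 + stepSum p m ν lam x₁ D T z) - 1) := by
    intro T
    induction T with
    | zero =>
      have h1 : 0 < al p m ν lam x₁ 0 z := al_pos _ _
      have h2 : 0 ≤ al p m ν lam x₁ 0 z / (D + 1) *
        (R - (p.l (xs p m ν lam x₁ 0 z) + p.r (xs p m ν lam x₁ 0 z))) :=
        mul_nonneg (by positivity) (by linarith [(hval 0).2])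
      simpa [stepSum] using h2
    | succ T ih =>
      have h1 := descent_step (m := m) (ν := ν) (lam := lam) h hd hD hx₁ T z
      have h2 := mul_le_mul_of_nonneg_left (hsqrt T) (by positivity : 0 ≤ L / 2 * (D + 1))
      have h3 : al p m ν lam x₁ T z / (D + 1) ≤ al p m ν lam x₁ (T + 1) z / (D + 1) := by
        have : al p m ν lam x₁ T z ≤ al p m ν lam x₁ (T + 1) z := al_le_succ _ _
        gcongr
      have h4 := mul_le_mul_of_nonneg_right h3 (by linarith [(hval T).2] :
        0 ≤ R - (p.l (xs p m ν lam x₁ T z) + p.r (xs p m ν lam x₁ T z)))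
      rw [Finset.sum_range_succ]
      have h5 := stepSum_succ (p := p) (ν := ν) (lam := lam) (x₁ := x₁) (D := D) T z
      nlinarith
  have hA := stepSum_nonneg (p := p) (ν := ν) (lam := lam) (x₁ := x₁) (D := D) T z
  have hfin := hsum T
  have halT : (al p m ν lam x₁ T z / (D + 1)) ^ 2 ≤
      c * (1 + stepSum p m ν lam x₁ D T z) := by
    have h1 := (stepSum_le_Ss_le (ν := ν) h hd hD hx₁ hlam T z).2
    have h2 := Ss_nonneg (p := p) (ν := ν) (lam := lam) (x₁ := x₁) T z
    rw [div_pow, div_le_iff₀ (by positivity), al, alph_sq h2]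
    calc bet m (T + 1) * (1 + Ss p m ν lam x₁ T z)
        ≤ c * ((D + 1) ^ 2 + (D + 1) ^ 2 * stepSum p m ν lam x₁ D T z) := by
          gcongr
          nlinarith
      _ = _ := by ring
  set A := stepSum p m ν lam x₁ D T z
  set W := ∑ n ∈ Finset.range T, gradErr p m ν lam x₁ n z ^ 2
  have hal0 : 0 < al p m ν lam x₁ T z := al_pos _ _
  set y := al p m ν lam x₁ T z / (D + 1)
  have hy0 : 0 < y := by positivity
  have h1 : y * (R - (p.l (xs p m ν lam x₁ T z) + p.r (xs p m ν lam x₁ T z))) ≤ y * R := by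
    have := (hval T).1
    gcongr
    linarith
  -- Young's inequality; two terms `A / 8` are absorbed by `3 A / 4`, which leaves `A / 2`
  have h2 : y * R ≤ (1 + A) / 8 + 2 * R ^ 2 * c := by
    have h3 : y ^ 2 / c ≤ 1 + A := by rw [div_le_iff₀ hc]; linarith
    have h4 : 0 ≤ (y - 4 * R * c) ^ 2 / (8 * c) := by positivity
    have e : (y - 4 * R * c) ^ 2 / (8 * c) = y ^ 2 / c / 8 - y * R + 2 * R ^ 2 * c := by
      field_simp; ring
    linarith
  have h3 : L * (D + 1) * Real.sqrt (1 + A) ≤ (1 + A) / 8 + 2 * L ^ 2 * (D + 1) ^ 2 := by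
    have e := Real.sq_sqrt (by linarith : 0 ≤ 1 + A)
    nlinarith [sq_nonneg (Real.sqrt (1 + A) - 4 * (L * (D + 1)))]
  have h4 : 0 ≤ L * (D + 1) := by positivity
  linarith

/-- The generalised gradient is controlled by the step and by the error of the estimate. -/
lemma stationarity_le (h : p.Admissible G L R D σ) (hd : 0 < d) (hD : 0 < D) (hx₁ : x₁ ∈ p.K)
    (n : ℕ) (z : ℕ × Fin m → Ξ × E d) :
    stationarity p D m ν lam x₁ z (n + 1) ≤
      2 * stepSq p m ν lam x₁ D n z + 2 * gradErr p m ν lam x₁ n z ^ 2 := by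
  have hx := xs_mem (ν := ν) (lam := lam) h hd hx₁ n z
  have h0 : 0 < al p m ν lam x₁ n z := al_pos _ _
  change l1Norm ((al p m ν lam x₁ n z / (D + 1)) • (xs p m ν lam x₁ n z -
    prox p.K p.r (fun y => (D + 1) * symEntropy d y) (xs p m ν lam x₁ n z)
      (gradient p.l (xs p m ν lam x₁ n z)) (al p m ν lam x₁ n z / (D + 1)))) ^ 2 ≤ _
  rw [prox_mul_symEntropy _ _ _ _ (by positivity), l1Norm_smul, abs_of_pos (by positivity)]
  have h1 := h.l1Norm_prox_sub_le hd hx (ds p m ν lam x₁ n z)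
    (gradient p.l (xs p m ν lam x₁ n z)) h0
  change al p m ν lam x₁ n z / (D + 1) * l1Norm (vs p m ν lam x₁ n z - _) ≤
    gradErr p m ν lam x₁ n z at h1
  set P := prox p.K p.r (symEntropy d) (xs p m ν lam x₁ n z)
    (gradient p.l (xs p m ν lam x₁ n z)) (al p m ν lam x₁ n z)
  have h2 : l1Norm (xs p m ν lam x₁ n z - P) ≤
      l1Norm (vs p m ν lam x₁ n z - xs p m ν lam x₁ n z) + l1Norm (vs p m ν lam x₁ n z - P) := by
    rw [l1Norm_sub_comm (vs p m ν lam x₁ n z) (xs p m ν lam x₁ n z)]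
    have := l1Norm_add_le (xs p m ν lam x₁ n z - vs p m ν lam x₁ n z) (vs p m ν lam x₁ n z - P)
    rwa [sub_add_sub_cancel] at this
  have h3 := mul_le_mul_of_nonneg_left h2 (by positivity : 0 ≤ al p m ν lam x₁ n z / (D + 1))
  have h4 : 0 ≤ al p m ν lam x₁ n z / (D + 1) * l1Norm (xs p m ν lam x₁ n z - P) :=
    mul_nonneg (by positivity) (l1Norm_nonneg _)
  rw [stepSq]
  set s := al p m ν lam x₁ n z / (D + 1) * l1Norm (vs p m ν lam x₁ n z - xs p m ν lam x₁ n z)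
  set e := gradErr p m ν lam x₁ n z
  have h5 : al p m ν lam x₁ n z / (D + 1) * l1Norm (xs p m ν lam x₁ n z - P) ≤ s + e := by
    linarith
  calc _ ≤ (s + e) ^ 2 := by gcongr
    _ ≤ _ := by nlinarith [sq_nonneg (s - e)]

end Pathwise


/-! ### Conditioning on the past -/

section Conditioning

/-- Fubini for a function of two independent variables: a bound on the conditional expectation
given the first variable may be integrated. -/
lemma integral_le_of_indepFun {Ω β γ : Type*} [MeasurableSpace Ω] [MeasurableSpace β]
    [MeasurableSpace γ] {μ : Measure Ω} [IsProbabilityMeasure μ] {f : Ω → β} {g : Ω → γ}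
    (hf : Measurable f) (hg : Measurable g) (hfg : IndepFun f g μ) {π : Measure γ}
    (hπ : μ.map g = π) {Ψ : β × γ → ℝ} (hΨ : Measurable Ψ)
    (hint : Integrable (fun ω => Ψ (f ω, g ω)) μ) {Φ : β → ℝ} (hΦ : Measurable Φ)
    (hΦint : Integrable (fun ω => Φ (f ω)) μ) (hle : ∀ s, ∫ y, Ψ (s, y) ∂π ≤ Φ s) :
    ∫ ω, Ψ (f ω, g ω) ∂μ ≤ ∫ ω, Φ (f ω) ∂μ := by
  have h1 := (indepFun_iff_map_prod_eq_prod_map_map hf.aemeasurable hg.aemeasurable).1 hfg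
  rw [hπ] at h1
  have : IsProbabilityMeasure (μ.map f) := Measure.isProbabilityMeasure_map hf.aemeasurable
  have : IsProbabilityMeasure π := hπ ▸ Measure.isProbabilityMeasure_map hg.aemeasurable
  have hfg' : Measurable fun ω => (f ω, g ω) := hf.prodMk hg
  have hi : Integrable Ψ ((μ.map f).prod π) := by
    rw [← h1, integrable_map_measure hΨ.aestronglyMeasurable hfg'.aemeasurable]
    exact hint
  have e1 : ∫ ω, Ψ (f ω, g ω) ∂μ = ∫ q, Ψ q ∂(μ.map f).prod π := by
    rw [← h1, integral_map hfg'.aemeasurable hΨ.aestronglyMeasurable]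
  have e2 : ∫ ω, Φ (f ω) ∂μ = ∫ s, Φ s ∂μ.map f := by
    rw [integral_map hf.aemeasurable hΦ.aestronglyMeasurable]
  have hi2 : Integrable Φ (μ.map f) := by
    rw [integrable_map_measure hΦ.aestronglyMeasurable hf.aemeasurable]
    exact hΦint
  rw [e1, e2, integral_prod _ hi]
  exact integral_mono hi.integral_prod_left hi2 hle

variable {d : ℕ} {Ξ : Type u} [MeasurableSpace Ξ] {p : Problem d Ξ} {m T : ℕ}
  {G L R D σ : ℝ} {Ω : Type v} [MeasurableSpace Ω] {μ : Measure Ω}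
  {Z : ℕ × Fin m → Ω → Ξ × E d} {θ : Ω → ℕ}

lemma IsSampling.ae_sample (hS : IsSampling p m T μ Z θ) (h : p.Admissible G L R D σ) :
    ∀ᵐ ω ∂μ, ∀ k i, |(Z k ω).2 i| = 1 := by
  rw [ae_all_iff]
  intro k
  have h1 := h.ae_sample
  rw [sampleLaw, ← hS.law_Z k] at h1
  exact ae_of_ae_map (hS.measurable_Z k).aemeasurable h1

lemma IsSampling.measurable_all (hS : IsSampling p m T μ Z θ) :
    Measurable fun ω i => Z i ω := measurable_pi_lambda _ hS.measurable_Z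

lemma IsSampling.map_batch (hS : IsSampling p m T μ Z θ) (n : ℕ) :
    μ.map (fun ω (j : Fin m) => Z (n, j) ω) = Measure.pi fun _ => sampleLaw p := by
  have := hS.prob
  have hinj : Function.Injective fun j : Fin m => (n, j) := fun i j hij => by simpa using hij
  have h1 := hS.indep_Z.precomp hinj
  rw [iIndepFun_iff_map_fun_eq_pi_map fun j => (hS.measurable_Z _).aemeasurable] at h1
  simp only [hS.law_Z] at h1
  exact h1

/-- A function of the first `n` mini-batches is independent of the next one. -/
lemma IsSampling.indepFun_batch (hS : IsSampling p m T μ Z θ) (h : p.Admissible G L R D σ)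
    {β : Type*} [MeasurableSpace β] {f : (ℕ × Fin m → Ξ × E d) → β} (hf : Measurable f) (n : ℕ)
    (hloc : ∀ z z' : ℕ × Fin m → Ξ × E d,
      (∀ k ∈ Finset.Icc 1 n, ∀ j, z (k, j) = z' (k, j)) → f z = f z') :
    IndepFun (fun ω => f fun i => Z i ω) (fun ω (j : Fin m) => Z (n + 1, j) ω) μ := by
  classical
  obtain ⟨ξ⟩ := h.nonempty_sample
  set A : Finset (ℕ × Fin m) := Finset.Icc 1 n ×ˢ Finset.univ with hA
  set B : Finset (ℕ × Fin m) := {n + 1} ×ˢ Finset.univ with hB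
  have hAB : Disjoint A B := by
    rw [Finset.disjoint_left]
    rintro ⟨k, j⟩ h1 h2
    simp only [hA, hB, Finset.mem_product, Finset.mem_Icc, Finset.mem_singleton] at h1 h2
    omega
  have h1 := hS.indep_Z.indepFun_finset A B hAB hS.measurable_Z
  -- the samples outside the first `n` mini-batches are replaced by a fixed value
  set ext : (A → Ξ × E d) → (ℕ × Fin m → Ξ × E d) := fun y i =>
    if hi : i ∈ A then y ⟨i, hi⟩ else (ξ, 0) with hext
  have hextm : Measurable ext := measurable_pi_lambda _ fun i => by
    by_cases hi : i ∈ A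
    · simp only [hext, hi, dif_pos]; exact measurable_pi_apply _
    · simp only [hext, hi, dif_neg, not_false_eq_true]; exact measurable_const
  have hmem : ∀ j : Fin m, (n + 1, j) ∈ B := fun j => by simp [hB]
  have h2 := h1.comp (φ := fun y => f (ext y)) (ψ := fun y (j : Fin m) => y ⟨(n + 1, j), hmem j⟩)
    (hf.comp hextm) (measurable_pi_lambda _ fun j => measurable_pi_apply _)
  have e1 : (fun ω => f fun i => Z i ω) =
      (fun y => f (ext y)) ∘ fun ω (i : A) => Z i ω := by
    ext1 ω
    refine hloc _ _ fun k hk j => ?_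
    have : (k, j) ∈ A := by simp only [hA, Finset.mem_product, Finset.mem_univ, and_true]; exact hk
    simp [hext, this]
  rw [e1]
  exact h2

end Conditioning

/-! ### The error of the variance-reduced gradient estimate -/

section ErrorRecursion

variable {d : ℕ} {Ξ : Type u} [MeasurableSpace Ξ] {p : Problem d Ξ} {m T : ℕ} {ν : ℝ}
  {lam : ℕ → E d → E d → ℝ} {x₁ : E d}
  {G L R D σ : ℝ} {Ω : Type v} [MeasurableSpace Ω] {μ : Measure Ω}
  {Z : ℕ × Fin m → Ω → Ξ × E d} {θ : Ω → ℕ}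

lemma measurable_meanEst (h : p.Admissible G L R D σ) (ν : ℝ) : Measurable (meanEst p ν) := by
  have := h.isProbabilityMeasure_sampleLaw
  have hm : Measurable (WithLp.toLp 2 : (Fin d → ℝ) → E d) := by fun_prop
  refine hm.comp (measurable_pi_lambda _ fun i => ?_)
  have h1 := h.measurable_uncurry_diffQuot ν
  have h2 : Measurable fun q : E d × (Ξ × E d) => diffQuot p ν q.1 q.2 * q.2.2 i :=
    h1.mul (by fun_prop)
  exact (h2.stronglyMeasurable.integral_prod_right (ν := sampleLaw p)).measurable

lemma lInf_meanEst_le (h : p.Admissible G L R D σ) (hd : 0 < d) (hν : 0 < ν) (x : E d) :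
    lInf (meanEst p ν x) ≤ G * d := by
  have := h.isProbabilityMeasure_sampleLaw
  have hG := h.G_nonneg hd
  refine lInf_le (by positivity) fun i => ?_
  change |∫ z, diffQuot p ν x z * z.2 i ∂sampleLaw p| ≤ _
  rw [← Real.norm_eq_abs]
  refine (norm_integral_le_of_norm_le_const (C := G * d) ?_).trans (by simp)
  filter_upwards [h.ae_sample] with z hz
  rw [Real.norm_eq_abs, abs_mul, hz i, mul_one]
  exact h.abs_diffQuot_le hd hν x hz

lemma norm_le_mul_lInf (x : E d) : ‖x‖ ≤ d * lInf x := by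
  refine (norm_le_l1Norm x).trans ?_
  calc l1Norm x ≤ ∑ _i : Fin d, lInf x := Finset.sum_le_sum fun i _ => abs_le_lInf x i
    _ = _ := by simp

variable (p m ν lam x₁) in
/-- The deviation of the gradient estimate `d_{n+1}` from the mean of the two-point estimate. -/
noncomputable def dev (n : ℕ) (z : ℕ × Fin m → Ξ × E d) : E d :=
  ds p m ν lam x₁ n z - meanEst p ν (xs p m ν lam x₁ n z)

lemma measurable_dev (h : p.Admissible G L R D σ) (hd : 0 < d) (hx₁ : x₁ ∈ p.K)
    (hlam : ∀ t, Measurable fun q : E d × E d => lam t q.1 q.2) (n : ℕ) :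
    Measurable (dev p m ν lam x₁ n) := by
  obtain ⟨hx, hS, hds⟩ := measurable_trajectory (m := m) (ν := ν) h hd hx₁ hlam n
  exact hds.sub ((measurable_meanEst h ν).comp hx)

lemma exists_norm_dev_le (hS : IsSampling p m T μ Z θ) (h : p.Admissible G L R D σ) (hd : 0 < d)
    (hν : 0 < ν) (hm : 0 < m) (n : ℕ) :
    ∃ B, ∀ᵐ ω ∂μ, ‖dev p m ν lam x₁ n (fun i => Z i ω)‖ ≤ B := by
  obtain ⟨B, hB⟩ := exists_lInf_ds_le (lam := lam) (x₁ := x₁) h hd hν hm n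
  refine ⟨d * (B + G * d), ?_⟩
  filter_upwards [hS.ae_sample h] with ω hω
  refine (norm_le_mul_lInf _).trans ?_
  have h1 := lInf_add_le (ds p m ν lam x₁ n (fun i => Z i ω))
    (-meanEst p ν (xs p m ν lam x₁ n (fun i => Z i ω)))
  rw [lInf_neg, ← sub_eq_add_neg] at h1
  have h2 := hB _ hω
  have h3 := lInf_meanEst_le h hd hν (xs p m ν lam x₁ n (fun i => Z i ω))
  have h4 : lInf (dev p m ν lam x₁ n (fun i => Z i ω)) ≤ B + G * d := by
    rw [dev]; linarith
  gcongr

lemma integrable_lpSq_dev (hS : IsSampling p m T μ Z θ) (h : p.Admissible G L R D σ) (hd : 0 < d)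
    (hν : 0 < ν) (hm : 0 < m) (hx₁ : x₁ ∈ p.K)
    (hlam : ∀ t, Measurable fun q : E d × E d => lam t q.1 q.2) {q : ℝ} (hq : 0 < q) (n : ℕ) :
    Integrable (fun ω => lpSq q 0 (dev p m ν lam x₁ n fun i => Z i ω)) μ := by
  have := hS.prob
  obtain ⟨B, hB⟩ := exists_norm_dev_le (lam := lam) (x₁ := x₁) hS h hd hν hm n
  exact integrable_comp_of_bounded ((measurable_dev h hd hx₁ hlam n).comp hS.measurable_all) hB
    (continuous_lpSq hq 0)

lemma norm_xs_sub_sq_le (h : p.Admissible G L R D σ) (hd : 0 < d) (hx₁ : x₁ ∈ p.K)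
    (n n' : ℕ) (z : ℕ × Fin m → Ξ × E d) :
    ‖xs p m ν lam x₁ n z - xs p m ν lam x₁ n' z‖ ^ 2 ≤ (2 * D) ^ 2 := by
  have h1 := h.l1Norm_le hd (xs_mem (ν := ν) (lam := lam) h hd hx₁ n z)
  have h2 := h.l1Norm_le hd (xs_mem (ν := ν) (lam := lam) h hd hx₁ n' z)
  have h3 := norm_sub_le (xs p m ν lam x₁ n z) (xs p m ν lam x₁ n' z)
  have h4 := norm_le_l1Norm (xs p m ν lam x₁ n z)
  have h5 := norm_le_l1Norm (xs p m ν lam x₁ n' z)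
  have : ‖xs p m ν lam x₁ n z - xs p m ν lam x₁ n' z‖ ≤ 2 * D := by linarith
  gcongr

lemma integrable_norm_xs_sub_sq (hS : IsSampling p m T μ Z θ) (h : p.Admissible G L R D σ)
    (hd : 0 < d) (hx₁ : x₁ ∈ p.K)
    (hlam : ∀ t, Measurable fun q : E d × E d => lam t q.1 q.2) (n n' : ℕ) :
    Integrable (fun ω => ‖xs p m ν lam x₁ n (fun i => Z i ω) -
      xs p m ν lam x₁ n' (fun i => Z i ω)‖ ^ 2) μ := by
  have := hS.prob
  have hx := (measurable_trajectory (m := m) (ν := ν) h hd hx₁ hlam n).1.comp hS.measurable_all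
  have hx' := (measurable_trajectory (m := m) (ν := ν) h hd hx₁ hlam n').1.comp hS.measurable_all
  refine Integrable.of_bound ((hx.sub hx').norm.pow_const 2).aestronglyMeasurable ((2 * D) ^ 2)
    (Filter.Eventually.of_forall fun ω => ?_)
  rw [Real.norm_eq_abs, abs_of_nonneg (sq_nonneg _)]
  exact norm_xs_sub_sq_le h hd hx₁ n n' _

lemma integral_lpSq_dev_zero_le (hS : IsSampling p m T μ Z θ) (h : p.Admissible G L R D σ)
    (hd : 0 < d) {b : ℝ} (hν : 0 < ν) (hb : ν * d ≤ b) (hm : 0 < m) {q : ℝ} (hq : 1 < q) :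
    ∫ ω, lpSq q 0 (dev p m ν lam x₁ 0 fun i => Z i ω) ∂μ ≤
      (d : ℝ) ^ (1 / q) * (2 * q - 1) / m * (16 * G ^ 2 + 4 * L ^ 2 * b ^ 2) := by
  have h1 := h.integral_lpSq_recursion_le hd hq hm hν hb x₁ x₁ 0 0
  have hbm : Measurable fun ω (j : Fin m) => Z (1, j) ω :=
    measurable_pi_lambda _ fun j => hS.measurable_Z _
  have hm2 : Measurable fun z : Fin m → Ξ × E d =>
      lpSq q 0 (estimate p ν z x₁ - meanEst p ν x₁) :=
    (continuous_lpSq (by linarith) 0).measurable.comp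
      ((measurable_estimate_comp h ν measurable_id measurable_const).sub measurable_const)
  have e : ∫ ω, lpSq q 0 (dev p m ν lam x₁ 0 fun i => Z i ω) ∂μ =
      ∫ z, lpSq q 0 (estimate p ν z x₁ - meanEst p ν x₁)
        ∂Measure.pi (fun _ : Fin m => sampleLaw p) := by
    rw [← hS.map_batch 1, integral_map hbm.aemeasurable hm2.aestronglyMeasurable]
    rfl
  rw [e]
  have h0 : lpSq q 0 (0 : E d) = 0 := by
    have := lpSq_smul (by linarith : 0 < q) 0 (0 : E d)
    simpa using this
  simp only [zero_smul, zero_add, sub_zero, h0] at h1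
  linarith

lemma dev_succ (n : ℕ) (z : ℕ × Fin m → Ξ × E d) :
    dev p m ν lam x₁ (n + 1) z = (1 - gam m (n + 2)) •
        (ds p m ν lam x₁ n z - meanEst p ν (xs p m ν lam x₁ n z)) +
      (estimate p ν (fun j => z (n + 2, j)) (xs p m ν lam x₁ (n + 1) z) -
        meanEst p ν (xs p m ν lam x₁ (n + 1) z)) -
      (1 - gam m (n + 2)) • (estimate p ν (fun j => z (n + 2, j)) (xs p m ν lam x₁ n z) -
        meanEst p ν (xs p m ν lam x₁ n z)) := by
  rw [dev, ds_succ]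
  simp only [smul_sub]
  abel

/-- The error recursion in expectation. -/
lemma integral_lpSq_dev_succ_le (hS : IsSampling p m T μ Z θ) (h : p.Admissible G L R D σ)
    (hd : 0 < d) {b : ℝ} (hν : 0 < ν) (hb : ν * d ≤ b) (hm : 0 < m) (hx₁ : x₁ ∈ p.K)
    (hlam : ∀ t, Measurable fun q : E d × E d => lam t q.1 q.2) {q : ℝ} (hq : 1 < q) (n : ℕ) :
    ∫ ω, lpSq q 0 (dev p m ν lam x₁ (n + 1) fun i => Z i ω) ∂μ ≤
      (1 - gam m (n + 2)) ^ 2 * ∫ ω, lpSq q 0 (dev p m ν lam x₁ n fun i => Z i ω) ∂μ +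
      (d : ℝ) ^ (1 / q) * (2 * q - 1) / m *
        (gam m (n + 2) ^ 2 * (16 * G ^ 2 + 4 * L ^ 2 * b ^ 2) +
          (1 - gam m (n + 2)) ^ 2 * (16 * L ^ 2 *
            (∫ ω, ‖xs p m ν lam x₁ (n + 1) (fun i => Z i ω) -
              xs p m ν lam x₁ n (fun i => Z i ω)‖ ^ 2 ∂μ + b ^ 2))) := by
  have := hS.prob
  have hq0 : 0 < q := by linarith
  obtain ⟨hx, _, hds⟩ := measurable_trajectory (m := m) (ν := ν) h hd hx₁ hlam n
  obtain ⟨hx', _, _⟩ := measurable_trajectory (m := m) (ν := ν) h hd hx₁ hlam (n + 1)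
  have hmean := measurable_meanEst h ν
  set ϑ := 1 - gam m (n + 2) with hϑ
  -- `f` collects what the recursion uses of the past, `Ψ` is the new error as a function of the
  -- past and of the new mini-batch, and `Φ` bounds its conditional expectation
  set f : (ℕ × Fin m → Ξ × E d) → E d × E d × E d := fun z =>
    (xs p m ν lam x₁ (n + 1) z, xs p m ν lam x₁ n z, ds p m ν lam x₁ n z) with hf
  have hfm : Measurable f := hx'.prodMk (hx.prodMk hds)
  have hloc : ∀ z z' : ℕ × Fin m → Ξ × E d,
      (∀ k ∈ Finset.Icc 1 (n + 1), ∀ j, z (k, j) = z' (k, j)) → f z = f z' := by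
    intro z z' hz
    have h1 := run_congr (p := p) (ν := ν) (lam := lam) (x₁ := x₁) hz
    change ((run p m ν lam x₁ z (n + 1)).x, (run p m ν lam x₁ z (n + 1)).xPrev,
      (run p m ν lam x₁ z (n + 1)).dPrev) = ((run p m ν lam x₁ z' (n + 1)).x,
      (run p m ν lam x₁ z' (n + 1)).xPrev, (run p m ν lam x₁ z' (n + 1)).dPrev)
    rw [h1]
  have hind := hS.indepFun_batch h hfm (n + 1) hloc
  have hbm : Measurable fun ω (j : Fin m) => Z (n + 1 + 1, j) ω :=
    measurable_pi_lambda _ fun j => hS.measurable_Z _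
  set Ψ : (E d × E d × E d) × (Fin m → Ξ × E d) → ℝ := fun s =>
    lpSq q 0 (ϑ • (s.1.2.2 - meanEst p ν s.1.2.1) +
      (estimate p ν s.2 s.1.1 - meanEst p ν s.1.1) -
      ϑ • (estimate p ν s.2 s.1.2.1 - meanEst p ν s.1.2.1)) with hΨ
  have m1 : Measurable fun s : (E d × E d × E d) × (Fin m → Ξ × E d) => s.1.1 := by fun_prop
  have m2 : Measurable fun s : (E d × E d × E d) × (Fin m → Ξ × E d) => s.1.2.1 := by fun_prop
  have m3 : Measurable fun s : (E d × E d × E d) × (Fin m → Ξ × E d) => s.1.2.2 := by fun_prop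
  have hΨm : Measurable Ψ :=
    (continuous_lpSq hq0 0).measurable.comp ((((m3.sub (hmean.comp m2)).const_smul ϑ).add
      ((measurable_estimate_comp h ν measurable_snd m1).sub (hmean.comp m1))).sub
      (((measurable_estimate_comp h ν measurable_snd m2).sub (hmean.comp m2)).const_smul ϑ))
  have hΨeq : ∀ ω, Ψ (f (fun i => Z i ω), fun j => Z (n + 1 + 1, j) ω) =
      lpSq q 0 (dev p m ν lam x₁ (n + 1) fun i => Z i ω) := fun ω => by
    rw [dev_succ]
  set Φ : E d × E d × E d → ℝ := fun s => ϑ ^ 2 * lpSq q 0 (s.2.2 - meanEst p ν s.2.1) +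
    (d : ℝ) ^ (1 / q) * (2 * q - 1) / m *
        ((1 - ϑ) ^ 2 * (16 * G ^ 2 + 4 * L ^ 2 * b ^ 2) +
          ϑ ^ 2 * (16 * L ^ 2 * (‖s.1 - s.2.1‖ ^ 2 + b ^ 2))) with hΦ
  have hΦm : Measurable Φ := by
    have h1 : Measurable fun s : E d × E d × E d => lpSq q 0 (s.2.2 - meanEst p ν s.2.1) :=
      (continuous_lpSq hq0 0).measurable.comp
        ((by fun_prop : Measurable fun s : E d × E d × E d => s.2.2).sub
          (hmean.comp (by fun_prop : Measurable fun s : E d × E d × E d => s.2.1)))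
    fun_prop
  have i1 := integrable_lpSq_dev (ν := ν) hS h hd hν hm hx₁ hlam hq0 n
  have i2 := integrable_norm_xs_sub_sq (ν := ν) hS h hd hx₁ hlam (n + 1) n
  have i2b : Integrable (fun ω => ‖xs p m ν lam x₁ (n + 1) (fun i => Z i ω) -
      xs p m ν lam x₁ n (fun i => Z i ω)‖ ^ 2 + b ^ 2) μ := i2.add (integrable_const _)
  have i2' : Integrable (fun ω => (d : ℝ) ^ (1 / q) * (2 * q - 1) / m *
        ((1 - ϑ) ^ 2 * (16 * G ^ 2 + 4 * L ^ 2 * b ^ 2) +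
          ϑ ^ 2 * (16 * L ^ 2 * (‖xs p m ν lam x₁ (n + 1) (fun i => Z i ω) -
              xs p m ν lam x₁ n (fun i => Z i ω)‖ ^ 2 + b ^ 2)))) μ :=
    ((integrable_const _).add ((i2b.const_mul _).const_mul _)).const_mul _
  have hΦint : Integrable (fun ω => Φ (f fun i => Z i ω)) μ := (i1.const_mul _).add i2'
  have hmain := integral_le_of_indepFun (hfm.comp hS.measurable_all) hbm hind
    (hS.map_batch (n + 1 + 1)) hΨm
    (by
      simp only [Function.comp_apply, hΨeq]
      exact integrable_lpSq_dev (ν := ν) hS h hd hν hm hx₁ hlam hq0 (n + 1))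
    hΦm hΦint
    (fun s => h.integral_lpSq_recursion_le hd hq hm hν hb s.1 s.2.1
      (s.2.2 - meanEst p ν s.2.1) ϑ)
  simp only [Function.comp_apply, hΨeq] at hmain
  refine hmain.trans (le_of_eq ?_)
  have e : ∫ ω, Φ (f fun i => Z i ω) ∂μ =
      ϑ ^ 2 * ∫ ω, lpSq q 0 (dev p m ν lam x₁ n fun i => Z i ω) ∂μ +
      ∫ ω, (d : ℝ) ^ (1 / q) * (2 * q - 1) / m *
        ((1 - ϑ) ^ 2 * (16 * G ^ 2 + 4 * L ^ 2 * b ^ 2) +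
          ϑ ^ 2 * (16 * L ^ 2 * (‖xs p m ν lam x₁ (n + 1) (fun i => Z i ω) -
              xs p m ν lam x₁ n (fun i => Z i ω)‖ ^ 2 + b ^ 2))) ∂μ := by
    rw [← integral_const_mul, ← integral_add (i1.const_mul _) i2']
    rfl
  rw [e, integral_const_mul, integral_add (integrable_const _)
    ((i2b.const_mul _).const_mul _), integral_const_mul,
    integral_const_mul, integral_const_mul, integral_add i2 (integrable_const _)]
  simp only [integral_const, probReal_univ, one_smul]
  have e2 : 1 - ϑ = gam m (n + 2) := by rw [hϑ]; ring
  rw [e2]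

/-- Summation of a recursion `e_{n+1} ≤ (1 - γ)² e_n + c (γ² Q + (1 - γ)² δ_n)` with the weights
`errWeight`. -/
lemma sum_recursion_le {m : ℕ} (hm : 1 ≤ m) {e δ : ℕ → ℝ} {c Q : ℝ} (hc : 0 ≤ c) (hQ : 0 ≤ Q)
    (he : ∀ n, 0 ≤ e n) (hδ : ∀ n, 0 ≤ δ n) (h0 : e 0 ≤ c * Q)
    (hsucc : ∀ n, e (n + 1) ≤ (1 - gam m (n + 2)) ^ 2 * e n +
      c * (gam m (n + 2) ^ 2 * Q + (1 - gam m (n + 2)) ^ 2 * δ n)) (N : ℕ) :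
    3 * ∑ n ∈ Finset.range (N + 1), e n ≤
      c * (Q * (9 / 2 + 4 * ∑ n ∈ Finset.range (N + 1), 1 / tau m (n + 1)) +
        ∑ n ∈ Finset.range N, bet m (n + 2) ^ 2 * δ n) := by
  have key : 3 * ∑ n ∈ Finset.range N, e n + errWeight m (N + 1) * e N ≤
      c * (Q * (9 / 2 + 4 * ∑ n ∈ Finset.range (N + 1), 1 / tau m (n + 1)) +
        ∑ n ∈ Finset.range N, bet m (n + 2) ^ 2 * δ n) := by
    induction N with
    | zero =>
      have h1 := errWeight_one_le hm
      have h2 := one_le_tau m 1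
      have h3 : 0 ≤ 1 / tau m 1 := by positivity
      have h4 : errWeight m 1 * e 0 ≤ 9 / 2 * (c * Q) :=
        mul_le_mul h1 h0 (he 0) (by norm_num)
      have h5 : 0 ≤ c * Q * (1 / tau m 1) := by positivity
      simp only [Finset.range_zero, Finset.sum_empty, mul_zero, zero_add, Finset.range_one,
        Finset.sum_singleton, add_zero]
      linarith
    | succ N ih =>
      have h1 := mul_le_mul_of_nonneg_left (hsucc N) (errWeight_nonneg m (N + 2))
      have h2 := mul_le_mul_of_nonneg_right (three_add_errWeight_le hm (N + 1)) (he N)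
      have h3 := mul_le_mul_of_nonneg_right (errWeight_mul_one_sub_gam_sq_le m (N + 2))
        (mul_nonneg hc (hδ N))
      have h4 := errWeight_mul_gam_sq m (N + 2)
      have e1 : errWeight m (N + 2) * ((1 - gam m (N + 2)) ^ 2 * e N +
          c * (gam m (N + 2) ^ 2 * Q + (1 - gam m (N + 2)) ^ 2 * δ N)) =
          errWeight m (N + 2) * (1 - gam m (N + 2)) ^ 2 * e N +
          c * Q * (errWeight m (N + 2) * gam m (N + 2) ^ 2) +
          errWeight m (N + 2) * (1 - gam m (N + 2)) ^ 2 * (c * δ N) := by ring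
      rw [e1, h4] at h1
      have e2 : c * Q * (4 / tau m (N + 2)) = c * (Q * (4 * (1 / tau m (N + 2)))) := by ring
      rw [e2] at h1
      rw [Finset.sum_range_succ e, Finset.sum_range_succ _ (N + 1),
        Finset.sum_range_succ (fun n => bet m (n + 2) ^ 2 * δ n)]
      change _ + errWeight m (N + 2) * _ ≤ c * (Q * (9 / 2 + 4 * (_ + 1 / tau m (N + 2))) + _)
      change 3 * _ + errWeight m (N + 1) * _ ≤ _ at ih
      change (3 + errWeight m (N + 2) * (1 - gam m (N + 2)) ^ 2) * e N ≤ errWeight m (N + 1) * e N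
        at h2
      linarith
  rw [Finset.sum_range_succ]
  have := mul_le_mul_of_nonneg_right (three_le_errWeight m (N + 1)) (he N)
  linarith

end ErrorRecursion


/-! ### The bound in expectation -/

section Expectation

variable {d : ℕ} {Ξ : Type u} [MeasurableSpace Ξ] {p : Problem d Ξ} {m T : ℕ} {ν : ℝ}
  {lam : ℕ → E d → E d → ℝ} {x₁ : E d} {G L R D σ : ℝ} {Ω : Type v} [MeasurableSpace Ω]
  {μ : Measure Ω} {Z : ℕ × Fin m → Ω → Ξ × E d} {θ : Ω → ℕ}

lemma measurable_stepSq (h : p.Admissible G L R D σ) (hd : 0 < d) (hx₁ : x₁ ∈ p.K)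
    (hlam : ∀ t, Measurable fun q : E d × E d => lam t q.1 q.2) (n : ℕ) :
    Measurable (stepSq p m ν lam x₁ D n) := by
  have hx := (measurable_trajectory (m := m) (ν := ν) h hd hx₁ hlam n).1
  have hv := measurable_vs (m := m) (ν := ν) h hd hx₁ hlam n
  have ha := measurable_al (m := m) (ν := ν) h hd hx₁ hlam n
  exact ((ha.div_const _).mul (continuous_l1Norm.measurable.comp (hv.sub hx))).pow_const 2

lemma integrable_stepSq (hS : IsSampling p m T μ Z θ) (h : p.Admissible G L R D σ) (hd : 0 < d)
    (hD : 0 < D) (hx₁ : x₁ ∈ p.K) (hlam : ∀ t, Measurable fun q : E d × E d => lam t q.1 q.2)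
    (hlam' : ∀ t, ∀ x ∈ p.K, ∀ y ∈ p.K, 1 / (D + 1) ≤ lam t x y ∧ lam t x y ≤ 1) (n : ℕ) :
    Integrable (fun ω => stepSq p m ν lam x₁ D n fun i => Z i ω) μ := by
  have := hS.prob
  obtain ⟨B, hB⟩ := exists_Ss_le (m := m) (ν := ν) h hd hD hx₁ hlam' n
  refine Integrable.of_bound
    ((measurable_stepSq h hd hx₁ hlam n).comp hS.measurable_all).aestronglyMeasurable
    (bet m (n + 1) * (1 + B) / (D + 1) ^ 2 * (2 * D) ^ 2) (Filter.Eventually.of_forall fun ω => ?_)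
  rw [Real.norm_eq_abs, abs_of_nonneg (stepSq_nonneg _ _), stepSq, mul_pow,
    div_pow, al, alph_sq (Ss_nonneg n _)]
  have h1 := one_le_bet m (n + 1)
  have h2 := hB fun i => Z i ω
  have h3 := Ss_nonneg (p := p) (m := m) (ν := ν) (lam := lam) (x₁ := x₁) n fun i => Z i ω
  have h4 := l1Norm_vs_sub_le (ν := ν) (lam := lam) h hd hx₁ n fun i => Z i ω
  have h5 := l1Norm_nonneg (vs p m ν lam x₁ n (fun i => Z i ω) -
    xs p m ν lam x₁ n (fun i => Z i ω))
  have h6 : 0 ≤ 1 + B := by linarith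
  gcongr

lemma integrable_stepSum (hS : IsSampling p m T μ Z θ) (h : p.Admissible G L R D σ) (hd : 0 < d)
    (hD : 0 < D) (hx₁ : x₁ ∈ p.K) (hlam : ∀ t, Measurable fun q : E d × E d => lam t q.1 q.2)
    (hlam' : ∀ t, ∀ x ∈ p.K, ∀ y ∈ p.K, 1 / (D + 1) ≤ lam t x y ∧ lam t x y ≤ 1) (n : ℕ) :
    Integrable (fun ω => stepSum p m ν lam x₁ D n fun i => Z i ω) μ :=
  integrable_finsetSum _ fun k _ => integrable_stepSq hS h hd hD hx₁ hlam hlam' k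

lemma measurable_stepSum (h : p.Admissible G L R D σ) (hd : 0 < d) (hx₁ : x₁ ∈ p.K)
    (hlam : ∀ t, Measurable fun q : E d × E d => lam t q.1 q.2) (n : ℕ) :
    Measurable (stepSum p m ν lam x₁ D n) :=
  Finset.measurable_fun_sum _ fun k _ => measurable_stepSq h hd hx₁ hlam k

lemma integrable_log_one_add_stepSum (hS : IsSampling p m T μ Z θ) (h : p.Admissible G L R D σ)
    (hd : 0 < d) (hD : 0 < D) (hx₁ : x₁ ∈ p.K)
    (hlam : ∀ t, Measurable fun q : E d × E d => lam t q.1 q.2)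
    (hlam' : ∀ t, ∀ x ∈ p.K, ∀ y ∈ p.K, 1 / (D + 1) ≤ lam t x y ∧ lam t x y ≤ 1) (n : ℕ) :
    Integrable (fun ω => Real.log (1 + stepSum p m ν lam x₁ D n fun i => Z i ω)) μ := by
  refine (integrable_stepSum (ν := ν) hS h hd hD hx₁ hlam hlam' n).mono'
    (Real.measurable_log.comp (((measurable_stepSum h hd hx₁ hlam n).comp
      hS.measurable_all).const_add 1)).aestronglyMeasurable
    (Filter.Eventually.of_forall fun ω => ?_)
  have h0 := stepSum_nonneg (p := p) (ν := ν) (lam := lam) (x₁ := x₁) (D := D) n fun i => Z i ω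
  have h1 : 0 ≤ Real.log (1 + stepSum p m ν lam x₁ D n fun i => Z i ω) :=
    Real.log_nonneg (by linarith)
  have h2 := Real.log_le_sub_one_of_pos (by linarith :
    0 < 1 + stepSum p m ν lam x₁ D n fun i => Z i ω)
  rw [Real.norm_eq_abs, abs_of_nonneg h1]
  linarith

/-- The error of the gradient estimate splits into its deviation from the conditional mean and
the bias of the two-point estimate. -/
lemma gradErr_sq_le (h : p.Admissible G L R D σ) (hd : 0 < d) {b q : ℝ} (hν : 0 < ν)
    (hb : ν * d ≤ b) (hq : 0 < q) (n : ℕ) (z : ℕ × Fin m → Ξ × E d) :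
    gradErr p m ν lam x₁ n z ^ 2 ≤
      5 / 4 * lpSq q 0 (dev p m ν lam x₁ n z) + 5 / 4 * (L ^ 2 * b ^ 2) := by
  have h1 := sq_lInf_le_lpSq hq (dev p m ν lam x₁ n z)
  have h2 := h.lInf_meanEst_sub_le hd hν hb (xs p m ν lam x₁ n z)
  have h3 := lInf_add_le (dev p m ν lam x₁ n z)
    (meanEst p ν (xs p m ν lam x₁ n z) - gradient p.l (xs p m ν lam x₁ n z))
  rw [dev, sub_add_sub_cancel] at h3
  change gradErr p m ν lam x₁ n z ≤ lInf (dev p m ν lam x₁ n z) + _ at h3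
  have h4 : 0 ≤ gradErr p m ν lam x₁ n z := lInf_nonneg _
  set x := lInf (dev p m ν lam x₁ n z)
  have h5 : gradErr p m ν lam x₁ n z ≤ x + L * b / 2 := h3.trans (by gcongr)
  calc _ ≤ (x + L * b / 2) ^ 2 := by gcongr
    _ ≤ 5 / 4 * x ^ 2 + 5 / 4 * (L ^ 2 * b ^ 2) := by nlinarith [sq_nonneg (x / 2 - L * b)]
    _ ≤ _ := by gcongr

lemma measurable_gradErr (h : p.Admissible G L R D σ) (hd : 0 < d) (hx₁ : x₁ ∈ p.K)
    (hlam : ∀ t, Measurable fun q : E d × E d => lam t q.1 q.2) (n : ℕ) :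
    Measurable (gradErr p m ν lam x₁ n) := by
  obtain ⟨hx, _, hds⟩ := measurable_trajectory (m := m) (ν := ν) h hd hx₁ hlam n
  have hc : Continuous (lInf : E d → ℝ) := continuous_norm.comp (PiLp.continuous_ofLp 2 _)
  exact hc.measurable.comp (hds.sub ((h.continuous_gradient_l hd).measurable.comp hx))

lemma integrable_gradErr_sq (hS : IsSampling p m T μ Z θ) (h : p.Admissible G L R D σ) (hd : 0 < d)
    (hν : 0 < ν) (hm : 0 < m) (hx₁ : x₁ ∈ p.K)
    (hlam : ∀ t, Measurable fun q : E d × E d => lam t q.1 q.2) (n : ℕ) :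
    Integrable (fun ω => gradErr p m ν lam x₁ n (fun i => Z i ω) ^ 2) μ := by
  have := hS.prob
  refine (((integrable_lpSq_dev (ν := ν) hS h hd hν hm hx₁ hlam one_pos n).const_mul (5 / 4)).add
    (integrable_const (5 / 4 * (L ^ 2 * (ν * d) ^ 2)))).mono'
    (((measurable_gradErr h hd hx₁ hlam n).comp hS.measurable_all).pow_const 2).aestronglyMeasurable
    (Filter.Eventually.of_forall fun ω => ?_)
  rw [Real.norm_eq_abs, abs_of_nonneg (sq_nonneg _)]
  exact gradErr_sq_le h hd hν le_rfl one_pos n _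

lemma stationarity_nonneg (t : ℕ) (z : ℕ × Fin m → Ξ × E d) :
    0 ≤ stationarity p D m ν lam x₁ z t := sq_nonneg _

lemma measurable_stationarity (h : p.Admissible G L R D σ) (hd : 0 < d) (hD : 0 < D)
    (hx₁ : x₁ ∈ p.K) (hlam : ∀ t, Measurable fun q : E d × E d => lam t q.1 q.2) (n : ℕ) :
    Measurable fun z => stationarity p D m ν lam x₁ z (n + 1) := by
  have hx := (measurable_trajectory (m := m) (ν := ν) h hd hx₁ hlam n).1
  have ha := measurable_al (m := m) (ν := ν) h hd hx₁ hlam n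
  obtain ⟨F, hF, hFp⟩ := h.exists_measurable_prox hd
  have e : (fun z => stationarity p D m ν lam x₁ z (n + 1)) = fun z =>
      l1Norm ((al p m ν lam x₁ n z / (D + 1)) • (xs p m ν lam x₁ n z -
        F (xs p m ν lam x₁ n z, gradient p.l (xs p m ν lam x₁ n z), al p m ν lam x₁ n z))) ^ 2 := by
    ext1 z
    rw [hFp _ _ _ (xs_mem h hd hx₁ n z) (al_pos n z),
      ← prox_mul_symEntropy (c := D + 1) _ _ _ _ (by positivity)]
    rfl
  rw [e]
  have hg := (h.continuous_gradient_l hd).measurable.comp hx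
  exact (continuous_l1Norm.measurable.comp ((ha.div_const _).smul
    (hx.sub (hF.comp (hx.prodMk (hg.prodMk ha)))))).pow_const 2

lemma integrable_stationarity (hS : IsSampling p m T μ Z θ) (h : p.Admissible G L R D σ)
    (hd : 0 < d) (hD : 0 < D) (hν : 0 < ν) (hm : 0 < m) (hx₁ : x₁ ∈ p.K)
    (hlam : ∀ t, Measurable fun q : E d × E d => lam t q.1 q.2)
    (hlam' : ∀ t, ∀ x ∈ p.K, ∀ y ∈ p.K, 1 / (D + 1) ≤ lam t x y ∧ lam t x y ≤ 1) (n : ℕ) :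
    Integrable (fun ω => stationarity p D m ν lam x₁ (fun i => Z i ω) (n + 1)) μ := by
  refine (((integrable_stepSq (ν := ν) hS h hd hD hx₁ hlam hlam' n).const_mul 2).add
    ((integrable_gradErr_sq (ν := ν) hS h hd hν hm hx₁ hlam n).const_mul 2)).mono'
    ((measurable_stationarity h hd hD hx₁ hlam n).comp hS.measurable_all).aestronglyMeasurable
    (Filter.Eventually.of_forall fun ω => ?_)
  rw [Real.norm_eq_abs, abs_of_nonneg (stationarity_nonneg _ _)]
  exact stationarity_le h hd hD hx₁ n _

/-- The uniform random index averages the expectations over the iterations. -/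
lemma integral_stationarity_uniform (hS : IsSampling p m T μ Z θ) (h : p.Admissible G L R D σ)
    (hd : 0 < d) (hD : 0 < D) (hT : 1 ≤ T) (hν : 0 < ν) (hm : 0 < m) (hx₁ : x₁ ∈ p.K)
    (hlam : ∀ t, Measurable fun q : E d × E d => lam t q.1 q.2)
    (hlam' : ∀ t, ∀ x ∈ p.K, ∀ y ∈ p.K, 1 / (D + 1) ≤ lam t x y ∧ lam t x y ≤ 1) :
    Integrable (fun ω => stationarity p D m ν lam x₁ (fun i => Z i ω) (θ ω)) μ ∧
    ∫ ω, stationarity p D m ν lam x₁ (fun i => Z i ω) (θ ω) ∂μ =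
      (T : ℝ)⁻¹ * ∑ n ∈ Finset.range T,
        ∫ ω, stationarity p D m ν lam x₁ (fun i => Z i ω) (n + 1) ∂μ := by
  have := hS.prob
  have hmeas : ∀ t : ℕ, MeasurableSet (θ ⁻¹' {t}) := fun t =>
    hS.measurable_θ (measurableSet_singleton t)
  have hθ : ∀ᵐ ω ∂μ, θ ω ∈ Finset.Icc 1 T := by
    have h1 : μ (⋃ t ∈ Finset.Icc 1 T, θ ⁻¹' {t}) = 1 := by
      rw [measure_biUnion_finset (fun i _ j _ hij => Disjoint.preimage _
        (Set.disjoint_singleton.2 hij)) fun t _ => hmeas t, Finset.sum_congr rfl hS.law_θ]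
      simp only [Finset.sum_const, Nat.card_Icc, add_tsub_cancel_right, nsmul_eq_mul]
      exact ENNReal.mul_inv_cancel (by simp; lia) (by simp)
    have h2 := (prob_compl_eq_zero_iff
      (Finset.measurableSet_biUnion (Finset.Icc 1 T) fun t _ => hmeas t)).2 h1
    rw [ae_iff]
    refine measure_mono_null (fun ω hω => ?_) h2
    simp only [Set.mem_compl_iff, Set.mem_iUnion, not_exists]
    rintro t ht rfl
    exact hω ht
  set Y : ℕ → Ω → ℝ := fun t ω => stationarity p D m ν lam x₁ (fun i => Z i ω) t with hY
  have hYint : ∀ n, Integrable (Y (n + 1)) μ :=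
    integrable_stationarity hS h hd hD hν hm hx₁ hlam hlam'
  have hsplit : (fun ω => Y (θ ω) ω) =ᵐ[μ] fun ω => ∑ n ∈ Finset.range T,
      (θ ⁻¹' {n + 1}).indicator (fun _ => (1 : ℝ)) ω * Y (n + 1) ω := by
    filter_upwards [hθ] with ω hω
    obtain ⟨h1, h2⟩ := Finset.mem_Icc.1 hω
    rw [Finset.sum_eq_single (θ ω - 1)]
    · simp [Nat.sub_add_cancel h1]
    · intro n _ hn
      have : θ ω ≠ n + 1 := by lia
      simp [this]
    · intro hn
      simp only [Finset.mem_range] at hn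
      lia
  have hterm : ∀ n, Integrable (fun ω => (θ ⁻¹' {n + 1}).indicator (fun _ => (1 : ℝ)) ω *
      Y (n + 1) ω) μ := fun n => by
    refine ((hYint n).indicator (hmeas (n + 1))).congr (Filter.Eventually.of_forall fun ω => ?_)
    by_cases hω : ω ∈ θ ⁻¹' {n + 1}
    · simp only [Set.indicator_of_mem hω, one_mul]
    · simp only [Set.indicator_of_notMem hω, zero_mul]
  have hval : ∀ n ∈ Finset.range T, ∫ ω, (θ ⁻¹' {n + 1}).indicator (fun _ => (1 : ℝ)) ω *
      Y (n + 1) ω ∂μ = (T : ℝ)⁻¹ * ∫ ω, Y (n + 1) ω ∂μ := fun n hn => by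
    have hi : IndepFun (fun ω => (θ ⁻¹' {n + 1}).indicator (fun _ => (1 : ℝ)) ω) (Y (n + 1)) μ :=
      hS.indep_θ.comp (φ := ({n + 1} : Set ℕ).indicator fun _ => (1 : ℝ))
        (ψ := fun z => stationarity p D m ν lam x₁ z (n + 1)) (measurable_of_countable _)
        (measurable_stationarity h hd hD hx₁ hlam n)
    rw [hi.integral_fun_mul_eq_mul_integral
      ((measurable_const.indicator (hmeas _)).aestronglyMeasurable) (hYint n).aestronglyMeasurable]
    congr 1
    rw [integral_indicator (hmeas _)]
    simp [Measure.real, hS.law_θ (n + 1) (by simp at hn ⊢; lia)]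
  refine ⟨(integrable_finsetSum _ fun n _ => hterm n).congr hsplit.symm, ?_⟩
  rw [integral_congr_ae hsplit, integral_finsetSum _ fun n _ => hterm n,
    Finset.sum_congr rfl hval, Finset.mul_sum]

end Expectation


/-! ### The rate -/

/-- The bound of the error analysis as a function of the variance factor `κ`, in which it is,
up to a logarithm, linear; it is used with `κ = e (2 ln d - 1)`. -/
noncomputable def linRate (κ : ℝ) (T m : ℕ) (G L R D : ℝ) : ℝ :=
  16 * R ^ 2 * (T : ℝ) ^ (-(2 / 3) : ℝ)
  + (T : ℝ)⁻¹ * (4 + 32 * L ^ 2 * (D + 1) ^ 2)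
  + 2592 * κ * G ^ 2 * ((m : ℝ) ^ (-(1 / 3) : ℝ) * (T : ℝ) ^ (-(2 / 3) : ℝ))
  + 432 * κ * L ^ 2 * (T : ℝ) ^ (-(2 / 3) : ℝ)
  + 72 * L ^ 2 * (T : ℝ) ^ (-(2 / 3) : ℝ)
  + 648 / 5 * (κ * L ^ 2 * (D + 1) ^ 2 * (T : ℝ) ^ (-(2 / 3) : ℝ))
    * Real.posLog (324 / 5 * (κ * L ^ 2 * (D + 1) ^ 2 * (T : ℝ) ^ (2 / 3 : ℝ)))

/-- A logarithm with a large coefficient is absorbed by a linear term. -/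
lemma mul_log_one_add_le {A c : ℝ} (hA : 0 ≤ A) (hc : 0 ≤ c) :
    c * Real.log (1 + A) ≤ 1 + A + c * Real.posLog c := by
  rcases hc.eq_or_lt with rfl | hc
  · linarith
  have h1 := Real.log_le_sub_one_of_pos (by positivity : 0 < (1 + A) / c)
  rw [Real.log_div (by positivity) hc.ne'] at h1
  have h2 : Real.log c ≤ Real.posLog c := le_max_right _ _
  have h3 : c * Real.log (1 + A) ≤ c * ((1 + A) / c + Real.posLog c) := by
    gcongr
    linarith
  rwa [mul_add, mul_div_cancel₀ _ hc.ne'] at h3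

/-- The self-bounding inequality behind the rate, with `M = m^{-1/3} T^{1/3}` and `c = T^{1/3}`:
`a`, `w`, `s` and `ℓ` stand for the expectations of the total squared step, of the total squared
gradient error, of its fluctuating part, and of the logarithm of the total squared step. -/
lemma self_bounding {a w s ℓ κ G L R D c M Q b T m : ℝ} (hκ : 0 ≤ κ) (hm : 1 ≤ m) (hc : 1 ≤ c)
    (hM : 1 / m ≤ M) (hMc : M ≤ c) (hb : b ^ 2 ≤ 1) (hTb : T * b ^ 2 ≤ 1)
    (hQ : Q = 16 * G ^ 2 + 4 * L ^ 2 * b ^ 2) (hw0 : 0 ≤ w) (hℓ : 0 ≤ ℓ)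
    (hs : 3 * s ≤ κ / m * (Q * (9 / 2 + 12 * (m * M)) +
      16 * L ^ 2 * (c * ((D + 1) ^ 2 * ℓ) + c)))
    (hw : w ≤ 5 / 4 * s + 5 / 4 * (T * (L ^ 2 * b ^ 2)))
    (ha : a ≤ 1 / 2 + 4 * R ^ 2 * c + 4 * L ^ 2 * (D + 1) ^ 2 + 2 * w)
    (hlog : ∀ k, 0 ≤ k → k * ℓ ≤ 1 + a + k * Real.posLog k) :
    2 * a + 2 * w ≤ 16 * R ^ 2 * c + (4 + 32 * L ^ 2 * (D + 1) ^ 2) + 2592 * κ * G ^ 2 * M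
      + 432 * κ * L ^ 2 * c + 72 * L ^ 2 * c + 648 / 5 * (κ * L ^ 2 * (D + 1) ^ 2 * c)
      * Real.posLog (324 / 5 * (κ * L ^ 2 * (D + 1) ^ 2 * (c * c))) := by
  have hm0 : 0 < m := by linarith
  have hM0 : 0 ≤ M := le_trans (by positivity) hM
  have hκm : κ / m ≤ κ := div_le_self hκ hm
  have hκM : κ / m ≤ κ * M := by
    rw [div_eq_mul_one_div]
    gcongr
  set K := κ * L ^ 2 * (D + 1) ^ 2 * c with hK
  have hK0 : 0 ≤ K := by positivity
  have hQ0 : 0 ≤ Q := by rw [hQ]; positivity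
  have hQM : Q * M ≤ 16 * G ^ 2 * M + 4 * L ^ 2 * c := by
    have h1 : b ^ 2 * M ≤ 1 * c := by gcongr
    have h2 : 0 ≤ 4 * L ^ 2 := by positivity
    rw [hQ]
    nlinarith [mul_le_mul_of_nonneg_left h1 h2]
  have h1 : κ / m * (Q * (9 / 2 + 12 * (m * M)) + 16 * L ^ 2 * (c * ((D + 1) ^ 2 * ℓ) + c)) ≤
      33 / 2 * κ * (16 * G ^ 2 * M + 4 * L ^ 2 * c) + 16 * K * ℓ + 16 * κ * L ^ 2 * c := by
    have e1 : κ / m * (Q * (9 / 2 + 12 * (m * M)) + 16 * L ^ 2 * (c * ((D + 1) ^ 2 * ℓ) + c)) =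
        κ / m * (9 / 2 * Q) + 12 * κ * (Q * M) +
          κ / m * (16 * L ^ 2 * (c * ((D + 1) ^ 2 * ℓ) + c)) := by
      field_simp
    have h2 : κ / m * (9 / 2 * Q) ≤ κ * M * (9 / 2 * Q) := by gcongr
    have h3 : κ / m * (16 * L ^ 2 * (c * ((D + 1) ^ 2 * ℓ) + c)) ≤
        κ * (16 * L ^ 2 * (c * ((D + 1) ^ 2 * ℓ) + c)) := by gcongr
    have h4 := mul_le_mul_of_nonneg_left hQM hκ
    rw [e1, hK]
    linarith
  have hTL : T * (L ^ 2 * b ^ 2) ≤ L ^ 2 * c := by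
    have := mul_le_mul_of_nonneg_left (hTb.trans hc) (sq_nonneg L)
    linarith
  -- `2 a + 2 w` contains `6 w`, so the coefficient of `ℓ` is `6 · (5/4) · (1/3) · 16 K = 40 K`
  have h2 := hlog (40 * K) (by positivity)
  have h3 : Real.posLog (40 * K) ≤
      Real.posLog (324 / 5 * (κ * L ^ 2 * (D + 1) ^ 2 * (c * c))) := by
    refine Real.posLog_le_posLog (by positivity) ?_
    have : K * 1 ≤ K * c := by gcongr
    have e : κ * L ^ 2 * (D + 1) ^ 2 * (c * c) = K * c := by rw [hK]; ring
    rw [e]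
    linarith
  have h4 : 0 ≤ Real.posLog (324 / 5 * (κ * L ^ 2 * (D + 1) ^ 2 * (c * c))) := Real.posLog_nonneg
  set P := Real.posLog (324 / 5 * (κ * L ^ 2 * (D + 1) ^ 2 * (c * c)))
  have h5 : 40 * K * Real.posLog (40 * K) ≤ 40 * K * P := by gcongr
  have h6 : 0 ≤ K * P := by positivity
  have h7 : 0 ≤ L ^ 2 * c := by positivity
  have h8 : 0 ≤ κ * L ^ 2 * c := by positivity
  have h9 : 0 ≤ κ * G ^ 2 * M := by positivity
  have h10 : 0 ≤ L ^ 2 * (D + 1) ^ 2 := by positivity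
  linarith

section Rate

variable {d : ℕ} {Ξ : Type u} [MeasurableSpace Ξ] {p : Problem d Ξ} {m T : ℕ} {ν : ℝ}
  {lam : ℕ → E d → E d → ℝ} {x₁ : E d} {G L R D σ : ℝ} {Ω : Type v} [MeasurableSpace Ω]
  {μ : Measure Ω} {Z : ℕ × Fin m → Ω → Ξ × E d} {θ : Ω → ℕ}

/-- The total fluctuation of the gradient estimates over the first `T` iterations. -/
lemma sum_integral_lpSq_dev_le (hS : IsSampling p m T μ Z θ) (h : p.Admissible G L R D σ)
    (hd : 0 < d) (hD : 0 < D) (hT : 1 ≤ T) (hm : 1 ≤ m) (hx₁ : x₁ ∈ p.K)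
    (hlam : ∀ t, Measurable fun q : E d × E d => lam t q.1 q.2)
    (hlam' : ∀ t, ∀ x ∈ p.K, ∀ y ∈ p.K, 1 / (D + 1) ≤ lam t x y ∧ lam t x y ≤ 1)
    {b c q : ℝ} (hν : 0 < ν) (hb : ν * d ≤ b) (hbet : bet m (T + 1) ≤ c)
    (hcb : T * (c ^ 2 * b ^ 2) ≤ c) (hq : 1 < q) :
    3 * ∑ n ∈ Finset.range T, ∫ ω, lpSq q 0 (dev p m ν lam x₁ n fun i => Z i ω) ∂μ ≤
      (d : ℝ) ^ (1 / q) * (2 * q - 1) / m * ((16 * G ^ 2 + 4 * L ^ 2 * b ^ 2) *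
        (9 / 2 + 12 * (m * ((T : ℝ) / m) ^ (1 / 3 : ℝ))) + 16 * L ^ 2 * (c * ((D + 1) ^ 2 *
          ∫ ω, Real.log (1 + stepSum p m ν lam x₁ D T fun i => Z i ω) ∂μ) + c)) := by
  have := hS.prob
  have hd1 : (0 : ℝ) < d := by exact_mod_cast hd
  have hm1 : (0 : ℝ) < m := by exact_mod_cast hm
  have hκ : 0 ≤ (d : ℝ) ^ (1 / q) * (2 * q - 1) / m := by
    have : 0 ≤ 2 * q - 1 := by linarith
    positivity
  have hc1 : 1 ≤ c := (one_le_bet _ _).trans hbet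
  obtain ⟨N, rfl⟩ : ∃ N, T = N + 1 := ⟨T - 1, by lia⟩
  set W : ℕ → ℝ := fun n => ∫ ω, ‖xs p m ν lam x₁ (n + 1) (fun i => Z i ω) -
    xs p m ν lam x₁ n (fun i => Z i ω)‖ ^ 2 ∂μ with hW
  have hW0 : ∀ n, 0 ≤ W n := fun n => integral_nonneg fun ω => sq_nonneg _
  have hrec := sum_recursion_le hm (e := fun n => ∫ ω, lpSq q 0 (dev p m ν lam x₁ n
    fun i => Z i ω) ∂μ) (δ := fun n => 16 * L ^ 2 * (W n + b ^ 2)) hκ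
    (by positivity : 0 ≤ 16 * G ^ 2 + 4 * L ^ 2 * b ^ 2)
    (fun n => integral_nonneg fun ω => lpSq_nonneg le_rfl _)
    (fun n => by have := hW0 n; positivity)
    (integral_lpSq_dev_zero_le hS h hd hν hb hm hq)
    (fun n => integral_lpSq_dev_succ_le hS h hd hν hb hm hx₁ hlam hq n) N
  refine hrec.trans (mul_le_mul_of_nonneg_left (add_le_add ?_ ?_) hκ)
  · have := sum_one_div_tau_le hm (N + 1)
    exact mul_le_mul_of_nonneg_left (by linarith) (by positivity)
  have hbn : ∀ n ∈ Finset.range N, bet m (n + 2) ≤ c := fun n hn =>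
    (bet_mono m (by simp at hn; lia)).trans hbet
  have hdrift : ∑ n ∈ Finset.range N, bet m (n + 2) * W n ≤
      (D + 1) ^ 2 * ∫ ω, Real.log (1 + stepSum p m ν lam x₁ D (N + 1) fun i => Z i ω) ∂μ := by
    simp only [hW, ← integral_const_mul]
    have hi : ∀ n, Integrable (fun ω => bet m (n + 2) * ‖xs p m ν lam x₁ (n + 1) (fun i => Z i ω) -
        xs p m ν lam x₁ n (fun i => Z i ω)‖ ^ 2) μ := fun n =>
      (integrable_norm_xs_sub_sq hS h hd hx₁ hlam (n + 1) n).const_mul _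
    rw [← integral_finsetSum _ fun n _ => hi n]
    refine integral_mono (integrable_finsetSum _ fun n _ => hi n)
      ((integrable_log_one_add_stepSum hS h hd hD hx₁ hlam hlam' (N + 1)).const_mul _) fun ω => ?_
    have h0 := stepSum_nonneg (p := p) (ν := ν) (lam := lam) (x₁ := x₁) (D := D) N fun i => Z i ω
    have h1 := stepSum_mono (p := p) (m := m) (ν := ν) (lam := lam) (x₁ := x₁) (D := D)
      (Nat.le_succ N) fun i => Z i ω
    calc _ ≤ ∑ n ∈ Finset.range N, (D + 1) ^ 2 * (stepSq p m ν lam x₁ D n (fun i => Z i ω) /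
          (1 + stepSum p m ν lam x₁ D (n + 1) fun i => Z i ω)) :=
        Finset.sum_le_sum fun n _ => norm_xs_succ_sub_sq_le h hd hD hx₁ hlam' n _
      _ ≤ (D + 1) ^ 2 * Real.log (1 + stepSum p m ν lam x₁ D N fun i => Z i ω) := by
        rw [← Finset.mul_sum]
        exact mul_le_mul_of_nonneg_left (sum_stepSq_div_le N _) (sq_nonneg _)
      _ ≤ _ := mul_le_mul_of_nonneg_left (Real.log_le_log (by linarith)
        (by linarith)) (sq_nonneg _)
  calc ∑ n ∈ Finset.range N, bet m (n + 2) ^ 2 * (16 * L ^ 2 * (W n + b ^ 2))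
      ≤ ∑ n ∈ Finset.range N, 16 * L ^ 2 * (c * (bet m (n + 2) * W n) + c ^ 2 * b ^ 2) := by
        refine Finset.sum_le_sum fun n hn => ?_
        have h1 := hbn n hn
        have h2 := one_le_bet m (n + 2)
        have h3 : bet m (n + 2) * (bet m (n + 2) * W n) ≤ c * (bet m (n + 2) * W n) :=
          mul_le_mul_of_nonneg_right h1 (mul_nonneg (by linarith) (hW0 n))
        have h4 : bet m (n + 2) ^ 2 * b ^ 2 ≤ c ^ 2 * b ^ 2 := by gcongr
        have h5 := mul_le_mul_of_nonneg_left (add_le_add h3 h4)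
          (by positivity : 0 ≤ 16 * L ^ 2)
        linarith
    _ = 16 * L ^ 2 * (c * ∑ n ∈ Finset.range N, bet m (n + 2) * W n + N * (c ^ 2 * b ^ 2)) := by
        rw [← Finset.mul_sum, Finset.sum_add_distrib, ← Finset.mul_sum]
        simp
    _ ≤ _ := by
        have h1 : (N : ℝ) * (c ^ 2 * b ^ 2) ≤ c := by
          refine le_trans ?_ hcb
          gcongr
          simp
        gcongr

/-- The expected stationarity averaged over the first `T` iterations. -/
lemma sum_integral_stationarity_le (hS : IsSampling p m T μ Z θ) (h : p.Admissible G L R D σ)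
    (hd : 0 < d) (hD : 0 < D) (hT : 1 ≤ T) (hm : 1 ≤ m) (hx₁ : x₁ ∈ p.K)
    (hlam : ∀ t, Measurable fun q : E d × E d => lam t q.1 q.2)
    (hlam' : ∀ t, ∀ x ∈ p.K, ∀ y ∈ p.K, 1 / (D + 1) ≤ lam t x y ∧ lam t x y ≤ 1)
    (hν : 0 < ν) (hνT : ν ≤ (d : ℝ)⁻¹ * (T : ℝ) ^ (-(2 / 3) : ℝ)) {q : ℝ} (hq : 1 < q) :
    (T : ℝ)⁻¹ * ∑ n ∈ Finset.range T,
        ∫ ω, stationarity p D m ν lam x₁ (fun i => Z i ω) (n + 1) ∂μ ≤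
      linRate ((d : ℝ) ^ (1 / q) * (2 * q - 1)) T m G L R D := by
  have := hS.prob
  have hd1 : (0 : ℝ) < d := by exact_mod_cast hd
  have hm1 : (1 : ℝ) ≤ m := by exact_mod_cast hm
  have hT1 : (1 : ℝ) ≤ T := by exact_mod_cast hT
  have hT0 : (0 : ℝ) < T := by linarith
  have hm0 : (0 : ℝ) < m := by linarith
  have hκ : 0 ≤ (d : ℝ) ^ (1 / q) * (2 * q - 1) := by
    have : 0 ≤ 2 * q - 1 := by linarith
    positivity
  set b := (T : ℝ) ^ (-(2 / 3) : ℝ) with hbdef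
  set c := (T : ℝ) ^ (1 / 3 : ℝ) with hcdef
  have hc1 : 1 ≤ c := Real.one_le_rpow hT1 (by norm_num)
  have hb : ν * d ≤ b := by
    calc ν * d ≤ (d : ℝ)⁻¹ * b * d := by gcongr
      _ = b := by field_simp
  have hb1 : b ≤ 1 := Real.rpow_le_one_of_one_le_of_nonpos hT1 (by norm_num)
  have hb0 : 0 ≤ b := by positivity
  have hTb : T * b = c := by
    rw [hbdef, hcdef]
    nth_rewrite 1 [← Real.rpow_one (T : ℝ)]
    rw [← Real.rpow_add hT0]
    norm_num
  have hcc : c * c = (T : ℝ) ^ (2 / 3 : ℝ) := by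
    rw [hcdef, ← Real.rpow_add hT0]
    norm_num
  have hccb : c ^ 2 * b = 1 := by
    rw [pow_two, hcc, hbdef, ← Real.rpow_add hT0]
    norm_num
  have hcb1 : c * b ≤ 1 := by nlinarith
  have hmM : ((T : ℝ) / m) ^ (1 / 3 : ℝ) = (m : ℝ) ^ (-(1 / 3) : ℝ) * c := by
    rw [Real.div_rpow hT0.le hm0.le, Real.rpow_neg hm0.le, hcdef, div_eq_inv_mul]
  set M := ((T : ℝ) / m) ^ (1 / 3 : ℝ) with hMdef
  have hm3 : (m : ℝ) ^ (-(1 / 3) : ℝ) ≤ 1 :=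
    Real.rpow_le_one_of_one_le_of_nonpos hm1 (by norm_num)
  have hm3' : 1 / (m : ℝ) ≤ (m : ℝ) ^ (-(1 / 3) : ℝ) := by
    rw [one_div, ← Real.rpow_neg_one]
    exact Real.rpow_le_rpow_of_exponent_le hm1 (by norm_num)
  have hm30 : 0 ≤ (m : ℝ) ^ (-(1 / 3) : ℝ) := by positivity
  have hbet : bet m (T + 1) ≤ c := bet_succ_le hm hT
  have iS := integrable_stepSum (ν := ν) hS h hd hD hx₁ hlam hlam' T
  have iG : ∀ n, Integrable (fun ω => gradErr p m ν lam x₁ n (fun i => Z i ω) ^ 2) μ :=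
    integrable_gradErr_sq hS h hd hν hm hx₁ hlam
  have iD : ∀ n, Integrable (fun ω => lpSq q 0 (dev p m ν lam x₁ n fun i => Z i ω)) μ :=
    integrable_lpSq_dev hS h hd hν hm hx₁ hlam (by linarith)
  have iW : Integrable (fun ω => ∑ n ∈ Finset.range T,
    gradErr p m ν lam x₁ n (fun i => Z i ω) ^ 2) μ := integrable_finsetSum _ fun n _ => iG n
  have iL := integrable_log_one_add_stepSum (ν := ν) hS h hd hD hx₁ hlam hlam' T
  set a := ∫ ω, stepSum p m ν lam x₁ D T (fun i => Z i ω) ∂μ with ha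
  set w := ∫ ω, ∑ n ∈ Finset.range T, gradErr p m ν lam x₁ n (fun i => Z i ω) ^ 2 ∂μ with hw
  set ℓ := ∫ ω, Real.log (1 + stepSum p m ν lam x₁ D T fun i => Z i ω) ∂μ with hℓ
  have hS0 := fun ω => stepSum_nonneg (p := p) (ν := ν) (lam := lam) (x₁ := x₁) (D := D) T
    fun i => Z i ω
  have hmain := self_bounding (a := a) (w := w)
    (s := ∑ n ∈ Finset.range T, ∫ ω, lpSq q 0 (dev p m ν lam x₁ n fun i => Z i ω) ∂μ) (ℓ := ℓ)
    (κ := (d : ℝ) ^ (1 / q) * (2 * q - 1)) (G := G) (L := L) (R := R) (D := D) (c := c) (M := M)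
    (b := b) (T := T) (m := m) hκ hm1 hc1
    (by
      rw [hmM]
      calc 1 / (m : ℝ) ≤ (m : ℝ) ^ (-(1 / 3) : ℝ) * 1 := by rwa [mul_one]
        _ ≤ _ := by gcongr)
    (by
      rw [hmM]
      calc _ ≤ 1 * c := by gcongr
        _ = c := one_mul c)
    (pow_le_one₀ hb0 hb1)
    (by
      have e : T * b ^ 2 = c * b := by rw [← hTb]; ring
      rw [e]
      exact hcb1)
    rfl
    (integral_nonneg fun ω => Finset.sum_nonneg fun n _ => sq_nonneg _)
    (integral_nonneg fun ω => Real.log_nonneg (by linarith [hS0 ω]))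
    (sum_integral_lpSq_dev_le hS h hd hD hT hm hx₁ hlam hlam' hν hb hbet
      (by
        have e : T * (c ^ 2 * b ^ 2) = T * b * (c ^ 2 * b) := by ring
        rw [e, hccb, hTb, mul_one]) hq)
    (by
      rw [hw, integral_finsetSum _ fun n _ => iG n]
      have h1 : ∀ n ∈ Finset.range T, ∫ ω, gradErr p m ν lam x₁ n (fun i => Z i ω) ^ 2 ∂μ ≤
          5 / 4 * ∫ ω, lpSq q 0 (dev p m ν lam x₁ n fun i => Z i ω) ∂μ +
            5 / 4 * (L ^ 2 * b ^ 2) := fun n _ => by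
        have h2 := integral_mono (iG n) (((iD n).const_mul (5 / 4)).add (integrable_const _))
          fun ω => gradErr_sq_le h hd hν hb (by linarith) n fun i => Z i ω
        rw [integral_add' ((iD n).const_mul (5 / 4)) (integrable_const _), integral_const_mul] at h2
        simpa using h2
      refine (Finset.sum_le_sum h1).trans (le_of_eq ?_)
      rw [Finset.sum_add_distrib, ← Finset.mul_sum]
      simp
      ring)
    (by
      have h1 := integral_mono iS ((integrable_const (1 / 2 + 4 * R ^ 2 * c +
        4 * L ^ 2 * (D + 1) ^ 2)).add (iW.const_mul 2))
        fun ω => stepSum_le h hd hD hx₁ hlam' (by linarith) hbet fun i => Z i ω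
      rw [integral_add' (integrable_const _) (iW.const_mul 2), integral_const_mul] at h1
      simpa using h1)
    (fun k hk => by
      have h1 := integral_mono (iL.const_mul k) (((integrable_const (1 : ℝ)).add iS).add
        (integrable_const (k * Real.posLog k))) fun ω => mul_log_one_add_le (hS0 ω) hk
      rw [integral_add' ((integrable_const (1 : ℝ)).add iS) (integrable_const _),
        integral_add' (integrable_const _) iS, integral_const_mul] at h1
      simpa using h1)
  have hsum : ∑ n ∈ Finset.range T, ∫ ω, stationarity p D m ν lam x₁ (fun i => Z i ω) (n + 1) ∂μ ≤
      2 * a + 2 * w := by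
    have iY := integrable_stationarity (ν := ν) hS h hd hD hν hm hx₁ hlam hlam'
    rw [← integral_finsetSum _ fun n _ => iY n, ha, hw, ← integral_const_mul, ← integral_const_mul,
      ← integral_add (iS.const_mul 2) (iW.const_mul 2)]
    refine integral_mono (integrable_finsetSum _ fun n _ => iY n)
      ((iS.const_mul 2).add (iW.const_mul 2)) fun ω => ?_
    refine (Finset.sum_le_sum fun n _ => stationarity_le h hd hD hx₁ n fun i => Z i ω).trans
      (le_of_eq ?_)
    rw [Finset.sum_add_distrib, ← Finset.mul_sum, ← Finset.mul_sum]
    rfl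
  have h1 := mul_le_mul_of_nonneg_left (hsum.trans hmain) (inv_nonneg.2 hT0.le)
  refine h1.trans (le_of_eq ?_)
  rw [linRate, ← hbdef, ← hcc, hmM, ← hTb]
  field_simp

end Rate


/-! ### Consequences of the rate -/

lemma one_lt_log_of_three_le {d : ℕ} (hd : 3 ≤ d) : 1 < Real.log d := by
  have h3 : (3 : ℝ) ≤ d := by exact_mod_cast hd
  rw [Real.lt_log_iff_exp_lt (by linarith)]
  exact Real.exp_one_lt_three.trans_le h3

/-- With the exponent `q = ln d` the `ℓ_{2q}` norm is equivalent to the maximum norm up to the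
constant `d^{1/q} = e`. -/
lemma guarantee_linRate {d T m : ℕ} {G L R D σ : ℝ} (hD : 0 < D) (hd : 3 ≤ d) (hT : 1 ≤ T)
    (hm : 1 ≤ m) :
    Guarantee.{u, v} d T m G L R D σ
      (linRate (Real.exp 1 * (2 * Real.log d - 1)) T m G L R D) (4 * m * T) := by
  intro Ξ _ p h x₁ hx₁ ν hν hνT lam hlam hlam' Ω _ μ Z θ hS
  have hd0 : 0 < d := by lia
  obtain ⟨h1, h2⟩ := integral_stationarity_uniform (ν := ν) hS h hd0 hD hT hν hm hx₁ hlam hlam'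
  refine ⟨h1, ?_, fun ω => ?_⟩
  · have h3 := sum_integral_stationarity_le hS h hd0 hD hT hm hx₁ hlam hlam' hν hνT
      (one_lt_log_of_three_le hd)
    have h4 : (d : ℝ) ≠ 1 := by
      have : (3 : ℝ) ≤ d := by exact_mod_cast hd
      linarith
    rwa [one_div, Real.rpow_inv_log (by exact_mod_cast hd0) h4, ← h2] at h3
  · exact_mod_cast run_calls_le (p := p) (ν := ν) (lam := lam) (x₁ := x₁) (fun i => Z i ω) T

lemma Guarantee.mono {d T m : ℕ} {G L R D σ b b' N N' : ℝ}
    (h : Guarantee.{u, v} d T m G L R D σ b N) (hb : b ≤ b') (hN : N ≤ N') :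
    Guarantee.{u, v} d T m G L R D σ b' N' := by
  intro Ξ _ p hp x₁ hx₁ ν hν hνT lam hlam hlam' Ω _ μ Z θ hS
  obtain ⟨h1, h2, h3⟩ := h Ξ p hp x₁ hx₁ ν hν hνT lam hlam hlam' Ω μ Z θ hS
  exact ⟨h1, h2.trans hb, fun ω => (h3 ω).trans hN⟩

lemma linRate_le_rateBound {d T m : ℕ} {G L R D σ : ℝ} (hR : 0 < R) (hd : 3 ≤ d) :
    linRate (Real.exp 1 * (2 * Real.log d - 1)) T m G L R D ≤ rateBound d T m G L R D σ := by
  have hℓ := one_lt_log_of_three_le hd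
  have he : 1 ≤ Real.exp 1 := Real.one_le_exp (by norm_num)
  have e1 : 324 * (D + 1) ^ 2 * L ^ 2 * Real.exp 1 * (2 * Real.log d - 1) *
      (T : ℝ) ^ (2 / 3 : ℝ) / 5 = 324 / 5 * (Real.exp 1 * (2 * Real.log d - 1) * L ^ 2 *
        (D + 1) ^ 2 * (T : ℝ) ^ (2 / 3 : ℝ)) := by ring
  rw [linRate, rateBound, e1]
  set P := Real.posLog (324 / 5 * (Real.exp 1 * (2 * Real.log d - 1) * L ^ 2 *
        (D + 1) ^ 2 * (T : ℝ) ^ (2 / 3 : ℝ)))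
  have hκ : 1 ≤ Real.exp 1 * (2 * Real.log d - 1) := one_le_mul_of_one_le_of_one_le he (by linarith)
  have e2 : Real.exp 1 ^ 2 * (4 * Real.log d - 2) ^ 2 =
      4 * (Real.exp 1 * (2 * Real.log d - 1)) ^ 2 := by ring
  set u := (T : ℝ) ^ (-(2 / 3) : ℝ)
  set M := (m : ℝ) ^ (-(1 / 3) : ℝ)
  have e3 : 648 * Real.exp 1 ^ 2 * (4 * Real.log d - 2) ^ 2 * (5 * G ^ 2 + 4 * σ ^ 2) * M * u / 5 =
      2592 * (Real.exp 1 * (2 * Real.log d - 1)) ^ 2 * (G ^ 2 * (M * u)) +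
        2592 * 4 / 5 * (Real.exp 1 * (2 * Real.log d - 1)) ^ 2 * (σ ^ 2 * (M * u)) := by
    linear_combination 648 / 5 * (5 * G ^ 2 + 4 * σ ^ 2) * M * u * e2
  rw [e3]
  have hκ2 : Real.exp 1 * (2 * Real.log d - 1) ≤ (Real.exp 1 * (2 * Real.log d - 1)) ^ 2 := by
    nlinarith
  set κ := Real.exp 1 * (2 * Real.log d - 1) with hκdef
  have hu : 0 ≤ u := by positivity
  have hM : 0 ≤ M := by positivity
  have h1 : 2592 * κ * (G ^ 2 * (M * u)) ≤ 2592 * κ ^ 2 * (G ^ 2 * (M * u)) := by gcongr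
  have h2 : 0 ≤ κ ^ 2 * (σ ^ 2 * (M * u)) := by positivity
  have h3 : 0 ≤ (T : ℝ)⁻¹ * R := by positivity
  have e4 : 2160 * Real.exp 1 * (2 * Real.log d - 1) * L ^ 2 * u / 5 = 432 * κ * L ^ 2 * u := by
    rw [hκdef]; ring
  have e5 : 648 * (D + 1) ^ 2 * L ^ 2 * Real.exp 1 * (2 * Real.log d - 1) * u / 5 * P =
      648 / 5 * (κ * L ^ 2 * (D + 1) ^ 2 * u) * P := by
    rw [hκdef]; ring
  rw [e4, e5]
  linarith

/-- The rate up to constants; the dependence on `ln d` is linear up to a logarithm. -/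
lemma exists_linRate_le (G L R D : ℝ) : ∃ C : ℝ, 1 ≤ C ∧ ∀ d T m : ℕ, 3 ≤ d → 1 ≤ T → 1 ≤ m →
    linRate (Real.exp 1 * (2 * Real.log d - 1)) T m G L R D ≤
      C * ((T : ℝ) ^ (-(2 / 3) : ℝ) *
        (Real.log d * (1 + Real.log (Real.log d) + Real.log T))) := by
  set B := L ^ 2 * (D + 1) ^ 2 with hB
  have hB0 : 0 ≤ B := by positivity
  have hp0 : 0 ≤ Real.posLog (1944 / 5 * B) := Real.posLog_nonneg
  refine ⟨16 * R ^ 2 + (4 + 32 * B) + 2592 * 6 * G ^ 2 + 432 * 6 * L ^ 2 + 72 * L ^ 2 +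
    648 / 5 * 6 * B * (1 + Real.posLog (1944 / 5 * B)), ?_, fun d T m hd hT hm => ?_⟩
  · have h1 : 0 ≤ B * (1 + Real.posLog (1944 / 5 * B)) := by positivity
    linarith [sq_nonneg R, sq_nonneg G, sq_nonneg L]
  have hT1 : (1 : ℝ) ≤ T := by exact_mod_cast hT
  have hT0 : (0 : ℝ) < T := by linarith
  have hm1 : (1 : ℝ) ≤ m := by exact_mod_cast hm
  have hℓ := one_lt_log_of_three_le hd
  set ℓ := Real.log d
  have hℓ0 : 0 < ℓ := by linarith
  have hlogℓ : 0 ≤ Real.log ℓ := Real.log_nonneg hℓ.le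
  have hlogT : 0 ≤ Real.log T := Real.log_nonneg hT1
  have he := Real.exp_one_lt_three
  have he0 := Real.exp_pos 1
  have hκ0 : 0 ≤ Real.exp 1 * (2 * ℓ - 1) := mul_nonneg he0.le (by linarith)
  have hκ : Real.exp 1 * (2 * ℓ - 1) ≤ 6 * ℓ := by nlinarith
  rw [linRate]
  set κ := Real.exp 1 * (2 * ℓ - 1)
  have hTu : (T : ℝ)⁻¹ ≤ (T : ℝ) ^ (-(2 / 3) : ℝ) := by
    rw [← Real.rpow_neg_one]
    exact Real.rpow_le_rpow_of_exponent_le hT1 (by norm_num)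
  have hM : (m : ℝ) ^ (-(1 / 3) : ℝ) ≤ 1 :=
    Real.rpow_le_one_of_one_le_of_nonpos hm1 (by norm_num)
  have hM0 : 0 ≤ (m : ℝ) ^ (-(1 / 3) : ℝ) := by positivity
  have hlog : Real.posLog (324 / 5 * (κ * L ^ 2 * (D + 1) ^ 2 * (T : ℝ) ^ (2 / 3 : ℝ))) ≤
      Real.posLog (1944 / 5 * B) + Real.log ℓ + Real.log T := by
    have h1 : 324 / 5 * (κ * L ^ 2 * (D + 1) ^ 2 * (T : ℝ) ^ (2 / 3 : ℝ)) ≤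
        1944 / 5 * B * (ℓ * T) := by
      have h2 : (T : ℝ) ^ (2 / 3 : ℝ) ≤ T := by
        calc _ ≤ (T : ℝ) ^ (1 : ℝ) := Real.rpow_le_rpow_of_exponent_le hT1 (by norm_num)
          _ = T := Real.rpow_one _
      have h3 : κ * L ^ 2 * (D + 1) ^ 2 * (T : ℝ) ^ (2 / 3 : ℝ) ≤
          6 * ℓ * L ^ 2 * (D + 1) ^ 2 * T := by gcongr
      rw [hB]
      linarith
    refine (Real.posLog_le_posLog (by positivity) h1).trans (Real.posLog_mul.trans ?_)
    have h4 : 1 ≤ ℓ * T := one_le_mul_of_one_le_of_one_le hℓ.le hT1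
    rw [Real.posLog_eq_log (h4.trans (le_abs_self _)), Real.log_mul hℓ0.ne' hT0.ne']
    linarith
  set u := (T : ℝ) ^ (-(2 / 3) : ℝ)
  have hu : 0 ≤ u := by positivity
  set Λ := 1 + Real.log ℓ + Real.log T with hΛ
  have hΛ1 : 1 ≤ Λ := by linarith
  have hP0 : 0 ≤ Real.posLog (324 / 5 * (κ * L ^ 2 * (D + 1) ^ 2 * (T : ℝ) ^ (2 / 3 : ℝ))) :=
    Real.posLog_nonneg
  set P := Real.posLog (324 / 5 * (κ * L ^ 2 * (D + 1) ^ 2 * (T : ℝ) ^ (2 / 3 : ℝ)))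
  set p := Real.posLog (1944 / 5 * B)
  have hPΛ : P ≤ (1 + p) * Λ := by nlinarith
  have hκΛ : κ ≤ 6 * (ℓ * Λ) := by nlinarith
  have hℓΛ : 1 ≤ ℓ * Λ := one_le_mul_of_one_le_of_one_le hℓ.le hΛ1
  have hu1 : u ≤ u * (ℓ * Λ) := le_mul_of_one_le_right hu hℓΛ
  have g1 : 16 * R ^ 2 * u ≤ 16 * R ^ 2 * (u * (ℓ * Λ)) := by gcongr
  have g2 : (T : ℝ)⁻¹ * (4 + 32 * L ^ 2 * (D + 1) ^ 2) ≤ (u * (ℓ * Λ)) * (4 + 32 * B) := by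
    have e : 4 + 32 * L ^ 2 * (D + 1) ^ 2 = 4 + 32 * B := by rw [hB]; ring
    rw [e]
    have := hTu.trans hu1
    gcongr
  have g3 : 2592 * κ * G ^ 2 * ((m : ℝ) ^ (-(1 / 3) : ℝ) * u) ≤
      2592 * (6 * (ℓ * Λ)) * G ^ 2 * (1 * u) := by gcongr
  have g4 : 432 * κ * L ^ 2 * u ≤ 432 * (6 * (ℓ * Λ)) * L ^ 2 * u := by gcongr
  have g5 : 72 * L ^ 2 * u ≤ 72 * L ^ 2 * (u * (ℓ * Λ)) := by gcongr
  have g6 : 648 / 5 * (κ * L ^ 2 * (D + 1) ^ 2 * u) * P ≤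
      648 / 5 * (6 * ℓ * L ^ 2 * (D + 1) ^ 2 * u) * ((1 + p) * Λ) := by gcongr
  have e6 : 648 / 5 * (6 * ℓ * L ^ 2 * (D + 1) ^ 2 * u) * ((1 + p) * Λ) =
      648 / 5 * 6 * B * (1 + p) * (u * (ℓ * Λ)) := by rw [hB]; ring
  rw [e6] at g6
  linarith

/-- The choice of the number of iterations: with `X = 20 C (ln d)^{2/3} (1 + ln (1/ε)) / ε` the
number `T = ⌈X³⌉` brings the rate below `ε²`. -/
lemma exists_iterations {C ℓ ε : ℝ} (hC : 1 ≤ C) (hℓ : 1 ≤ ℓ) (hε : 0 < ε) (hε1 : ε ≤ 1) :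
    ∃ T : ℕ, 1 ≤ T ∧
      C * ((T : ℝ) ^ (-(2 / 3) : ℝ) * (ℓ * (1 + Real.log ℓ + Real.log T))) ≤ ε ^ 2 ∧
      (T : ℝ) ≤ 2 * (20 * C) ^ 3 * ℓ ^ 2 / ε ^ 3 * (1 + Real.log (1 / ε)) ^ 3 := by
  have hℓ0 : 0 < ℓ := by linarith
  set s := ℓ ^ (1 / 3 : ℝ) with hs
  have hs1 : 1 ≤ s := Real.one_le_rpow hℓ (by norm_num)
  have hsℓ : s ^ 3 = ℓ := by
    rw [hs, ← Real.rpow_natCast, ← Real.rpow_mul hℓ0.le]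
    norm_num
  set Λ := 1 + Real.log (1 / ε) with hΛ
  have hΛ1 : 1 ≤ Λ := by
    have := Real.log_nonneg (one_le_one_div hε hε1)
    linarith
  set y := 20 * C with hy
  set X := y * s ^ 2 * (1 / ε) * Λ with hX
  have hs0 : 0 < s := by linarith
  have hΛ0 : 0 < Λ := by linarith
  have hy1 : 1 ≤ y := by linarith
  have hy0 : 0 < y := by linarith
  have hX1 : 1 ≤ X := one_le_mul_of_one_le_of_one_le (one_le_mul_of_one_le_of_one_le
    (one_le_mul_of_one_le_of_one_le hy1 (one_le_pow₀ hs1)) (one_le_one_div hε hε1)) hΛ1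
  have hX0 : 0 < X := by linarith
  have hX3 : 1 ≤ X ^ 3 := one_le_pow₀ hX1
  refine ⟨⌈X ^ 3⌉₊, Nat.one_le_ceil_iff.2 (by linarith), ?_, ?_⟩
  · have hT := Nat.le_ceil (X ^ 3)
    have hT2 : (⌈X ^ 3⌉₊ : ℝ) ≤ 2 * X ^ 3 := by
      have := (Nat.ceil_lt_add_one (by linarith : 0 ≤ X ^ 3)).le
      linarith
    set T : ℝ := (⌈X ^ 3⌉₊ : ℝ)
    have hT0 : 0 < T := by linarith
    have hpow : T ^ (-(2 / 3) : ℝ) ≤ (X ^ 2)⁻¹ := by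
      rw [Real.rpow_neg hT0.le]
      gcongr
      calc X ^ 2 = (X ^ 3) ^ (2 / 3 : ℝ) := by
            rw [← Real.rpow_natCast X 3, ← Real.rpow_mul hX0.le, ← Real.rpow_natCast]
            norm_num
        _ ≤ _ := by gcongr
    have hlogX : Real.log X ≤ y + 2 * s + (Λ - 1) + Λ := by
      rw [hX, Real.log_mul (by positivity) hΛ0.ne', Real.log_mul (by positivity) (by positivity),
        Real.log_mul hy0.ne' (by positivity), Real.log_pow]
      have h1 := Real.log_le_self hy0.le
      have h2 := Real.log_le_self hs0.le
      have h3 := Real.log_le_self hΛ0.le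
      push_cast
      linarith
    have hlogT : Real.log T ≤ 1 + 3 * Real.log X := by
      have h1 := Real.log_le_log hT0 hT2
      rw [Real.log_mul two_ne_zero (by positivity), Real.log_pow] at h1
      have h2 := Real.log_le_sub_one_of_pos (two_pos : (0 : ℝ) < 2)
      push_cast at h1
      linarith
    -- powers of `s = ℓ^{1/3}` absorb `ln ℓ`: the rate needs only `ℓ^{3/2}` iterations up to
    -- logarithms, and `ℓ²` are spent
    have hlogℓ : Real.log ℓ ≤ 3 * s := by
      rw [← hsℓ, Real.log_pow]
      have h2 := Real.log_le_self hs0.le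
      push_cast
      linarith
    have hlog : 1 + Real.log ℓ + Real.log T ≤ (3 * y + 17) * (s * Λ) := by
      have h1 : 1 + Real.log ℓ + Real.log T ≤ 3 * y + 9 * s + 6 * Λ := by linarith
      have h2 : s ≤ s * Λ := le_mul_of_one_le_right hs0.le hΛ1
      have h3 : Λ ≤ s * Λ := le_mul_of_one_le_left hΛ0.le hs1
      have h4 : y ≤ y * (s * Λ) := le_mul_of_one_le_right hy0.le (by linarith)
      linarith
    have hpos : 0 ≤ 1 + Real.log ℓ + Real.log T := by
      have h1 := Real.log_nonneg hℓ
      have h2 := Real.log_nonneg (hX3.trans hT)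
      linarith
    calc C * (T ^ (-(2 / 3) : ℝ) * (ℓ * (1 + Real.log ℓ + Real.log T)))
        ≤ C * ((X ^ 2)⁻¹ * (ℓ * ((3 * y + 17) * (s * Λ)))) := by gcongr
      _ = ε ^ 2 * (C * (3 * y + 17) / (y ^ 2 * Λ)) := by
          rw [← hsℓ, hX]
          field_simp
      _ ≤ ε ^ 2 * 1 := by
          gcongr
          rw [div_le_one (by positivity)]
          have h1 : C * (3 * y + 17) ≤ y ^ 2 * 1 := by rw [hy]; nlinarith
          exact h1.trans (by gcongr)
      _ = ε ^ 2 := mul_one _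
  · calc (⌈X ^ 3⌉₊ : ℝ) ≤ X ^ 3 + 1 := (Nat.ceil_lt_add_one (by linarith)).le
      _ ≤ 2 * X ^ 3 := by linarith
      _ = 2 * y ^ 3 * ℓ ^ 2 / ε ^ 3 * Λ ^ 3 := by
          rw [← hsℓ, hX]
          field_simp

end ZOExpStorm

theorem mainTheorem1 (G L R D σ : ℝ) (hR : 0 < R) (hD : 0 < D) :
    (∀ d T m : ℕ, 3 ≤ d → 1 ≤ T → 1 ≤ m →
      ZOExpStorm.Guarantee.{u, v} d T m G L R D σ
        (ZOExpStorm.rateBound d T m G L R D σ) (4 * m * T)) ∧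
    (∃ C : ℝ, ∀ d T m : ℕ, 3 ≤ d → 1 ≤ T → 1 ≤ m →
      ZOExpStorm.Guarantee.{u, v} d T m G L R D σ
        (C * (Real.log d) ^ 2 * (T : ℝ) ^ (-(2 / 3) : ℝ) * (1 + Real.log T)) (4 * m * T)) ∧
    (∃ (C : ℝ) (k : ℕ), ∀ d : ℕ, 3 ≤ d → ∀ ε : ℝ, 0 < ε → ε ≤ 1 →
      ∃ T m : ℕ, 1 ≤ T ∧ 1 ≤ m ∧
        ZOExpStorm.Guarantee.{u, v} d T m G L R D σ (ε ^ 2)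
          (C * (Real.log d) ^ 2 / ε ^ 3 * (1 + Real.log (1 / ε)) ^ k)) := by
  obtain ⟨C, hC1, hC⟩ := ZOExpStorm.exists_linRate_le G L R D
  refine ⟨fun d T m hd hT hm => (ZOExpStorm.guarantee_linRate hD hd hT hm).mono
    (ZOExpStorm.linRate_le_rateBound hR hd) le_rfl, ⟨C, fun d T m hd hT hm => ?_⟩,
    8 * (20 * C) ^ 3, 3, fun d hd ε hε hε1 => ?_⟩
  · refine (ZOExpStorm.guarantee_linRate hD hd hT hm).mono ((hC d T m hd hT hm).trans ?_) le_rfl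
    have hℓ := ZOExpStorm.one_lt_log_of_three_le hd
    have h1 := Real.log_le_sub_one_of_pos (by linarith : 0 < Real.log d)
    have hT1 : 0 ≤ Real.log T := Real.log_nonneg (by exact_mod_cast hT)
    have h2 : Real.log d * (1 + Real.log (Real.log d) + Real.log T) ≤
        Real.log d * (Real.log d * (1 + Real.log T)) := by
      gcongr
      nlinarith
    calc _ ≤ C * ((T : ℝ) ^ (-(2 / 3) : ℝ) * (Real.log d * (Real.log d * (1 + Real.log T)))) := by
          gcongr
      _ = _ := by ring
  · obtain ⟨T, hT, h1, h2⟩ := ZOExpStorm.exists_iterations hC1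
      (ZOExpStorm.one_lt_log_of_three_le hd).le hε hε1
    refine ⟨T, 1, hT, le_rfl, (ZOExpStorm.guarantee_linRate hD hd hT le_rfl).mono
      ((hC d T 1 hd hT le_rfl).trans h1) ?_⟩
    push_cast
    calc 4 * 1 * (T : ℝ) ≤ 4 * 1 * _ := mul_le_mul_of_nonneg_left h2 (by norm_num)
      _ = _ := by ring
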